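/- Let $n\ge 3$ and $m\ge 0$ be integers, and let $$T\mathbb S^{n-1}=\{(x,\xi)\in\mathbb R^n\times\mathbb R^n : |\xi|=1,\ \langle x,\xi\rangle=0\}.$$ A function $\varphi\in C^\infty(T\mathbb S^{n-1};\mathbb C)$ is extended to $\mathbb R^n\times(\mathbb R^n\setminus\{0\})$ by $$\varphi(x,\xi)=\varphi\Big(x-\frac{\langle x,\xi\rangle}{|\xi|^2}\xi,\ \frac{\xi}{|\xi|}\Big).$$ It belongs to the Schwartz space $\mathcal S(T\mathbb S^{n-1})$ if $\sup_{(x,\xi)\in T\mathbb S^{n-1}}(1+|x|)^k|\partial_x^\alpha\partial_\xi^\beta\varphi(x,\xi)|<\infty$ for all $k\in\mathbb N$ and all multi-indices $\alpha,\beta$. Let $\mathcal S_{\pi(m)}(T\mathbb S^{n-1})$ be the subspace of those $\varphi\in\mathcal S(T\mathbb S^{n-1})$ for which $\varphi(x,-\xi)=(-1)^m\varphi(x,\xi)$. Let $\mathcal S(\mathbb R^n;S^m\mathbb R^n)$ be the space of complex symmetric $m$-tensor fields $f=(f_{i_1\dots i_m})$ on $\mathbb R^n$ whose components are Schwartz functions,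 and let the ray transform $I:\mathcal S(\mathbb R^n;S^m\mathbb R^n)\to\mathcal S(T\mathbb S^{n-1})$ be $$If(x,\xi)=\int_{-\infty}^{\infty}\ \sum_{i_1,\dots,i_m=1}^n f_{i_1\dots i_m}(x+t\xi)\,\xi_{i_1}\cdots\xi_{i_m}\,dt .$$ For $1\le i\le n$ let $X_i$ and $\Xi_i$ be the restrictions to $T\mathbb S^{n-1}$ of the vector fields $$\widetilde X_i=\frac{\partial}{\partial x_i}-\xi_i\sum_{p=1}^n\xi_p\frac{\partial}{\partial x_p},\qquad \widetilde\Xi_i=\frac{\partial}{\partial \xi_i}-x_i\sum_{p=1}^n\xi_p\frac{\partial}{\partial x_p}-\xi_i\sum_{p=1}^n\xi_p\frac{\partial}{\partial \xi_p},$$ which are tangent to $T\mathbb S^{n-1}$ at its points, and let $\mathcal J_{ij}=X_i\Xi_j-X_j\Xi_i$. **Theorem.** A function $\varphi\in\mathcal S_{\pi(m)}(T\mathbb S^{n-1})$ belongs to the range of $I$ (that is, $\varphi=If$ for some $f\in\mathcal S(\mathbb R^n;S^m\mathbb R^n)$) if and only if $$\mathcal J_{i_1j_1}\Big(\mathcal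 J_{i_2j_2}-(\xi_{i_2}X_{j_2}-\xi_{j_2}X_{i_2})\Big)\Big(\mathcal J_{i_3j_3}-2(\xi_{i_3}X_{j_3}-\xi_{j_3}X_{i_3})\Big)\cdots\Big(\mathcal J_{i_{m+1}j_{m+1}}-m(\xi_{i_{m+1}}X_{j_{m+1}}-\xi_{j_{m+1}}X_{i_{m+1}})\Big)\varphi=0$$ on $T\mathbb S^{n-1}$ for all indices $1\le i_1,j_1,\dots,i_{m+1},j_{m+1}\le n$. -/

import Mathlib

open scoped ContDiff SchwartzMap

noncomputable section

/-- Euclidean space `ℝⁿ`. -/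
abbrev Euc (n : ℕ) : Type := EuclideanSpace ℝ (Fin n)

/-- The manifold `T𝕊ⁿ⁻¹ = {(x, ξ) ∈ ℝⁿ × ℝⁿ : |ξ| = 1, ⟨x, ξ⟩ = 0}` of oriented lines of `ℝⁿ`. -/
def TSphere (n : ℕ) : Type :=
  {p : Euc n × Euc n // ‖p.2‖ = 1 ∧ inner ℝ p.1 p.2 = 0}

namespace TSphere

variable {n : ℕ}

/-- The base component `x` of a point `(x, ξ)`. -/
def pos (p : TSphere n) : Euc n := p.1.1

/-- The direction `ξ` of a point `(x, ξ)`. -/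
def dir (p : TSphere n) : Euc n := p.1.2

/-- `(x, ξ) ↦ (x, -ξ)`. -/
def flip (p : TSphere n) : TSphere n :=
  ⟨(p.1.1, -p.1.2), by simpa using p.2.1, by simpa using p.2.2⟩

/-- The map `(x, ξ) ↦ (x - ⟨x, ξ⟩ ξ / |ξ|², ξ / |ξ|)`, sending `(x, ξ)` with `ξ ≠ 0` to the
oriented line through `x` in the direction `ξ`. -/
def proj (p : Euc n × Euc n) (hp : p.2 ≠ 0) : TSphere n :=
  ⟨(p.1 - (inner ℝ p.1 p.2 / ‖p.2‖ ^ 2) • p.2, ‖p.2‖⁻¹ • p.2), by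
    have h : ‖p.2‖ ≠ 0 := norm_ne_zero_iff.mpr hp
    constructor
    · simp [norm_smul, h]
    · simp only [inner_smul_right, inner_sub_left, inner_smul_left, real_inner_self_eq_norm_sq]
      simp [h]⟩

open Classical in
/-- The extension of a function `φ` on `T𝕊ⁿ⁻¹` to `ℝⁿ × (ℝⁿ ∖ {0})` that satisfies
`φ(x, rξ) = φ(x, ξ)` for `r > 0` and `φ(x + rξ, ξ) = φ(x, ξ)` for `r ∈ ℝ`
(the value `0` at `ξ = 0` is never used). -/
def extend (φ : TSphere n → ℂ) (p : Euc n × Euc n) : ℂ :=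
  if hp : p.2 ≠ 0 then φ (proj p hp) else 0

/-- `φ ∈ C^∞(T𝕊ⁿ⁻¹)`. As `proj` is a smooth retraction of `ℝⁿ × (ℝⁿ ∖ {0})` onto `T𝕊ⁿ⁻¹`, this
is smoothness on the embedded submanifold. -/
def IsSmooth (φ : TSphere n → ℂ) : Prop :=
  ContDiffOn ℝ ∞ (extend φ) {p : Euc n × Euc n | p.2 ≠ 0}

/-- The Schwartz space `𝓢(T𝕊ⁿ⁻¹)`: all derivatives in `(x, ξ)` of the extension of `φ`, taken at
points of `T𝕊ⁿ⁻¹`, decay faster than any power of `1 + |x|`. -/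
def IsSchwartz (φ : TSphere n → ℂ) : Prop :=
  IsSmooth φ ∧ ∀ k N : ℕ, ∃ C : ℝ, ∀ p : TSphere n,
    (1 + ‖p.pos‖) ^ k * ‖iteratedFDeriv ℝ N (extend φ) (p.pos, p.dir)‖ ≤ C

/-- The space `𝓢_{π(m)}(T𝕊ⁿ⁻¹)` of Schwartz functions with the parity of `m` in `ξ`. -/
def schwartzParity (n m : ℕ) : Set (TSphere n → ℂ) :=
  {φ | IsSchwartz φ ∧ ∀ p : TSphere n, φ p.flip = (-1) ^ m * φ p}

/-- The value at `(x, ξ)` of the vector field `X̃_i = ∂/∂x_i - ξ_i ξ^p ∂/∂x^p`. -/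
def vecX (i : Fin n) (p : Euc n × Euc n) : Euc n × Euc n :=
  (EuclideanSpace.single i 1 - p.2 i • p.2, 0)

/-- The value at `(x, ξ)` of the vector field
`Ξ̃_i = ∂/∂ξ_i - x_i ξ^p ∂/∂x^p - ξ_i ξ^p ∂/∂ξ^p`. -/
def vecXi (i : Fin n) (p : Euc n × Euc n) : Euc n × Euc n :=
  (-(p.1 i • p.2), EuclideanSpace.single i 1 - p.2 i • p.2)

/-- The operator `X_i` on functions on `T𝕊ⁿ⁻¹`. Since `X̃_i` is tangent to `T𝕊ⁿ⁻¹`, the extension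
used to differentiate is immaterial. -/
def X (i : Fin n) (φ : TSphere n → ℂ) : TSphere n → ℂ :=
  fun p => fderiv ℝ (extend φ) (p.pos, p.dir) (vecX i (p.pos, p.dir))

/-- The operator `Ξ_i` on functions on `T𝕊ⁿ⁻¹`. -/
def Xi (i : Fin n) (φ : TSphere n → ℂ) : TSphere n → ℂ :=
  fun p => fderiv ℝ (extend φ) (p.pos, p.dir) (vecXi i (p.pos, p.dir))

/-- The intrinsic John operator `𝒥_{ij} = X_i Ξ_j - X_j Ξ_i`. -/
def intrinsicJohn (i j : Fin n) (φ : TSphere n → ℂ) : TSphere n → ℂ :=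
  fun p => X i (Xi j φ) p - X j (Xi i φ) p

/-- The operator `𝒥_{ij} - k (ξ_i X_j - ξ_j X_i)`. -/
def shiftedJohn (k : ℕ) (i j : Fin n) (φ : TSphere n → ℂ) : TSphere n → ℂ :=
  fun p => intrinsicJohn i j φ p
    - (k : ℂ) * ((p.dir i : ℂ) * X j φ p - (p.dir j : ℂ) * X i φ p)

/-- The product over `k = 0, …, m`, in this order from left to right, of the operators
`𝒥_{i_k j_k} - k (ξ_{i_k} X_{j_k} - ξ_{j_k} X_{i_k})`; the factor with `k = m` acts first. -/
def johnProduct {m : ℕ} (i j : Fin (m + 1) → Fin n) (φ : TSphere n → ℂ) : TSphere n → ℂ :=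
  Fin.foldr (m + 1) (fun k ψ => shiftedJohn (k : ℕ) (i k) (j k) ψ) φ

end TSphere

/-- The Schwartz space `𝓢(ℝⁿ; Sᵐℝⁿ)` of complex symmetric `m`-tensor fields on `ℝⁿ`, given by
their components `f_{i_1 … i_m}`. -/
structure SchwartzTensorField (n m : ℕ) where
  /-- the components -/
  comp : (Fin m → Fin n) → 𝓢(Euc n, ℂ)
  /-- symmetry in the indices -/
  symm : ∀ (σ : Equiv.Perm (Fin m)) (i : Fin m → Fin n), comp (i ∘ σ) = comp i

/-- The ray transform `If(x, ξ) = ∫ f_{i_1 … i_m}(x + tξ) ξ^{i_1} ⋯ ξ^{i_m} dt`. -/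
def rayTransform {n m : ℕ} (f : SchwartzTensorField n m) : TSphere n → ℂ :=
  fun p => ∫ t : ℝ, ∑ i : Fin m → Fin n,
    f.comp i (p.pos + t • p.dir) * ∏ a : Fin m, (p.dir (i a) : ℂ)

end

/-! Extend `φ` to `Ψ(x, ξ)` on `ξ ≠ 0`, invariant under `x ↦ x + tξ` and homogeneous of degree `m -
1` in `ξ`. This is how the integral of a rank `m` tensor field over a line scales. Under this
extension each shifted operator becomes the plain John operator `J_ij = ∂_{x_i}∂_{ξ_j} -
∂_{x_j}∂_{ξ_i}`, which lowers the degree by one (`john_homExtend`). The product condition then says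
that every product of `m + 1` John operators annihilates `Ψ` (`Killed`).

Necessity: `Ψ` is a sum of terms `M(ξ) ∫ f(x + tξ) dt` with `M` a polynomial of degree `m`. John
operators kill the integrals, so each one only differentiates the coefficients `M`, and `m + 1` of
them leave nothing (`killed_transformSum`).

Sufficiency goes by induction on the rank (`exists_transform_of_killed`). For rank `0`, the Fourier
transform of `Ψ(·, ξ)` on `ξᗮ` does not depend on the choice of `ξ ⊥ y`, because John's equations
make its derivative in `ξ` vanish (`fourier_cutoff_line`). These transforms glue to a function `F`
on the whole space. In dimension at least three any two vectors lie in a common hyperplane, so the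
iterated differences of `F` are controlled by those of Schwartz functions. This is enough for `F` to
be Schwartz (`exists_schwartz_of_hyperplanes`), and its inverse transform is the required function.

For rank `m + 1`, the induction hypothesis gives fields `f_ij`, antisymmetric in `i, j`, with `J_ij
Ψ` the ray transform of `f_ij`. Euler's identity `ξ_j J_ij Ψ = (m + 1) ∂_{x_i} Ψ`
(`RayLike.john_dir`), read on the Fourier side, says that the vector field `a_i = ξ_j 𝓕(f_ij)(ξ, …,
ξ)` equals a constant times `y_i` times the transform of `Ψ(·, ξ)` on `ξᗮ`. The factor `y` is
divided out by a linear operator that does not involve `ξ` (`radialQuotient`). It can therefore be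
applied coefficient by coefficient, and the result is again polynomial in `ξ`, that is, the
transform of a tensor field. -/

namespace RayTransform

noncomputable section

set_option linter.unusedSectionVars false

open MeasureTheory Real FourierTransform RealInnerProductSpace Filter Topology LineDeriv

/-! ### Iterated differences and decay of Fourier transforms -/

section Fourier

variable {E V : Type} [NormedAddCommGroup E] [InnerProductSpace ℝ E] [FiniteDimensional ℝ E]
  [MeasurableSpace E] [BorelSpace E] [NormedAddCommGroup V] [NormedSpace ℂ V]

lemma norm_fourierChar_sub_one_le (t : ℝ) : ‖(𝐞 (-t) : ℂ) - 1‖ ≤ 2 * π * |t| := by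
  have := Real.norm_exp_I_mul_ofReal_sub_one_le (x := 2 * π * (-t))
  rw [Real.fourierChar_apply, mul_comm]
  refine this.trans (le_of_eq ?_)
  rw [Real.norm_eq_abs, abs_mul, abs_neg, abs_of_pos Real.two_pi_pos]

lemma fwdDiff_fourier (h : E) {g : E → V} (hg : Integrable g) :
    fwdDiff h (𝓕 g) = 𝓕 (fun x => ((𝐞 (-⟪x, h⟫) : ℂ) - 1) • g x) := by
  ext y
  have h1 := (Real.fourierIntegral_convergent_iff (μ := volume) (f := g) y).2 hg
  have h2 := (Real.fourierIntegral_convergent_iff (μ := volume) (f := g) (y + h)).2 hg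
  rw [fwdDiff, Real.fourier_eq, Real.fourier_eq, Real.fourier_eq, ← integral_sub h2 h1]
  congr 1
  ext x
  rw [inner_add_right, neg_add, AddChar.map_add_eq_mul, sub_smul, one_smul, smul_sub, mul_smul,
    Circle.smul_def (𝐞 (-⟪x, h⟫))]

lemma fourier_fwdDiff (h : E) {F : E → V} (hF : Integrable F) (x : E) :
    𝓕 (fwdDiff h F) x = ((𝐞 ⟪h, x⟫ : ℂ) - 1) • 𝓕 F x := by
  have h1 := (Real.fourierIntegral_convergent_iff (μ := volume) (f := F) x).2 hF
  have h2 := (Real.fourierIntegral_convergent_iff (μ := volume) (f := fun y => F (y + h)) x).2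
    (hF.comp_add_right h)
  rw [Real.fourier_eq, sub_smul, one_smul, Real.fourier_eq]
  simp only [fwdDiff, smul_sub]
  rw [integral_sub h2 h1, ← integral_add_right_eq_self (μ := volume)
    (fun v => 𝐞 (-⟪v, x⟫) • F v) h, ← integral_smul]
  congr 2
  ext y
  rw [inner_add_left, neg_add, AddChar.map_add_eq_mul, Circle.smul_def, Circle.smul_def, smul_smul]
  congr 1
  rw [Circle.coe_mul, mul_left_comm, ← Circle.coe_mul, ← AddChar.map_add_eq_mul]
  simp

lemma integrable_char_sub_one_smul (h : E) {g : E → V} (hg : Integrable g) :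
    Integrable (fun x => ((𝐞 (-⟪x, h⟫) : ℂ) - 1) • g x) := by
  have h1 := (Real.fourierIntegral_convergent_iff (μ := volume) (f := g) h).2 hg
  convert h1.sub hg using 2 with x
  simp [sub_smul, Circle.smul_def]

lemma fwdDiff_iter_fourier (h : E) (k : ℕ) {g : E → V} (hg : Integrable g) :
    (fwdDiff h)^[k] (𝓕 g) = 𝓕 (fun x => ((𝐞 (-⟪x, h⟫) : ℂ) - 1) ^ k • g x) := by
  induction k generalizing g with
  | zero => simp
  | succ k ih =>
    rw [Function.iterate_succ_apply, fwdDiff_fourier h hg, ih (integrable_char_sub_one_smul h hg)]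
    simp only [smul_smul, pow_succ]

lemma fourier_fwdDiff_iter (h : E) (k : ℕ) {F : E → V} (hF : Integrable F) (x : E) :
    𝓕 ((fwdDiff h)^[k] F) x = ((𝐞 ⟪h, x⟫ : ℂ) - 1) ^ k • 𝓕 F x := by
  induction k generalizing F with
  | zero => simp
  | succ k ih =>
    have : Integrable (fwdDiff h F) := (hF.comp_add_right h).sub hF
    rw [Function.iterate_succ_apply, ih this, fourier_fwdDiff h hF, smul_smul, pow_succ]

lemma fwdDiff_iter_congr {M G : Type} [AddCommMonoid M] [AddCommGroup G] {f g : M → G} {h y : M}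
    (hfg : ∀ j : ℕ, f (y + j • h) = g (y + j • h)) (k : ℕ) :
    (fwdDiff h)^[k] f y = (fwdDiff h)^[k] g y := by
  simp only [fwdDiff_iter_eq_sum_shift, hfg]

variable (E) in
lemma exists_integrable_inv_pow : ∃ p : ℕ, Integrable (fun x : E => ((1 + ‖x‖) ^ p)⁻¹) := by
  refine ⟨(volume : Measure E).integrablePower,
    (Measure.integrable_pow_neg_integrablePower (volume : Measure E)).congr
    (Eventually.of_forall fun x => ?_)⟩
  simp only
  rw [Real.rpow_neg (by positivity), Real.rpow_natCast]

/-- A continuous function decaying faster than any power. -/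
structure RapidDecay (F : E → V) : Prop where
  cont : Continuous F
  bound : ∀ k : ℕ, ∃ C : ℝ, ∀ x, (1 + ‖x‖) ^ k * ‖F x‖ ≤ C

lemma RapidDecay.integrable_pow_mul {F : E → V} (hF : RapidDecay F) (k : ℕ) :
    Integrable (fun x => ‖x‖ ^ k * ‖F x‖) := by
  obtain ⟨p, hp⟩ := exists_integrable_inv_pow E
  obtain ⟨C, hC⟩ := hF.bound (k + p)
  refine (hp.const_mul C).mono' ((continuous_norm.pow k).mul hF.cont.norm).aestronglyMeasurable
    (Eventually.of_forall fun x => ?_)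
  rw [Real.norm_of_nonneg (by positivity), ← div_eq_mul_inv, le_div_iff₀ (by positivity)]
  refine le_trans ?_ (hC x)
  rw [pow_add, mul_right_comm]
  gcongr
  linarith [norm_nonneg x]

lemma RapidDecay.integrable {F : E → V} (hF : RapidDecay F) : Integrable F := by
  have := hF.integrable_pow_mul 0
  simp only [pow_zero, one_mul] at this
  exact (integrable_norm_iff hF.cont.aestronglyMeasurable).1 this

/-- A shift by a vector of length at most one changes the weight `1 + ‖x‖` by a factor of at most
two, so each difference costs `2 ^ p + 1`. -/
lemma norm_fwdDiff_iter_le {F : E → V} (p : ℕ) {C : ℝ} (hC : ∀ x, (1 + ‖x‖) ^ p * ‖F x‖ ≤ C)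
    {h : E} (hh : ‖h‖ ≤ 1) (k : ℕ) (x : E) :
    (1 + ‖x‖) ^ p * ‖(fwdDiff h)^[k] F x‖ ≤ (2 ^ p + 1) ^ k * C := by
  induction k generalizing F C with
  | zero => simpa using hC x
  | succ k ih =>
    rw [Function.iterate_succ_apply, pow_succ, mul_assoc]
    refine ih fun x => ?_
    rw [fwdDiff]
    have h1 : (1 + ‖x‖) ^ p ≤ 2 ^ p * (1 + ‖x + h‖) ^ p := by
      rw [← mul_pow]
      gcongr
      have : ‖x‖ ≤ ‖x + h‖ + ‖h‖ := by simpa using norm_sub_le (x + h) h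
      linarith [norm_nonneg (x + h)]
    calc (1 + ‖x‖) ^ p * ‖F (x + h) - F x‖
        ≤ (1 + ‖x‖) ^ p * ‖F (x + h)‖ + (1 + ‖x‖) ^ p * ‖F x‖ := by
          rw [← mul_add]; gcongr; exact norm_sub_le _ _
      _ ≤ 2 ^ p * (1 + ‖x + h‖) ^ p * ‖F (x + h)‖ + C := by gcongr; exact hC x
      _ ≤ 2 ^ p * C + C := by rw [mul_assoc]; gcongr; exact hC _
      _ = _ := by ring

/-- If all iterated differences of a rapidly decaying function are controlled by powers of the
step, then its Fourier transform decays faster than any power. -/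
lemma RapidDecay.fourier_bound {F : E → V} (hF : RapidDecay F)
    (hd : ∀ k : ℕ, ∃ C : ℝ, ∀ h y : E, ‖(fwdDiff h)^[k] F y‖ ≤ C * ‖h‖ ^ k) (k : ℕ) :
    ∃ C : ℝ, ∀ x, ‖x‖ ^ k * ‖𝓕 F x‖ ≤ C := by
  obtain ⟨p, hp⟩ := exists_integrable_inv_pow E
  obtain ⟨C₁, hC₁⟩ := hd (2 * k)
  obtain ⟨C₂, hC₂⟩ := hF.bound (2 * p)
  have hC₂0 : 0 ≤ C₂ := le_trans (by positivity) (hC₂ 0)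
  set C₃ := (2 ^ (2 * p) + 1) ^ (2 * k) * C₂ with hC₃
  have hC₃0 : 0 ≤ C₃ := by positivity
  set A := ∫ x : E, ((1 + ‖x‖) ^ p)⁻¹ with hA
  have hA0 : 0 ≤ A := integral_nonneg fun x => by positivity
  set B := √(|C₁| * C₃) with hB
  refine ⟨(∫ x, ‖F x‖) + B * A, fun x => ?_⟩
  have htriv : ‖𝓕 F x‖ ≤ ∫ x, ‖F x‖ := by
    rw [Real.fourier_eq]
    refine (norm_integral_le_integral_norm _).trans (le_of_eq ?_)
    simp
  have hF0 : 0 ≤ ∫ x, ‖F x‖ := integral_nonneg fun x => norm_nonneg _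
  rcases le_or_gt ‖x‖ 1 with hx | hx
  · calc ‖x‖ ^ k * ‖𝓕 F x‖ ≤ 1 * ∫ x, ‖F x‖ := by
          gcongr; exact pow_le_one₀ (norm_nonneg _) hx
      _ ≤ _ := by rw [one_mul]; exact le_add_of_nonneg_right (by positivity)
  · have hx0 : 0 < ‖x‖ := by linarith
    -- With `⟪h, x⟫ = 1/2` the character takes the value `-1`. Hence `2k` differences multiply `𝓕 F
    -- x` by `(-2) ^ (2k)`, while `‖h‖` is comparable to `‖x‖⁻¹`.
    set h : E := (1 / (2 * ‖x‖ ^ 2)) • x with hh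
    have hhn : ‖h‖ = 1 / (2 * ‖x‖) := by
      rw [hh, norm_smul, Real.norm_of_nonneg (by positivity)]
      field_simp
    have hh1 : ‖h‖ ≤ 1 := by
      rw [hhn, div_le_one (by positivity)]; linarith
    have hhx : ⟪h, x⟫ = 1 / 2 := by
      rw [hh, real_inner_smul_left, real_inner_self_eq_norm_sq]; field_simp
    have hchar : (𝐞 ⟪h, x⟫ : ℂ) = -1 := by
      rw [hhx, Real.fourierChar_apply]
      convert Complex.exp_pi_mul_I using 2
      push_cast; ring
    have key := fourier_fwdDiff_iter h (2 * k) hF.integrable x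
    rw [hchar] at key
    -- Geometric mean of two bounds: `‖h‖ ^ (2k)` without decay in `y`, and decay of order `2p`
    -- without smallness in `h`. Half of each gives smallness and integrability together.
    have hpt : ∀ y, ‖(fwdDiff h)^[2 * k] F y‖ ≤ B * ‖h‖ ^ k * ((1 + ‖y‖) ^ p)⁻¹ := by
      intro y
      have e1 := hC₁ h y
      have e2 := norm_fwdDiff_iter_le (2 * p) hC₂ hh1 (2 * k) y
      set a := ‖(fwdDiff h)^[2 * k] F y‖ with ha
      have ha0 : 0 ≤ a := norm_nonneg _
      rw [← div_eq_mul_inv, le_div_iff₀ (by positivity)]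
      refine abs_le_of_sq_le_sq' ?_ (by positivity) |>.2
      have hB2 : B ^ 2 = |C₁| * C₃ := Real.sq_sqrt (by positivity)
      calc (a * (1 + ‖y‖) ^ p) ^ 2 = a * ((1 + ‖y‖) ^ (2 * p) * a) := by ring
        _ ≤ (|C₁| * ‖h‖ ^ (2 * k)) * C₃ := by
            gcongr
            exact e1.trans (by gcongr; exact le_abs_self _)
        _ = (B * ‖h‖ ^ k) ^ 2 := by rw [mul_pow, hB2]; ring
    have hle : ‖𝓕 ((fwdDiff h)^[2 * k] F) x‖ ≤ B * ‖h‖ ^ k * A := by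
      rw [Real.fourier_eq, hA, ← integral_const_mul]
      refine norm_integral_le_of_norm_le (hp.const_mul _) (Eventually.of_forall fun y => ?_)
      simpa using hpt y
    rw [key, norm_smul, norm_pow, hhn] at hle
    have h2 : ‖(-1 : ℂ) - 1‖ = 2 := by norm_num
    rw [h2] at hle
    have h4 : ‖x‖ ^ k * ‖𝓕 F x‖ ≤ B * A := by
      have : B * (1 / (2 * ‖x‖)) ^ k * A = B * A / (2 ^ k * ‖x‖ ^ k) := by
        rw [div_pow, mul_pow, one_pow]; ring
      rw [this, le_div_iff₀ (by positivity)] at hle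
      refine le_trans ?_ hle
      have h1 : (1 : ℝ) ≤ 2 ^ (2 * k) * 2 ^ k := by
        have : (1:ℝ) ≤ 2 ^ (2 * k) := one_le_pow₀ (by norm_num)
        have : (1:ℝ) ≤ 2 ^ k := one_le_pow₀ (by norm_num)
        nlinarith
      calc ‖x‖ ^ k * ‖𝓕 F x‖ = 1 * (‖x‖ ^ k * ‖𝓕 F x‖) := by ring
        _ ≤ (2 ^ (2 * k) * 2 ^ k) * (‖x‖ ^ k * ‖𝓕 F x‖) := by gcongr
        _ = _ := by ring
    linarith

/-- Every two vectors of a space of dimension at least three have a common unit normal. -/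
lemma exists_unit_orthogonal (hE : 3 ≤ Module.finrank ℝ E) (a b : E) :
    ∃ ξ : E, ‖ξ‖ = 1 ∧ ⟪a, ξ⟫ = 0 ∧ ⟪b, ξ⟫ = 0 := by
  set S : Submodule ℝ E := Submodule.span ℝ {a, b} with hS
  have h1 : Module.finrank ℝ S ≤ 2 := by
    classical
    have := finrank_span_finset_le_card (R := ℝ) ({a, b} : Finset E)
    simp only [Finset.coe_insert, Finset.coe_singleton] at this
    exact this.trans Finset.card_le_two
  have h2 := Submodule.finrank_add_finrank_orthogonal S
  have h3 : 0 < Module.finrank ℝ Sᗮ := by omega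
  obtain ⟨v, hv⟩ := (Module.finrank_pos_iff_exists_ne_zero (R := ℝ)).1 h3
  have hv0 : (v : E) ≠ 0 := by simpa using hv
  have hvS := (Submodule.mem_orthogonal S v).1 v.2
  refine ⟨‖(v : E)‖⁻¹ • (v : E), by simp [norm_smul, hv0], ?_, ?_⟩
  · rw [inner_smul_right, hvS a (Submodule.subset_span (by simp)), mul_zero]
  · rw [inner_smul_right, hvS b (Submodule.subset_span (by simp)), mul_zero]

/-- On every hyperplane `ξᗮ` the function `F` is the Fourier transform of the function `g ξ`, and
the functions `g ξ` are uniformly integrable against all powers. -/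
structure IsPlanar (F : E → V) (g : E → E → V) : Prop where
  meas : ∀ ξ, ‖ξ‖ = 1 → AEStronglyMeasurable (g ξ)
  int : ∀ k : ℕ, ∀ ξ, ‖ξ‖ = 1 → Integrable (fun x => ‖x‖ ^ k * ‖g ξ x‖)
  bound : ∀ k : ℕ, ∃ C : ℝ, ∀ ξ, ‖ξ‖ = 1 → ∫ x, ‖x‖ ^ k * ‖g ξ x‖ ≤ C
  eq : ∀ ξ y, ‖ξ‖ = 1 → ⟪y, ξ⟫ = 0 → F y = 𝓕 (g ξ) y

/-- The points `y + j h` all lie in one hyperplane `ξᗮ`, where `F` may be replaced by `𝓕 (g ξ)`.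
Differences of the latter put the factor `(𝐞 (-⟪x, h⟫) - 1) ^ k` under the integral, of size at most
`(2π ‖x‖ ‖h‖) ^ k`. Only dimension at least three provides the common normal. -/
lemma IsPlanar.fwdDiff_bound (hE : 3 ≤ Module.finrank ℝ E) {F : E → V} {g : E → E → V}
    (H : IsPlanar F g) (k : ℕ) :
    ∃ C : ℝ, ∀ h y : E, ‖(fwdDiff h)^[k] F y‖ ≤ C * ‖h‖ ^ k := by
  obtain ⟨C, hC⟩ := H.bound k
  refine ⟨(2 * π) ^ k * C, fun h y => ?_⟩
  obtain ⟨ξ, hξ, hy, hh⟩ := exists_unit_orthogonal hE y h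
  have hint : Integrable (g ξ) := by
    have := H.int 0 ξ hξ
    simp only [pow_zero, one_mul] at this
    exact (integrable_norm_iff (H.meas ξ hξ)).1 this
  rw [fwdDiff_iter_congr (g := 𝓕 (g ξ)), fwdDiff_iter_fourier h k hint, Real.fourier_eq]
  · have : (2 * π) ^ k * C * ‖h‖ ^ k ≥ ∫ x, (2 * π * ‖h‖) ^ k * (‖x‖ ^ k * ‖g ξ x‖) := by
      rw [integral_const_mul]
      calc (2 * π * ‖h‖) ^ k * ∫ x, ‖x‖ ^ k * ‖g ξ x‖ ≤ (2 * π * ‖h‖) ^ k * C := by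
            gcongr; exact hC ξ hξ
        _ = _ := by ring
    refine le_trans (norm_integral_le_of_norm_le ((H.int k ξ hξ).const_mul _)
      (Eventually.of_forall fun x => ?_)) this
    rw [Circle.norm_smul, norm_smul, norm_pow, ← mul_assoc, ← mul_pow]
    gcongr
    refine (norm_fourierChar_sub_one_le _).trans ?_
    rw [mul_assoc (2 * π), mul_comm ‖h‖]
    gcongr
    exact abs_real_inner_le_norm _ _
  · intro j
    refine H.eq ξ _ hξ ?_
    rw [inner_add_left, ← Nat.cast_smul_eq_nsmul ℝ, real_inner_smul_left, hy, hh]; simp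

lemma IsPlanar.continuous (hE : 3 ≤ Module.finrank ℝ E) {F : E → V} {g : E → E → V}
    (H : IsPlanar F g) : Continuous F := by
  obtain ⟨C, hC⟩ := H.fwdDiff_bound hE 1
  simp only [Function.iterate_one, pow_one, fwdDiff] at hC
  refine (LipschitzWith.of_dist_le_mul (K := C.toNNReal) fun x y => ?_).continuous
  have := hC (x - y) y
  rw [add_sub_cancel] at this
  rw [dist_eq_norm, dist_eq_norm]
  exact this.trans (by gcongr; exact Real.le_coe_toNNReal C)

end Fourier

/-! ### Gluing Schwartz functions given on hyperplanes -/

section Fourier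

variable {E V : Type} [NormedAddCommGroup E] [InnerProductSpace ℝ E] [FiniteDimensional ℝ E]
  [MeasurableSpace E] [BorelSpace E] [NormedAddCommGroup V] [NormedSpace ℂ V]

open VectorFourier

/-- Families of Schwartz functions whose seminorms are bounded uniformly over unit vectors. -/
def UniformlySchwartz (g : E → 𝓢(E, V)) : Prop :=
  ∀ k l : ℕ, ∃ C : ℝ, ∀ ξ : E, ‖ξ‖ = 1 → SchwartzMap.seminorm ℂ k l (g ξ) ≤ C

lemma UniformlySchwartz.integral_bound {g : E → 𝓢(E, V)} (hg : UniformlySchwartz g) (k l : ℕ) :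
    ∃ C : ℝ, ∀ ξ : E, ‖ξ‖ = 1 → ∫ x, ‖x‖ ^ k * ‖iteratedFDeriv ℝ l (g ξ) x‖ ≤ C := by
  obtain ⟨C₁, h₁⟩ := hg 0 l
  obtain ⟨C₂, h₂⟩ := hg (k + (volume : Measure E).integrablePower) l
  have hA : 0 ≤ ∫ x : E, (1 + ‖x‖) ^ (-((volume : Measure E).integrablePower : ℝ)) :=
    integral_nonneg fun x => by positivity
  refine ⟨_, fun ξ hξ => (SchwartzMap.integral_pow_mul_iteratedFDeriv_le ℂ volume (g ξ) k l).trans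
    (mul_le_mul_of_nonneg_left (add_le_add (h₁ ξ hξ) (h₂ ξ hξ)) (by positivity))⟩

/-- By continuity of the Fourier transform, each seminorm of `𝓕 (g ξ)` is dominated by finitely many
seminorms of `g ξ`, with a constant independent of `ξ`. -/
lemma UniformlySchwartz.fourier {g : E → 𝓢(E, V)} (hg : UniformlySchwartz g) :
    UniformlySchwartz (fun ξ => 𝓕 (g ξ)) := by
  intro k l
  have hc : Continuous ((SchwartzMap.seminorm ℂ k l).comp
      (SchwartzMap.fourierTransformCLM ℂ : 𝓢(E, V) →L[ℂ] 𝓢(E, V)).toLinearMap) :=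
    ((schwartz_withSeminorms ℂ E V).continuous_seminorm (k, l)).comp
      (SchwartzMap.fourierTransformCLM ℂ).continuous
  obtain ⟨s, C, -, hC⟩ := Seminorm.bound_of_continuous (schwartz_withSeminorms ℂ E V) _ hc
  choose B hB using fun i : ℕ × ℕ => hg i.1 i.2
  refine ⟨C * ∑ i ∈ s, |B i|, fun ξ hξ => (hC (g ξ)).trans ?_⟩
  rw [smul_apply, NNReal.smul_def, smul_eq_mul]
  gcongr
  refine Seminorm.finset_sup_apply_le (by positivity) fun i hi => ?_
  refine ((hB i ξ hξ).trans (le_abs_self _)).trans ?_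
  exact Finset.single_le_sum (f := fun i => |B i|) (fun i _ => abs_nonneg _) hi

lemma RapidDecay.fourierPowSMulRight {F : E → V} (hF : RapidDecay F) (N : ℕ) :
    RapidDecay (fun y => fourierPowSMulRight (innerSL ℝ) F y N) where
  cont := by
    have h1 : Continuous fun y : E => (fun _ : Fin N => innerSL ℝ y) := by fun_prop
    simp only [fourierPowSMulRight_eq_comp]
    have := ((ContinuousMultilinearMap.smulRightL ℝ (fun _ : Fin N => E) V).continuous₂.comp
      (Continuous.prodMk (f := fun y : E => ContinuousMultilinearMap.compContinuousLinearMapLRight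
        (ContinuousMultilinearMap.mkPiAlgebra ℝ (Fin N) ℝ) (fun _ => innerSL ℝ y)) (g := F)
        ((ContinuousMultilinearMap.cont _).comp h1) hF.cont)).const_smul ((-(2 * π * Complex.I)) ^ N)
    exact this
  bound k := by
    obtain ⟨C, hC⟩ := hF.bound (k + N)
    refine ⟨(2 * π * ‖(innerSL ℝ : E →L[ℝ] E →L[ℝ] ℝ)‖) ^ N * C, fun y => ?_⟩
    calc (1 + ‖y‖) ^ k * ‖VectorFourier.fourierPowSMulRight (innerSL ℝ) F y N‖
        ≤ (1 + ‖y‖) ^ k * ((2 * π * ‖(innerSL ℝ : E →L[ℝ] E →L[ℝ] ℝ)‖) ^ N * ‖y‖ ^ N * ‖F y‖) := by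
          gcongr; exact norm_fourierPowSMulRight_le _ _ _ _
      _ ≤ (1 + ‖y‖) ^ k * ((2 * π * ‖(innerSL ℝ : E →L[ℝ] E →L[ℝ] ℝ)‖) ^ N
            * (1 + ‖y‖) ^ N * ‖F y‖) := by
          gcongr; linarith
      _ = (2 * π * ‖(innerSL ℝ : E →L[ℝ] E →L[ℝ] ℝ)‖) ^ N * ((1 + ‖y‖) ^ (k + N) * ‖F y‖) := by
          rw [pow_add]; ring
      _ ≤ _ := by gcongr; exact hC y

lemma aestronglyMeasurable_iteratedFDeriv (f : 𝓢(E, V)) (N : ℕ) :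
    AEStronglyMeasurable (iteratedFDeriv ℝ N f) := by
  have : SecondCountableTopologyEither E (E [×N]→L[ℝ] V) := secondCountableTopologyEither_of_left _ _
  exact ((f.smooth ⊤).continuous_iteratedFDeriv (mod_cast le_top)).aestronglyMeasurable

lemma integrable_iteratedFDeriv (f : 𝓢(E, V)) (N : ℕ) :
    Integrable (iteratedFDeriv ℝ N f) := by
  have := f.integrable_pow_mul_iteratedFDeriv volume 0 N
  simp only [pow_zero, one_mul] at this
  exact (integrable_norm_iff (aestronglyMeasurable_iteratedFDeriv f N)).1 this

lemma fourier_iteratedFDeriv_schwartz [CompleteSpace V] (f : 𝓢(E, V)) (N : ℕ) (y : E) :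
    𝓕 (iteratedFDeriv ℝ N f) y
      = (-1 : ℂ) ^ N • fourierPowSMulRight (innerSL ℝ) (𝓕 (f : E → V)) y N := by
  rw [Real.fourier_iteratedFDeriv (f := f) (N := ⊤) (n := N) (f.smooth ⊤)
    (fun n _ => integrable_iteratedFDeriv f n) (mod_cast le_top)]
  ext w
  rw [fourierPowSMulRight_apply, smul_apply, fourierPowSMulRight_apply]
  simp only [neg_apply, Finset.prod_neg, Finset.card_univ, Fintype.card_fin]
  rw [mul_smul, smul_comm ((-1 : ℂ) ^ N)]
  congr 1
  rw [← Complex.coe_smul]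
  push_cast
  rfl

/-- Multiplying `F` by `N` copies of `y` amounts, on each `ξᗮ`, to differentiating `g ξ`. So the
planar estimates for `F` carry over to the functions whose transforms are the derivatives of `𝓕 F`.
The sign `(-1) ^ N` reconciles the two conventions for the factor `2πi`. -/
lemma isPlanar_fourierPowSMulRight [CompleteSpace V] {F : E → V} {g : E → 𝓢(E, V)}
    (hg : UniformlySchwartz g)
    (hF : ∀ ξ y, ‖ξ‖ = 1 → ⟪y, ξ⟫ = 0 → F y = 𝓕 (g ξ) y) (N : ℕ) :
    IsPlanar (fun y => fourierPowSMulRight (innerSL ℝ) F y N)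
      (fun ξ => (-1 : ℂ) ^ N • iteratedFDeriv ℝ N (g ξ)) where
  meas ξ _ := (aestronglyMeasurable_iteratedFDeriv (g ξ) N).const_smul _
  int k ξ _ := by
    refine ((g ξ).integrable_pow_mul_iteratedFDeriv volume k N).congr (Eventually.of_forall fun x => ?_)
    simp only [Pi.smul_apply]
    rw [norm_smul, norm_pow, norm_neg, norm_one, one_pow, one_mul]
  bound k := by
    obtain ⟨C, hC⟩ := hg.integral_bound k N
    refine ⟨C, fun ξ hξ => (le_of_eq ?_).trans (hC ξ hξ)⟩
    congr 1
    ext x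
    rw [Pi.smul_apply, norm_smul, norm_pow, norm_neg, norm_one, one_pow, one_mul]
  eq ξ y hξ hy := by
    have h2 : 𝓕 ((-1 : ℂ) ^ N • iteratedFDeriv ℝ N (g ξ)) y
        = (-1 : ℂ) ^ N • 𝓕 (iteratedFDeriv ℝ N (g ξ)) y := by
      rw [Real.fourier_eq, Real.fourier_eq, ← integral_smul]
      congr 1; ext x : 1; rw [smul_comm, Pi.smul_apply]
    rw [h2, fourier_iteratedFDeriv_schwartz, smul_smul, ← mul_pow]
    ext w
    simp only [fourierPowSMulRight_apply, hF ξ y hξ hy, SchwartzMap.fourier_coe, neg_mul, one_mul,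
      neg_neg, one_pow, one_smul]

/-- A function whose restrictions to the hyperplanes `ξᗮ` agree with Schwartz functions, uniformly
in `ξ`, is a Schwartz function. -/
theorem exists_schwartz_of_hyperplanes [CompleteSpace V] (hE : 3 ≤ Module.finrank ℝ E) {F : E → V}
    {g : E → 𝓢(E, V)} (hg : UniformlySchwartz g)
    (hF : ∀ ξ y, ‖ξ‖ = 1 → ⟪y, ξ⟫ = 0 → F y = 𝓕 (g ξ) y) : ∃ S : 𝓢(E, V), ∀ y, S y = F y := by
  have hP := isPlanar_fourierPowSMulRight hg hF
  have hcont : Continuous F := by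
    have : IsPlanar F (fun ξ => g ξ) :=
      { meas := fun ξ _ => (g ξ).continuous.aestronglyMeasurable
        int := fun k ξ _ => (g ξ).integrable_pow_mul volume k
        bound := fun k => by simpa using hg.integral_bound k 0
        eq := fun ξ y h1 h2 => by rw [hF ξ y h1 h2, SchwartzMap.fourier_coe] }
    exact this.continuous hE
  have hrap : RapidDecay F := by
    refine ⟨hcont, fun k => ?_⟩
    obtain ⟨C₁, h₁⟩ := hg.fourier 0 0
    obtain ⟨C₂, h₂⟩ := hg.fourier k 0
    refine ⟨2 ^ k * (C₁ + C₂), fun y => ?_⟩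
    obtain ⟨ξ, hξ, hy, -⟩ := exists_unit_orthogonal hE y y
    rw [hF ξ y hξ hy]
    have e1 := (SchwartzMap.norm_pow_mul_le_seminorm ℂ (𝓕 (g ξ)) 0 y).trans (h₁ ξ hξ)
    have e2 := (SchwartzMap.norm_pow_mul_le_seminorm ℂ (𝓕 (g ξ)) k y).trans (h₂ ξ hξ)
    rw [pow_zero, one_mul] at e1
    have : (1 + ‖y‖) ^ k ≤ 2 ^ k * (1 + ‖y‖ ^ k) := by
      refine (add_pow_le zero_le_one (norm_nonneg y) k).trans ?_
      rw [one_pow]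
      gcongr
      · norm_num
      · omega
    calc (1 + ‖y‖) ^ k * ‖𝓕 (g ξ) y‖ ≤ 2 ^ k * (1 + ‖y‖ ^ k) * ‖𝓕 (g ξ) y‖ := by gcongr
      _ = 2 ^ k * (‖𝓕 (g ξ) y‖ + ‖y‖ ^ k * ‖𝓕 (g ξ) y‖) := by ring
      _ ≤ _ := by gcongr
  have hd : ∀ N : ℕ, iteratedFDeriv ℝ N (𝓕 F)
      = 𝓕 (fun y => fourierPowSMulRight (innerSL ℝ) F y N) := fun N =>
    Real.iteratedFDeriv_fourier (N := ⊤) (fun n _ => hrap.integrable_pow_mul n)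
      hcont.aestronglyMeasurable (mod_cast le_top)
  -- The differences of `F` control the decay of `𝓕 F`, so it is `𝓕 F` that is shown to be Schwartz.
  -- `F` is then recovered by Fourier inversion.
  let S₀ : 𝓢(E, V) :=
    { toFun := 𝓕 F
      smooth' := Real.contDiff_fourier (N := ⊤) (fun n _ => hrap.integrable_pow_mul n)
      decay' := fun k N => by
        rw [hd N]
        exact (hrap.fourierPowSMulRight N).fourier_bound ((hP N).fwdDiff_bound hE) k }
  refine ⟨𝓕⁻ S₀, fun y => ?_⟩
  have h1 : (𝓕⁻ S₀ : 𝓢(E, V)) y = 𝓕⁻ (𝓕 F) y := by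
    rw [SchwartzMap.fourierInv_coe]; rfl
  rw [h1, hcont.fourierInv_fourier_eq hrap.integrable S₀.integrable]

end Fourier

/-! ### John operators and homogeneous functions on `ξ ≠ 0` -/

section Calculus

variable {E : Type} [NormedAddCommGroup E] [InnerProductSpace ℝ E]

variable (E) in
/-- The set of pairs `(x, ξ)` with `ξ ≠ 0`. -/
def nonzeroDir : Set (E × E) := {p | p.2 ≠ 0}

lemma isOpen_nonzeroDir : IsOpen (nonzeroDir E) :=
  isOpen_compl_singleton.preimage continuous_snd

/-- The derivative of `Ψ` in the constant direction `v`. -/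
def dirDeriv (v : E × E) (Ψ : E × E → ℂ) (p : E × E) : ℂ := fderiv ℝ Ψ p v

lemma ContDiffOn.at_nonzeroDir {Ψ : E × E → ℂ} (h : ContDiffOn ℝ ∞ Ψ (nonzeroDir E)) {p : E × E}
    (hp : p ∈ nonzeroDir E) : ContDiffAt ℝ ∞ Ψ p :=
  h.contDiffAt (isOpen_nonzeroDir.mem_nhds hp)

lemma contDiffOn_dirDeriv {Ψ : E × E → ℂ} (h : ContDiffOn ℝ ∞ Ψ (nonzeroDir E)) (v : E × E) :
    ContDiffOn ℝ ∞ (dirDeriv v Ψ) (nonzeroDir E) := by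
  have : ContDiffOn ℝ ∞ (fderiv ℝ Ψ) (nonzeroDir E) :=
    h.fderiv_of_isOpen isOpen_nonzeroDir (by simp)
  exact this.clm_apply contDiffOn_const

lemma differentiableAt_of_nonzeroDir {Ψ : E × E → ℂ} (h : ContDiffOn ℝ ∞ Ψ (nonzeroDir E))
    {p : E × E} (hp : p ∈ nonzeroDir E) : DifferentiableAt ℝ Ψ p :=
  (ContDiffOn.at_nonzeroDir h hp).differentiableAt (by simp)

lemma dirDeriv_congr {Ψ Φ : E × E → ℂ} (h : Set.EqOn Ψ Φ (nonzeroDir E)) (v : E × E) :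
    Set.EqOn (dirDeriv v Ψ) (dirDeriv v Φ) (nonzeroDir E) := fun p hp => by
  have : Ψ =ᶠ[𝓝 p] Φ := h.eventuallyEq_of_mem (isOpen_nonzeroDir.mem_nhds hp)
  rw [dirDeriv, dirDeriv, this.fderiv_eq]

lemma fderiv_dirDeriv {Ψ : E × E → ℂ} (h : ContDiffOn ℝ ∞ Ψ (nonzeroDir E)) {p : E × E}
    (hp : p ∈ nonzeroDir E) (u v : E × E) :
    dirDeriv u (dirDeriv v Ψ) p = fderiv ℝ (fderiv ℝ Ψ) p u v := by
  have hd : DifferentiableAt ℝ (fderiv ℝ Ψ) p :=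
    ((ContDiffOn.at_nonzeroDir h hp).fderiv_right (m := 1) (by norm_num; exact ENat.LEInfty.out)).differentiableAt
      (by simp)
  change fderiv ℝ (fun q => fderiv ℝ Ψ q v) p u = _
  rw [fderiv_clm_apply hd (differentiableAt_const v)]
  simp

lemma dirDeriv_comm {Ψ : E × E → ℂ} (h : ContDiffOn ℝ ∞ Ψ (nonzeroDir E)) {p : E × E}
    (hp : p ∈ nonzeroDir E) (u v : E × E) :
    dirDeriv u (dirDeriv v Ψ) p = dirDeriv v (dirDeriv u Ψ) p := by
  rw [fderiv_dirDeriv h hp, fderiv_dirDeriv h hp]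
  exact ((ContDiffOn.at_nonzeroDir h hp).isSymmSndFDerivAt (by simp; exact ENat.LEInfty.out)).eq _ _

lemma dirDeriv_add_vec (u v : E × E) (Ψ : E × E → ℂ) (p : E × E) :
    dirDeriv (u + v) Ψ p = dirDeriv u Ψ p + dirDeriv v Ψ p := map_add _ _ _

lemma dirDeriv_smul_vec (c : ℝ) (v : E × E) (Ψ : E × E → ℂ) (p : E × E) :
    dirDeriv (c • v) Ψ p = c * dirDeriv v Ψ p := by simp [dirDeriv]

lemma dirDeriv_add {Ψ Φ : E × E → ℂ} {p : E × E} (h : DifferentiableAt ℝ Ψ p)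
    (h' : DifferentiableAt ℝ Φ p) (v : E × E) :
    dirDeriv v (fun q => Ψ q + Φ q) p = dirDeriv v Ψ p + dirDeriv v Φ p := by
  simp [dirDeriv, fderiv_fun_add h h']

lemma dirDeriv_mul {Ψ Φ : E × E → ℂ} {p : E × E} (h : DifferentiableAt ℝ Ψ p)
    (h' : DifferentiableAt ℝ Φ p) (v : E × E) :
    dirDeriv v (fun q => Ψ q * Φ q) p = Ψ p * dirDeriv v Φ p + dirDeriv v Ψ p * Φ p := by
  simp [dirDeriv, fderiv_fun_mul h h', mul_comm]

lemma norm_iteratedFDeriv_dirDeriv_le {Ψ : E × E → ℂ} (h : ContDiffOn ℝ ∞ Ψ (nonzeroDir E))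
    {p : E × E} (hp : p ∈ nonzeroDir E) (v : E × E) (N : ℕ) :
    ‖iteratedFDeriv ℝ N (dirDeriv v Ψ) p‖ ≤ ‖v‖ * ‖iteratedFDeriv ℝ (N + 1) Ψ p‖ := by
  have h1 : ContDiffAt ℝ N (fderiv ℝ Ψ) p :=
    (ContDiffOn.at_nonzeroDir h hp).fderiv_right (by norm_cast; exact mod_cast le_top)
  have := norm_iteratedFDeriv_clm_apply_const (f := fderiv ℝ Ψ) (c := v) h1 (le_refl (N : WithTop ℕ∞))
  rwa [norm_iteratedFDeriv_fderiv] at this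

/-- The John operator `a_i b_j (∂²/∂x_i∂ξ_j - ∂²/∂x_j∂ξ_i)`. -/
def john (a b : E) (Ψ : E × E → ℂ) (p : E × E) : ℂ :=
  dirDeriv (a, 0) (dirDeriv (0, b) Ψ) p - dirDeriv (b, 0) (dirDeriv (0, a) Ψ) p

lemma john_congr {Ψ Φ : E × E → ℂ} (h : Set.EqOn Ψ Φ (nonzeroDir E)) (a b : E) :
    Set.EqOn (john a b Ψ) (john a b Φ) (nonzeroDir E) := fun p hp => by
  rw [john, john, dirDeriv_congr (dirDeriv_congr h (0, b)) (a, 0) hp,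
    dirDeriv_congr (dirDeriv_congr h (0, a)) (b, 0) hp]

lemma contDiffOn_john {Ψ : E × E → ℂ} (h : ContDiffOn ℝ ∞ Ψ (nonzeroDir E)) (a b : E) :
    ContDiffOn ℝ ∞ (john a b Ψ) (nonzeroDir E) :=
  (contDiffOn_dirDeriv (contDiffOn_dirDeriv h _) _).sub
    (contDiffOn_dirDeriv (contDiffOn_dirDeriv h _) _)

/-- The linear map `(x, ξ) ↦ (x + t ξ, r ξ)`. -/
def shearScale (t : ℝ) {r : ℝ} (hr : r ≠ 0) : (E × E) ≃L[ℝ] (E × E) :=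
  ContinuousLinearEquiv.equivOfInverse
    ((ContinuousLinearMap.fst ℝ E E + t • ContinuousLinearMap.snd ℝ E E).prod
      (r • ContinuousLinearMap.snd ℝ E E))
    ((ContinuousLinearMap.fst ℝ E E - (t / r) • ContinuousLinearMap.snd ℝ E E).prod
      (r⁻¹ • ContinuousLinearMap.snd ℝ E E))
    (fun p => by ext <;> simp [smul_smul, hr])
    (fun p => by ext <;> simp [smul_smul, hr, div_eq_mul_inv])

@[simp] lemma shearScale_apply (t : ℝ) {r : ℝ} (hr : r ≠ 0) (p : E × E) :
    shearScale t hr p = (p.1 + t • p.2, r • p.2) := rfl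

lemma norm_shearScale_le (t : ℝ) {r : ℝ} (hr : r ≠ 0) :
    ‖((shearScale t hr : (E × E) ≃L[ℝ] (E × E)) : (E × E) →L[ℝ] (E × E))‖ ≤ 1 + |t| + |r| := by
  refine ContinuousLinearMap.opNorm_le_bound _ (by positivity) fun p => ?_
  have h1 := norm_fst_le p
  have h2 := norm_snd_le p
  rw [ContinuousLinearEquiv.coe_coe, shearScale_apply, Prod.norm_def, max_le_iff]
  constructor
  · refine (norm_add_le _ _).trans ?_
    rw [norm_smul, Real.norm_eq_abs]
    have : |t| * ‖p.2‖ ≤ |t| * ‖p‖ := by gcongr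
    have : 0 ≤ |r| * ‖p‖ := by positivity
    linarith
  · rw [norm_smul, Real.norm_eq_abs]
    have : |r| * ‖p.2‖ ≤ |r| * ‖p‖ := by gcongr
    have : 0 ≤ |t| * ‖p‖ := by positivity
    linarith [norm_nonneg p]

lemma shearScale_mem (t : ℝ) {r : ℝ} (hr : r ≠ 0) {p : E × E} (hp : p ∈ nonzeroDir E) :
    shearScale t hr p ∈ nonzeroDir E := by
  simpa [nonzeroDir, hr] using hp

lemma iteratedFDeriv_of_equivariant {Ψ : E × E → ℂ} (h : ContDiffOn ℝ ∞ Ψ (nonzeroDir E))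
    {M : (E × E) ≃L[ℝ] (E × E)} (hM : ∀ p ∈ nonzeroDir E, M p ∈ nonzeroDir E) {c : ℝ}
    (hc : ∀ p ∈ nonzeroDir E, Ψ p = c * Ψ (M p)) (N : ℕ) {p : E × E} (hp : p ∈ nonzeroDir E) :
    iteratedFDeriv ℝ N Ψ p =
      c • (iteratedFDeriv ℝ N Ψ (M p)).compContinuousLinearMap (fun _ => (M : (E × E) →L[ℝ] (E × E))) := by
  have he : Ψ =ᶠ[𝓝 p] c • (Ψ ∘ M) :=
    Set.EqOn.eventuallyEq_of_mem (fun q hq => by simp [hc q hq]) (isOpen_nonzeroDir.mem_nhds hp)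
  have hs : ContDiffAt ℝ N (Ψ ∘ M) p :=
    ((ContDiffOn.at_nonzeroDir h (hM p hp)).of_le (mod_cast le_top)).comp p M.contDiff.contDiffAt
  rw [(he.iteratedFDeriv (𝕜 := ℝ) N).eq_of_nhds, iteratedFDeriv_const_smul_apply hs,
    ← iteratedFDerivWithin_univ, ← iteratedFDerivWithin_univ]
  congr 1
  exact M.iteratedFDerivWithin_comp_right Ψ uniqueDiffOn_univ (Set.mem_univ _) N

/-- The class of functions on `{(x, ξ) | ξ ≠ 0}` that behave as the ray transform of a symmetric
tensor field of rank `m` with Schwartz components. -/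
structure RayLike (m : ℕ) (Ψ : E × E → ℂ) : Prop where
  smooth : ContDiffOn ℝ ∞ Ψ (nonzeroDir E)
  equivariant : ∀ (t : ℝ) {r : ℝ} (hr : r ≠ 0), ∀ p ∈ nonzeroDir E,
    Ψ (shearScale t hr p) = ((r ^ m * |r|⁻¹ : ℝ) : ℂ) * Ψ p
  decay : ∀ k N : ℕ, ∃ C : ℝ, ∀ x ξ : E, ‖ξ‖ = 1 → ⟪x, ξ⟫ = 0 →
    (1 + ‖x‖) ^ k * ‖iteratedFDeriv ℝ N Ψ (x, ξ)‖ ≤ C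

lemma RayLike.eq_mul {m : ℕ} {Ψ : E × E → ℂ} (h : RayLike m Ψ) (t : ℝ) {r : ℝ} (hr : r ≠ 0) :
    ∀ p ∈ nonzeroDir E, Ψ p = (((r ^ m * |r|⁻¹)⁻¹ : ℝ) : ℂ) * Ψ (shearScale t hr p) := by
  intro p hp
  have h0 : r ^ m * |r|⁻¹ ≠ 0 := by positivity
  rw [h.equivariant t hr p hp, ← mul_assoc, ← Complex.ofReal_mul, inv_mul_cancel₀ h0]
  simp

/-- The shear turns `∂_{ξ_b}` into `r ∂_{ξ_b} + t ∂_{x_b}`. The terms with `t` are pure second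
derivatives in `x`, symmetric in `a` and `b`, and cancel in the difference, leaving only the extra
factor `r`. -/
lemma john_eq_mul_shearScale {Ψ : E × E → ℂ} (h : ContDiffOn ℝ ∞ Ψ (nonzeroDir E)) (a b : E) (t : ℝ)
    {r c : ℝ} (hr : r ≠ 0) (hc : ∀ p ∈ nonzeroDir E, Ψ p = c * Ψ (shearScale t hr p)) {p : E × E}
    (hp : p ∈ nonzeroDir E) :
    john a b Ψ p = ((c * r : ℝ) : ℂ) * john a b Ψ (shearScale t hr p) := by
  have hq := shearScale_mem t hr hp
  have key : ∀ u v : E × E, dirDeriv u (dirDeriv v Ψ) p = (c : ℂ) *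
      dirDeriv (shearScale t hr u) (dirDeriv (shearScale t hr v) Ψ) (shearScale t hr p) := by
    intro u v
    have := congrArg (fun T => T ![u, v]) (iteratedFDeriv_of_equivariant h
      (fun p => shearScale_mem t hr) hc 2 hp)
    simp only [smul_apply, ContinuousMultilinearMap.compContinuousLinearMap_apply,
      iteratedFDeriv_two_apply] at this
    rw [fderiv_dirDeriv h hp, fderiv_dirDeriv h hq]
    simpa using this
  have hsym := dirDeriv_comm h hq (a, 0) (b, 0)
  have hsplit : ∀ u b : E, dirDeriv (u, 0) (dirDeriv (t • b, r • b) Ψ) (shearScale t hr p) =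
      t * dirDeriv (u, 0) (dirDeriv (b, 0) Ψ) (shearScale t hr p)
        + r * dirDeriv (u, 0) (dirDeriv (0, b) Ψ) (shearScale t hr p) := by
    intro u b
    have : ((t • b, r • b) : E × E) = t • (b, 0) + r • (0, b) := by simp
    rw [this, fderiv_dirDeriv h hq, fderiv_dirDeriv h hq, fderiv_dirDeriv h hq]
    simp only [map_add, map_smul, Complex.real_smul]
  rw [john, john, key, key (b, 0)]
  simp only [shearScale_apply, smul_zero, add_zero, zero_add]
  have hsp1 := hsplit a b
  have hsp2 := hsplit b a
  simp only [shearScale_apply] at hsp1 hsp2 hsym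
  rw [hsp1, hsp2, hsym]
  push_cast
  ring

lemma john_shearScale {m : ℕ} {Ψ : E × E → ℂ} (h : RayLike (m + 1) Ψ) (a b : E) (t : ℝ) {r : ℝ}
    (hr : r ≠ 0) {p : E × E} (hp : p ∈ nonzeroDir E) :
    john a b Ψ (shearScale t hr p) = ((r ^ m * |r|⁻¹ : ℝ) : ℂ) * john a b Ψ p := by
  rw [john_eq_mul_shearScale h.smooth a b t hr (h.eq_mul t hr) hp, ← mul_assoc,
    ← Complex.ofReal_mul]
  have hr' := abs_ne_zero.2 hr
  have : r ^ m * |r|⁻¹ * ((r ^ (m + 1) * |r|⁻¹)⁻¹ * r) = 1 := by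
    field_simp
    ring
  rw [this, Complex.ofReal_one, one_mul]

/-- This drop of the rank by one is what drives the induction. -/
lemma RayLike.john {m : ℕ} {Ψ : E × E → ℂ} (h : RayLike (m + 1) Ψ) (a b : E) :
    RayLike m (john a b Ψ) where
  smooth := contDiffOn_john h.smooth a b
  equivariant t _ hr p hp := john_shearScale h a b t hr hp
  decay k N := by
    obtain ⟨C, hC⟩ := h.decay k (N + 2)
    refine ⟨(‖a‖ * ‖b‖ + ‖b‖ * ‖a‖) * C, fun x ξ hξ hx => ?_⟩
    have hp : ((x, ξ) : E × E) ∈ nonzeroDir E := by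
      change ξ ≠ 0
      rintro rfl
      simp at hξ
    have hb : ∀ u v : E × E, ‖iteratedFDeriv ℝ N (dirDeriv u (dirDeriv v Ψ)) (x, ξ)‖
        ≤ ‖u‖ * ‖v‖ * ‖iteratedFDeriv ℝ (N + 2) Ψ (x, ξ)‖ := by
      intro u v
      refine (norm_iteratedFDeriv_dirDeriv_le (contDiffOn_dirDeriv h.smooth v) hp u N).trans ?_
      rw [mul_assoc]
      gcongr
      exact norm_iteratedFDeriv_dirDeriv_le h.smooth hp v (N + 1)
    have hs : ∀ u v : E × E, ContDiffAt ℝ N (dirDeriv u (dirDeriv v Ψ)) (x, ξ) := fun u v =>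
      (ContDiffOn.at_nonzeroDir (contDiffOn_dirDeriv (contDiffOn_dirDeriv h.smooth v) u) hp).of_le
        (mod_cast le_top)
    have e : iteratedFDeriv ℝ N (RayTransform.john a b Ψ) (x, ξ)
        = iteratedFDeriv ℝ N (dirDeriv (a, 0) (dirDeriv (0, b) Ψ)) (x, ξ)
          - iteratedFDeriv ℝ N (dirDeriv (b, 0) (dirDeriv (0, a) Ψ)) (x, ξ) :=
      iteratedFDeriv_sub_apply (hs _ _) (hs _ _)
    have h1 := hb (a, 0) (0, b)
    have h2 := hb (b, 0) (0, a)
    simp only [Prod.norm_mk, norm_zero, norm_nonneg, sup_of_le_left, sup_of_le_right] at h1 h2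
    calc (1 + ‖x‖) ^ k * ‖iteratedFDeriv ℝ N (RayTransform.john a b Ψ) (x, ξ)‖
        ≤ (1 + ‖x‖) ^ k * (‖a‖ * ‖b‖ * ‖iteratedFDeriv ℝ (N + 2) Ψ (x, ξ)‖
          + ‖b‖ * ‖a‖ * ‖iteratedFDeriv ℝ (N + 2) Ψ (x, ξ)‖) := by
          rw [e]; gcongr; exact (norm_sub_le _ _).trans (add_le_add h1 h2)
      _ = (‖a‖ * ‖b‖ + ‖b‖ * ‖a‖) * ((1 + ‖x‖) ^ k * ‖iteratedFDeriv ℝ (N + 2) Ψ (x, ξ)‖) := by ring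
      _ ≤ _ := by gcongr; exact hC x ξ hξ hx

/-- All derivatives decay fast on the strips `|⟨x, ν⟩| ≤ 1`, locally uniformly in `ξ` and `ν` with
`⟨ξ, ν⟩ = 1`. -/
structure StripDecay (Γ : E × E → ℂ) : Prop where
  smooth : ContDiffOn ℝ ∞ Γ (nonzeroDir E)
  decay : ∀ (R : ℝ) (k N : ℕ), ∃ C : ℝ, ∀ x ξ ν : E, ‖ξ‖ ≤ R → ‖ν‖ ≤ R → ⟪ξ, ν⟫ = 1 →
    |⟪x, ν⟫| ≤ 1 → (1 + ‖x‖) ^ k * ‖iteratedFDeriv ℝ N Γ (x, ξ)‖ ≤ C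

lemma ne_zero_of_inner_eq_one {ξ ν : E} (h : ⟪ξ, ν⟫ = 1) : ξ ≠ 0 := by
  rintro rfl
  simp at h

lemma StripDecay.dirDeriv {Γ : E × E → ℂ} (h : StripDecay Γ) (v : E × E) :
    StripDecay (dirDeriv v Γ) where
  smooth := contDiffOn_dirDeriv h.smooth v
  decay R k N := by
    obtain ⟨C, hC⟩ := h.decay R k (N + 1)
    refine ⟨‖v‖ * C, fun x ξ ν h1 h2 h3 h4 => ?_⟩
    have hp : ((x, ξ) : E × E) ∈ nonzeroDir E := ne_zero_of_inner_eq_one h3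
    calc (1 + ‖x‖) ^ k * ‖iteratedFDeriv ℝ N (RayTransform.dirDeriv v Γ) (x, ξ)‖
        ≤ (1 + ‖x‖) ^ k * (‖v‖ * ‖iteratedFDeriv ℝ (N + 1) Γ (x, ξ)‖) := by
          gcongr; exact norm_iteratedFDeriv_dirDeriv_le h.smooth hp v N
      _ = ‖v‖ * ((1 + ‖x‖) ^ k * ‖iteratedFDeriv ℝ (N + 1) Γ (x, ξ)‖) := by ring
      _ ≤ _ := by gcongr; exact hC x ξ ν h1 h2 h3 h4

/-- Equivariance moves `(x, ξ)` to the orthogonal unit representative `(x₀, rξ)`, where decay is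
assumed. Inside the strip the shear parameter is `O(1 + ‖x₀‖)`, so `N` derivatives lose at most a
factor `(1 + ‖x₀‖) ^ N`. -/
lemma RayLike.stripDecay {m : ℕ} {Ψ : E × E → ℂ} (h : RayLike m Ψ) : StripDecay Ψ where
  smooth := h.smooth
  decay R₀ k N := by
    -- The surplus power `N` absorbs the growth of the shear matrix.
    obtain ⟨C, hC⟩ := h.decay (k + N) N
    set R := max R₀ 1 with hR
    have hR1 : 1 ≤ R := le_max_right _ _
    refine ⟨(1 + R + R ^ 2) ^ k * (R ^ (m + 1) * (2 + R) ^ N) * C, fun x ξ ν h1 h2 h3 h4 => ?_⟩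
    replace h1 : ‖ξ‖ ≤ R := h1.trans (le_max_left _ _)
    replace h2 : ‖ν‖ ≤ R := h2.trans (le_max_left _ _)
    have hp : ((x, ξ) : E × E) ∈ nonzeroDir E := ne_zero_of_inner_eq_one h3
    have hξ0 : 0 < ‖ξ‖ := norm_pos_iff.2 (ne_zero_of_inner_eq_one h3)
    have hξR : ‖ξ‖⁻¹ ≤ R := by
      have : 1 ≤ ‖ξ‖ * ‖ν‖ := h3 ▸ real_inner_le_norm ξ ν
      rw [inv_le_iff_one_le_mul₀ hξ0, mul_comm]
      exact this.trans (by gcongr)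
    set r := ‖ξ‖⁻¹ with hr
    have hr0 : 0 < r := by positivity
    set t := -(⟪x, ξ⟫ / ‖ξ‖ ^ 2) with ht
    set x₀ := x + t • ξ with hx₀
    have horth : ⟪x₀, r • ξ⟫ = 0 := by
      rw [hx₀, inner_smul_right, inner_add_left, real_inner_smul_left, real_inner_self_eq_norm_sq, ht]
      field_simp
      ring
    have hunit : ‖r • ξ‖ = 1 := by
      rw [norm_smul, hr, norm_inv, norm_norm, inv_mul_cancel₀ hξ0.ne']
    have htb : |t| ≤ 1 + R * ‖x₀‖ := by
      -- Pairing `x₀ = x + tξ` with `ν` isolates `t`, since `⟪ξ, ν⟫ = 1`.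
      have e : t = ⟪x₀, ν⟫ - ⟪x, ν⟫ := by
        rw [hx₀, inner_add_left, real_inner_smul_left, h3]; ring
      rw [e]
      refine (abs_sub _ _).trans ?_
      have := abs_real_inner_le_norm x₀ ν
      have : ‖x₀‖ * ‖ν‖ ≤ ‖x₀‖ * R := by gcongr
      linarith
    have hxb : 1 + ‖x‖ ≤ (1 + R + R ^ 2) * (1 + ‖x₀‖) := by
      have e : x = x₀ - t • ξ := by rw [hx₀]; abel
      have e1 : ‖x‖ ≤ ‖x₀‖ + |t| * ‖ξ‖ := by
        conv_lhs => rw [e]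
        exact (norm_sub_le _ _).trans (by rw [norm_smul, Real.norm_eq_abs])
      have e2 : |t| * ‖ξ‖ ≤ (1 + R * ‖x₀‖) * R := by gcongr
      nlinarith [norm_nonneg x₀]
    have hMb : 1 + |t| + |r| ≤ (2 + R) * (1 + ‖x₀‖) := by
      rw [abs_of_pos hr0]
      nlinarith [norm_nonneg x₀]
    have hcb : |(r ^ m * |r|⁻¹)⁻¹| ≤ R ^ (m + 1) := by
      have hri : r⁻¹ = ‖ξ‖ := by rw [hr, inv_inv]
      rw [abs_of_pos hr0, abs_of_pos (by positivity), mul_inv, inv_inv, ← inv_pow, hri, pow_succ]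
      gcongr
    have hD := iteratedFDeriv_of_equivariant h.smooth (fun p => shearScale_mem t hr0.ne')
      (h.eq_mul t hr0.ne') N hp
    have hDn : ‖iteratedFDeriv ℝ N Ψ (x, ξ)‖ ≤ R ^ (m + 1) *
        (‖iteratedFDeriv ℝ N Ψ (x₀, r • ξ)‖ * ((2 + R) * (1 + ‖x₀‖)) ^ N) := by
      rw [hD, norm_smul, Real.norm_eq_abs]
      gcongr
      refine (ContinuousMultilinearMap.norm_compContinuousLinearMap_le _ _).trans ?_
      rw [Finset.prod_const, Finset.card_univ, Fintype.card_fin]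
      gcongr
      · exact le_of_eq rfl
      · exact (norm_shearScale_le t hr0.ne').trans hMb
    calc (1 + ‖x‖) ^ k * ‖iteratedFDeriv ℝ N Ψ (x, ξ)‖
        ≤ ((1 + R + R ^ 2) * (1 + ‖x₀‖)) ^ k * (R ^ (m + 1) *
          (‖iteratedFDeriv ℝ N Ψ (x₀, r • ξ)‖ * ((2 + R) * (1 + ‖x₀‖)) ^ N)) := by gcongr
      _ = (1 + R + R ^ 2) ^ k * (R ^ (m + 1) * (2 + R) ^ N) *
          ((1 + ‖x₀‖) ^ (k + N) * ‖iteratedFDeriv ℝ N Ψ (x₀, r • ξ)‖) := by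
          rw [mul_pow, mul_pow, pow_add]; ring
      _ ≤ _ := by gcongr; exact hC _ _ hunit horth

end Calculus

/-! ### Cutting functions constant along `ξ` down to Schwartz functions -/

section Window

variable {E : Type} [NormedAddCommGroup E] [InnerProductSpace ℝ E] [FiniteDimensional ℝ E]
  [MeasurableSpace E] [BorelSpace E]

/-- A smooth function on the line supported in `[-1, 1]`, of integral one. -/
def window : ℝ → ℝ := (⟨1 / 2, 1, by norm_num, by norm_num⟩ : ContDiffBump (0 : ℝ)).normed volume

lemma contDiff_window {n : ℕ∞} : ContDiff ℝ n window := ContDiffBump.contDiff_normed _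

lemma integral_window : ∫ t, window t = 1 := ContDiffBump.integral_normed _

lemma integrable_window : Integrable window := ContDiffBump.integrable_normed _

lemma tsupport_window : tsupport window = Metric.closedBall 0 1 :=
  ContDiffBump.tsupport_normed_eq _

lemma hasCompactSupport_window : HasCompactSupport window :=
  ContDiffBump.hasCompactSupport_normed _

lemma window_zero_ne : window 0 ≠ 0 := by
  have : (0 : ℝ) ∈ Function.support window := by
    rw [window, ContDiffBump.support_normed_eq]
    simp
  exact this

lemma iteratedFDeriv_window_eq_zero {t : ℝ} (ht : 1 < |t|) (j : ℕ) :
    iteratedFDeriv ℝ j window t = 0 := by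
  by_contra h
  have := support_iteratedFDeriv_subset (𝕜 := ℝ) (f := window) j h
  rw [tsupport_window] at this
  simp at this
  linarith

lemma exists_bound_iteratedFDeriv_window (j : ℕ) : ∃ C, ∀ t, ‖iteratedFDeriv ℝ j window t‖ ≤ C :=
  (hasCompactSupport_window.iteratedFDeriv j).exists_bound_of_continuous
    (contDiff_window (n := ⊤)|>.continuous_iteratedFDeriv (mod_cast le_top))

/-- The restriction of `Γ(·, ξ)` to the strip `|⟨x, ν⟩| ≤ 1`. -/
def cutoff (Γ : E × E → ℂ) (ξ ν x : E) : ℂ := window ⟪x, ν⟫ • Γ (x, ξ)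

lemma contDiff_slice {Γ : E × E → ℂ} (h : ContDiffOn ℝ ∞ Γ (nonzeroDir E)) {ξ : E} (hξ : ξ ≠ 0) :
    ContDiff ℝ ∞ (fun x => Γ (x, ξ)) :=
  h.comp_contDiff (contDiff_id.prodMk contDiff_const) fun _ => hξ

lemma hasFDerivAt_slice {Γ : E × E → ℂ} (h : ContDiffOn ℝ ∞ Γ (nonzeroDir E)) {ξ : E} (hξ : ξ ≠ 0)
    (x : E) : HasFDerivAt (fun x => Γ (x, ξ))
      ((fderiv ℝ Γ (x, ξ)).comp (ContinuousLinearMap.inl ℝ E E)) x := by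
  have h1 : HasFDerivAt Γ (fderiv ℝ Γ (x, ξ)) (x, ξ) :=
    (differentiableAt_of_nonzeroDir h (p := (x, ξ)) hξ).hasFDerivAt
  exact h1.comp x ((hasFDerivAt_id x).prodMk (hasFDerivAt_const ξ x))

lemma norm_iteratedFDeriv_slice_le {Γ : E × E → ℂ} (h : ContDiffOn ℝ ∞ Γ (nonzeroDir E)) {ξ : E}
    (hξ : ξ ≠ 0) (x : E) (N : ℕ) :
    ‖iteratedFDeriv ℝ N (fun x => Γ (x, ξ)) x‖ ≤ ‖iteratedFDeriv ℝ N Γ (x, ξ)‖ := by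
  -- The inclusion `x ↦ (x, ξ)` is affine. It is split into the linear map `inl` and a translation
  -- so that the chain rule for linear maps applies.
  set s : Set (E × E) := (fun p => p + (0, ξ)) ⁻¹' nonzeroDir E with hs
  have hso : IsOpen s := isOpen_nonzeroDir.preimage (by fun_prop)
  have hpre : (ContinuousLinearMap.inl ℝ E E) ⁻¹' s = Set.univ := by
    ext z; simpa [hs, nonzeroDir] using hξ
  have hc : ContDiffOn ℝ N (fun p => Γ (p + (0, ξ))) s :=
    (h.of_le (mod_cast le_top)).comp (by fun_prop) fun p hp => hp
  have key := (ContinuousLinearMap.inl ℝ E E).iteratedFDerivWithin_comp_right hc hso.uniqueDiffOn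
    (by rw [hpre]; exact uniqueDiffOn_univ) (x := x) (by simpa [hs, nonzeroDir] using hξ)
    (le_refl (N : WithTop ℕ∞))
  rw [hpre, iteratedFDerivWithin_univ, iteratedFDerivWithin_of_isOpen N hso
    (by simpa [hs, nonzeroDir] using hξ), iteratedFDeriv_comp_add_right] at key
  have e : (fun p : E × E => Γ (p + (0, ξ))) ∘ (ContinuousLinearMap.inl ℝ E E)
      = fun x => Γ (x, ξ) := by ext z; simp
  rw [e] at key
  rw [key]
  refine (ContinuousMultilinearMap.norm_compContinuousLinearMap_le _ _).trans ?_
  simp only [ContinuousLinearMap.inl_apply, Prod.mk_add_mk, add_zero, zero_add, Finset.prod_const]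
  refine mul_le_of_le_one_right (norm_nonneg _) (pow_le_one₀ (norm_nonneg _) ?_)
  exact ContinuousLinearMap.opNorm_le_bound _ zero_le_one fun z => by simp [Prod.norm_def]

lemma norm_iteratedFDeriv_window_inner_le (ν x : E) (N : ℕ) :
    ‖iteratedFDeriv ℝ N (fun x => window ⟪x, ν⟫) x‖
      ≤ ‖iteratedFDeriv ℝ N window ⟪x, ν⟫‖ * ‖ν‖ ^ N := by
  have key := (innerSL ℝ ν).iteratedFDeriv_comp_right (contDiff_window (n := ⊤)) x
    (i := N) (mod_cast le_top)
  have e : window ∘ (innerSL ℝ ν) = fun x => window ⟪x, ν⟫ := by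
    ext z; simp [real_inner_comm]
  rw [e] at key
  rw [key]
  refine (ContinuousMultilinearMap.norm_compContinuousLinearMap_le _ _).trans ?_
  rw [Finset.prod_const, Finset.card_univ, Fintype.card_fin, innerSL_apply_norm, innerSL_apply_apply,
    real_inner_comm]

lemma contDiff_window_inner (ν : E) : ContDiff ℝ ∞ (fun x : E => window ⟪x, ν⟫) :=
  (contDiff_window (n := ⊤)).comp (contDiff_id.inner ℝ contDiff_const)

lemma StripDecay.contDiff_cutoff {Γ : E × E → ℂ} (h : StripDecay Γ) {ξ : E} (hξ : ξ ≠ 0) (ν : E) :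
    ContDiff ℝ ∞ (cutoff Γ ξ ν) :=
  (contDiff_window_inner ν).smul (contDiff_slice h.smooth hξ)

lemma StripDecay.cutoff_bound {Γ : E × E → ℂ} (h : StripDecay Γ) (R : ℝ) (k N : ℕ) :
    ∃ C : ℝ, ∀ ξ ν : E, ‖ξ‖ ≤ R → ‖ν‖ ≤ R → ⟪ξ, ν⟫ = 1 → ∀ x,
      (1 + ‖x‖) ^ k * ‖iteratedFDeriv ℝ N (cutoff Γ ξ ν) x‖ ≤ C := by
  choose H hH using exists_bound_iteratedFDeriv_window
  choose C hC using fun i => h.decay R k i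
  refine ⟨∑ i ∈ Finset.range (N + 1), (N.choose i : ℝ) * (H i * R ^ i) * |C (N - i)|,
    fun ξ ν h1 h2 h3 x => ?_⟩
  have hR : 0 ≤ R := (norm_nonneg ξ).trans h1
  have hξ := ne_zero_of_inner_eq_one h3
  have hH0 : ∀ i, 0 ≤ H i := fun i => (norm_nonneg _).trans (hH i 0)
  have hL := norm_iteratedFDeriv_smul_le (𝕜 := ℝ) (contDiff_window_inner ν)
    (contDiff_slice h.smooth hξ) x (n := N) (mod_cast le_top)
  calc (1 + ‖x‖) ^ k * ‖iteratedFDeriv ℝ N (cutoff Γ ξ ν) x‖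
      ≤ (1 + ‖x‖) ^ k * ∑ i ∈ Finset.range (N + 1), (N.choose i : ℝ) *
        ‖iteratedFDeriv ℝ i (fun x => window ⟪x, ν⟫) x‖ *
        ‖iteratedFDeriv ℝ (N - i) (fun x => Γ (x, ξ)) x‖ := by gcongr; exact hL
    _ = ∑ i ∈ Finset.range (N + 1), (N.choose i : ℝ) *
        ‖iteratedFDeriv ℝ i (fun x => window ⟪x, ν⟫) x‖ *
        ((1 + ‖x‖) ^ k * ‖iteratedFDeriv ℝ (N - i) (fun x => Γ (x, ξ)) x‖) := by
        rw [Finset.mul_sum]; exact Finset.sum_congr rfl fun i _ => by ring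
    _ ≤ _ := by
        refine Finset.sum_le_sum fun i _ => ?_
        rcases le_or_gt |⟪x, ν⟫| 1 with hx | hx
        · have e1 : ‖iteratedFDeriv ℝ i (fun x => window ⟪x, ν⟫) x‖ ≤ H i * R ^ i :=
            (norm_iteratedFDeriv_window_inner_le ν x i).trans
              (mul_le_mul (hH i _) (by gcongr) (by positivity) (hH0 i))
          have e2 : (1 + ‖x‖) ^ k * ‖iteratedFDeriv ℝ (N - i) (fun x => Γ (x, ξ)) x‖
              ≤ |C (N - i)| := by
            refine le_trans ?_ ((hC (N - i) x ξ ν h1 h2 h3 hx).trans (le_abs_self _))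
            gcongr
            exact norm_iteratedFDeriv_slice_le h.smooth hξ x _
          have := hH0 i
          gcongr
        · have : ‖iteratedFDeriv ℝ i (fun x => window ⟪x, ν⟫) x‖ ≤ 0 := by
            refine (norm_iteratedFDeriv_window_inner_le ν x i).trans ?_
            rw [iteratedFDeriv_window_eq_zero hx]; simp
          rw [le_antisymm this (norm_nonneg _)]
          have := hH0 i
          simp only [mul_zero, zero_mul]
          positivity

/-- The function `cutoff Γ ξ ν` as a Schwartz function. -/
def StripDecay.toSchwartz {Γ : E × E → ℂ} (h : StripDecay Γ) {ξ ν : E} (hξ : ⟪ξ, ν⟫ = 1) :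
    𝓢(E, ℂ) where
  toFun := cutoff Γ ξ ν
  smooth' := h.contDiff_cutoff (ne_zero_of_inner_eq_one hξ) ν
  decay' k N := by
    obtain ⟨C, hC⟩ := h.cutoff_bound (max ‖ξ‖ ‖ν‖) k N
    refine ⟨C, fun x => le_trans ?_ (hC ξ ν (le_max_left _ _) (le_max_right _ _) hξ x)⟩
    gcongr
    linarith [norm_nonneg x]

@[simp] lemma StripDecay.toSchwartz_apply {Γ : E × E → ℂ} (h : StripDecay Γ) {ξ ν : E}
    (hξ : ⟪ξ, ν⟫ = 1) (x : E) : h.toSchwartz hξ x = cutoff Γ ξ ν x := rfl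

lemma StripDecay.coe_toSchwartz {Γ : E × E → ℂ} (h : StripDecay Γ) {ξ ν : E}
    (hξ : ⟪ξ, ν⟫ = 1) : (h.toSchwartz hξ : E → ℂ) = cutoff Γ ξ ν := rfl

lemma inner_self_of_unit {ξ : E} (hξ : ‖ξ‖ = 1) : ⟪ξ, ξ⟫ = 1 := by
  rw [real_inner_self_eq_norm_sq, hξ, one_pow]

open Classical in
/-- The family of Schwartz functions `cutoff Γ ξ ξ` with `|ξ| = 1`. -/
def StripDecay.family {Γ : E × E → ℂ} (h : StripDecay Γ) (ξ : E) : 𝓢(E, ℂ) :=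
  if hξ : ‖ξ‖ = 1 then h.toSchwartz (inner_self_of_unit hξ) else 0

lemma StripDecay.family_eq {Γ : E × E → ℂ} (h : StripDecay Γ) {ξ : E} (hξ : ‖ξ‖ = 1) :
    h.family ξ = h.toSchwartz (inner_self_of_unit hξ) := dif_pos hξ

lemma StripDecay.uniformlySchwartz {Γ : E × E → ℂ} (h : StripDecay Γ) :
    UniformlySchwartz h.family := by
  intro k l
  obtain ⟨C, hC⟩ := h.cutoff_bound 1 k l
  refine ⟨|C|, fun ξ hξ => ?_⟩
  rw [h.family_eq hξ]
  refine SchwartzMap.seminorm_le_bound ℂ k l _ (abs_nonneg C) fun x => ?_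
  refine le_trans ?_ ((hC ξ ξ hξ.le hξ.le (inner_self_of_unit hξ) x).trans (le_abs_self C))
  rw [h.coe_toSchwartz]
  gcongr
  linarith [norm_nonneg x]

/-- The window is constant in directions orthogonal to `ν`, so the derivative falls on `Γ` alone. -/
lemma StripDecay.lineDeriv_toSchwartz {Γ : E × E → ℂ} (h : StripDecay Γ) {ξ ν a : E}
    (hξ : ⟪ξ, ν⟫ = 1) (ha : ⟪a, ν⟫ = 0) :
    ∂_{a} (h.toSchwartz hξ) = (h.dirDeriv (a, 0)).toSchwartz hξ := by
  ext x
  rw [SchwartzMap.lineDerivOp_apply_eq_fderiv, h.coe_toSchwartz, StripDecay.toSchwartz_apply]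
  have h1 := hasFDerivAt_slice h.smooth (ne_zero_of_inner_eq_one hξ) x
  have h2 : HasFDerivAt (fun x : E => window ⟪x, ν⟫) _ x :=
    ((contDiff_window (n := ⊤)).differentiable (by simp) _).hasFDerivAt.comp x
      ((hasFDerivAt_id x).inner ℝ (hasFDerivAt_const ν x))
  have h3 : HasFDerivAt (cutoff Γ ξ ν) _ x := h2.smul h1
  rw [h3.fderiv]
  simp [cutoff, RayTransform.dirDeriv, ha]

lemma StripDecay.fourier_cutoff_dirDeriv {Γ : E × E → ℂ} (h : StripDecay Γ) {ξ ν a : E}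
    (hξ : ⟪ξ, ν⟫ = 1) (ha : ⟪a, ν⟫ = 0) (y : E) :
    𝓕 (cutoff (RayTransform.dirDeriv (a, 0) Γ) ξ ν) y
      = 2 * π * Complex.I * ⟪y, a⟫ * 𝓕 (cutoff Γ ξ ν) y := by
  have := congrArg (fun f : 𝓢(E, ℂ) => f y) (SchwartzMap.fourier_lineDerivOp_eq (h.toSchwartz hξ) a)
  rw [h.lineDeriv_toSchwartz hξ ha, SchwartzMap.fourier_coe, smul_apply,
    SchwartzMap.smulLeftCLM_apply_apply (by fun_prop), SchwartzMap.fourier_coe] at this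
  rw [StripDecay.coe_toSchwartz, StripDecay.coe_toSchwartz] at this
  rw [this]
  simp only [smul_eq_mul, Complex.real_smul]
  ring

/-- Exchange of the weights `a` and `k ⟨·, ν⟩` in integrals of functions invariant along `ξ`. -/
lemma integral_window_swap {U a : E → ℂ} {ξ ν : E} (hU : ∀ x (t : ℝ), U (x + t • ξ) = U x)
    (hA : Integrable (fun x => U x * a x)) {k : ℝ → ℂ} (hk : Integrable k) (hc : ⟪ξ, ν⟫ ≠ 0) :
    Integrable (fun x => U x * k ⟪x, ν⟫ * ∫ t : ℝ, a (x - t • ξ)) ∧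
    ((|⟪ξ, ν⟫|⁻¹ : ℝ) : ℂ) * (∫ t, k t) * ∫ x, U x * a x
      = ∫ x, U x * k ⟪x, ν⟫ * ∫ t : ℝ, a (x - t • ξ) := by
  set c := ⟪ξ, ν⟫ with hcdef
  have hline : ∀ x : E, ∫ t : ℝ, k (⟪x, ν⟫ + t * c) = ((|c|⁻¹ : ℝ) : ℂ) * ∫ t, k t := by
    intro x
    have e : ∀ t : ℝ, ⟪x, ν⟫ + t * c = (t + ⟪x, ν⟫ / c) * c := fun t => by field_simp; ring
    simp only [e]
    rw [integral_add_right_eq_self (μ := volume) (fun t : ℝ => k (t * c)) (⟪x, ν⟫ / c),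
      Measure.integral_comp_mul_right, abs_inv, Complex.real_smul]
  -- The identity comes from inserting `∫ k (⟪x, ν⟫ + t c) dt = |c|⁻¹ ∫ k`, exchanging the integrals
  -- and translating `x` by `t • ξ`, which leaves `U` unchanged. The two integrability claims
  -- justify the exchanges; each follows from a measure-preserving shear of `E × ℝ`.
  have hint : Integrable (fun q : E × ℝ => U q.1 * a q.1 * k (⟪q.1, ν⟫ + q.2 * c))
      (volume.prod volume) := by
    have hB : Integrable (fun t : ℝ => k (t * c)) := hk.comp_mul_right' hc
    have hmp : MeasurePreserving (fun q : E × ℝ => (q.1, q.2 + ⟪q.1, ν⟫ / c))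
        (volume.prod volume) (volume.prod volume) :=
      MeasurePreserving.skew_product (g := fun x t => t + ⟪x, ν⟫ / c) (MeasurePreserving.id _)
        (by fun_prop) (Eventually.of_forall fun x => (measurePreserving_add_right volume _).map_eq)
    have := hmp.integrable_comp_of_integrable (hA.mul_prod hB)
    refine this.congr (Eventually.of_forall fun q => ?_)
    simp only [Function.comp]
    congr 2
    field_simp; ring
  have hint2 : Integrable (fun q : ℝ × E => U q.2 * a (q.2 - q.1 • ξ) * k ⟪q.2, ν⟫)
      (volume.prod volume) := by
    have hmp : MeasurePreserving (fun q : ℝ × E => (q.1, q.2 - q.1 • ξ))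
        (volume.prod volume) (volume.prod volume) :=
      MeasurePreserving.skew_product (g := fun t x => x - t • ξ) (MeasurePreserving.id _)
        (by fun_prop) (Eventually.of_forall fun t => (measurePreserving_sub_right volume _).map_eq)
    have := hmp.integrable_comp_of_integrable hint.swap
    refine this.congr (Eventually.of_forall fun q => ?_)
    simp only [Function.comp, Prod.swap]
    have e1 : U (q.2 - q.1 • ξ) = U q.2 := by
      have := hU q.2 (-q.1)
      rwa [neg_smul, ← sub_eq_add_neg] at this
    have e2 : ⟪q.2 - q.1 • ξ, ν⟫ + q.1 * c = ⟪q.2, ν⟫ := by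
      rw [inner_sub_left, real_inner_smul_left]; ring
    rw [e1, e2]
  have hlast : ∀ x, ∫ t : ℝ, U x * a (x - t • ξ) * k ⟪x, ν⟫
      = U x * k ⟪x, ν⟫ * ∫ t : ℝ, a (x - t • ξ) := by
    intro x
    rw [← integral_const_mul]
    congr 1; ext t; ring
  refine ⟨hint2.swap.integral_prod_left.congr (Eventually.of_forall hlast), ?_⟩
  calc ((|c|⁻¹ : ℝ) : ℂ) * (∫ t, k t) * ∫ x, U x * a x
      = ∫ x, ∫ t : ℝ, U x * a x * k (⟪x, ν⟫ + t * c) := by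
        rw [← integral_const_mul]
        congr 1; ext x
        rw [integral_const_mul, hline]; ring
    _ = ∫ t : ℝ, ∫ x, U x * a x * k (⟪x, ν⟫ + t * c) := integral_integral_swap hint
    _ = ∫ t : ℝ, ∫ x, U x * a (x - t • ξ) * k ⟪x, ν⟫ := by
        congr 1; ext t
        rw [← integral_sub_right_eq_self (μ := volume)
          (fun x => U x * a x * k (⟪x, ν⟫ + t * c)) (t • ξ)]
        congr 1; ext x
        have e1 : U (x - t • ξ) = U x := by
          have := hU x (-t)
          rwa [neg_smul, ← sub_eq_add_neg] at this
        have e2 : ⟪x - t • ξ, ν⟫ + t * c = ⟪x, ν⟫ := by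
          rw [inner_sub_left, real_inner_smul_left]; ring
        rw [e1, e2]
    _ = ∫ x, ∫ t : ℝ, U x * a (x - t • ξ) * k ⟪x, ν⟫ := integral_integral_swap hint2
    _ = _ := by simp only [hlast]

end Window

/-! ### Differentiating moments of Schwartz functions along lines -/

section Moments

variable {E : Type} [NormedAddCommGroup E] [InnerProductSpace ℝ E]

lemma exists_schwartz_bound {E V : Type} [NormedAddCommGroup E] [NormedSpace ℝ E]
    [NormedAddCommGroup V] [NormedSpace ℝ V] (f : 𝓢(E, V)) (k : ℕ) :
    ∃ C : ℝ, ∀ x, (1 + ‖x‖) ^ k * ‖f x‖ ≤ C := by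
  refine ⟨2 ^ k * ((Finset.Iic (k, 0)).sup fun m => SchwartzMap.seminorm ℝ m.1 m.2) f,
    fun x => ?_⟩
  have := SchwartzMap.one_add_le_sup_seminorm_apply (𝕜 := ℝ) (m := (k, 0)) (le_refl k) (le_refl 0) f x
  rwa [norm_iteratedFDeriv_zero] at this

/-- Around every `(x, ξ)` with `ξ ≠ 0`, the line parameter is controlled by the position. -/
lemma exists_one_add_abs_le {p₀ : E × E} (hp₀ : p₀ ∈ nonzeroDir E) :
    ∃ ε > 0, ∃ K > 0, ∀ p ∈ Metric.ball p₀ ε, ∀ t : ℝ, 1 + |t| ≤ K * (1 + ‖p.1 + t • p.2‖) := by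
  set ρ := ‖p₀.2‖ with hρ
  have hρ0 : 0 < ρ := norm_pos_iff.2 hp₀
  set A := ‖p₀.1‖ + ρ / 2 with hA
  have hA0 : 0 ≤ A := by positivity
  refine ⟨ρ / 2, by positivity, 1 + 2 / ρ * (1 + A), by positivity, fun p hp t => ?_⟩
  rw [Metric.mem_ball, Prod.dist_eq, max_lt_iff, dist_eq_norm, dist_eq_norm] at hp
  have h1 : ‖p.1‖ ≤ A := by
    have := norm_le_insert' p.1 p₀.1
    linarith [hp.1]
  have h2 : ρ / 2 ≤ ‖p.2‖ := by
    have := norm_le_insert p.2 p₀.2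
    rw [norm_sub_rev] at hp
    have h3 : ‖p₀.2‖ ≤ ‖p.2‖ + ‖p₀.2 - p.2‖ := norm_le_insert' _ _
    rw [norm_sub_rev p₀.2] at h3
    linarith [hp.2]
  set z := ‖p.1 + t • p.2‖ with hz
  have h3 : |t| * (ρ / 2) ≤ z + A := by
    have e : ‖t • p.2‖ ≤ ‖p.1 + t • p.2‖ + ‖p.1‖ := by
      simpa using norm_sub_le (p.1 + t • p.2) p.1
    rw [norm_smul, Real.norm_eq_abs] at e
    calc |t| * (ρ / 2) ≤ |t| * ‖p.2‖ := by gcongr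
      _ ≤ z + A := by linarith
  have hz0 : 0 ≤ z := norm_nonneg _
  have h4 : |t| ≤ 2 / ρ * (z + A) := by
    rw [div_mul_eq_mul_div, le_div_iff₀ hρ0]; linarith
  have h5 : 2 / ρ * (z + A) ≤ 2 / ρ * (1 + A) * (1 + z) := by
    rw [mul_assoc]; gcongr; nlinarith
  nlinarith

/-- The moments `∫ t^k f(x + tξ) dt` of a function along a line. -/
def rayMoment (k : ℕ) (f : 𝓢(E, ℂ)) (p : E × E) : ℂ := ∫ t : ℝ, (t : ℂ) ^ k * f (p.1 + t • p.2)

/-- A uniform integrable bound for moments of Schwartz functions along lines. -/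
lemma exists_moment_bound {V : Type} [NormedAddCommGroup V] [NormedSpace ℝ V] (f : 𝓢(E, V))
    (k : ℕ) {p₀ : E × E} (hp₀ : p₀ ∈ nonzeroDir E) :
    ∃ ε > 0, ∃ C, ∀ p ∈ Metric.ball p₀ ε, ∀ t : ℝ,
      (1 + |t|) ^ k * ‖f (p.1 + t • p.2)‖ ≤ C * (1 + t ^ 2)⁻¹ := by
  obtain ⟨ε, hε, K, hK, h⟩ := exists_one_add_abs_le hp₀
  -- Two powers beyond `k` pay for the integrable majorant `(1 + t ^ 2)⁻¹`.
  obtain ⟨C, hC⟩ := exists_schwartz_bound f (k + 2)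
  refine ⟨ε, hε, K ^ (k + 2) * C, fun p hp t => ?_⟩
  rw [← div_eq_mul_inv, le_div_iff₀ (by positivity)]
  have h1 : 1 + t ^ 2 ≤ (1 + |t|) ^ 2 := by
    rw [← sq_abs]; nlinarith [abs_nonneg t]
  calc (1 + |t|) ^ k * ‖f (p.1 + t • p.2)‖ * (1 + t ^ 2)
      ≤ (1 + |t|) ^ k * ‖f (p.1 + t • p.2)‖ * (1 + |t|) ^ 2 := by gcongr
    _ = (1 + |t|) ^ (k + 2) * ‖f (p.1 + t • p.2)‖ := by ring
    _ ≤ (K * (1 + ‖p.1 + t • p.2‖)) ^ (k + 2) * ‖f (p.1 + t • p.2)‖ := by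
        gcongr; exact h p hp t
    _ = K ^ (k + 2) * ((1 + ‖p.1 + t • p.2‖) ^ (k + 2) * ‖f (p.1 + t • p.2)‖) := by
        rw [mul_pow]; ring
    _ ≤ _ := by gcongr; exact hC _

lemma integrable_rayMoment (k : ℕ) (f : 𝓢(E, ℂ)) {p : E × E} (hp : p ∈ nonzeroDir E) :
    Integrable (fun t : ℝ => (t : ℂ) ^ k * f (p.1 + t • p.2)) := by
  obtain ⟨ε, hε, C, hC⟩ := exists_moment_bound f k hp
  refine (integrable_inv_one_add_sq.const_mul C).mono' ?_ (Eventually.of_forall fun t => ?_)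
  · exact Continuous.aestronglyMeasurable (by fun_prop)
  · refine le_trans ?_ (hC p (Metric.mem_ball_self hε) t)
    rw [norm_mul, norm_pow, Complex.norm_real, Real.norm_eq_abs]
    gcongr
    linarith

lemma hasFDerivAt_integral_comp {W : Type} [NormedAddCommGroup W] [NormedSpace ℝ W]
    (f : 𝓢(E, ℂ)) (k : ℕ) {A : ℝ → (W →L[ℝ] E)} (hA : Continuous A) (hAn : ∀ t, ‖A t‖ ≤ 1 + |t|)
    {w : W} {ε C : ℝ} (hε : 0 < ε)
    (hC : ∀ q ∈ Metric.ball w ε, ∀ t : ℝ, (1 + |t|) ^ (k + 1) * ‖fderiv ℝ f (A t q)‖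
      ≤ C * (1 + t ^ 2)⁻¹)
    (hint : Integrable (fun t : ℝ => (t : ℂ) ^ k * f (A t w))) :
    Integrable (fun t : ℝ => ((t : ℂ) ^ k) • (fderiv ℝ f (A t w)).comp (A t)) ∧
    HasFDerivAt (fun q => ∫ t : ℝ, (t : ℂ) ^ k * f (A t q))
      (∫ t : ℝ, ((t : ℂ) ^ k) • (fderiv ℝ f (A t w)).comp (A t)) w := by
  let F' : W → ℝ → (W →L[ℝ] ℂ) := fun q t => ((t : ℂ) ^ k) • (fderiv ℝ f (A t q)).comp (A t)
  have hcf : Continuous (fderiv ℝ f) := (SchwartzMap.fderivCLM ℝ E ℂ f).continuous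
  have hAq : ∀ q, Continuous fun t => A t q := fun q => hA.clm_apply continuous_const
  have hF'c : Continuous (F' w) :=
    (Complex.continuous_ofReal.pow k).smul ((hcf.comp (hAq w)).clm_comp hA)
  have hbound : ∀ t : ℝ, ∀ q ∈ Metric.ball w ε, ‖F' q t‖ ≤ C * (1 + t ^ 2)⁻¹ := by
    intro t q hq
    refine le_trans ?_ (hC q hq t)
    rw [norm_smul, norm_pow, Complex.norm_real, Real.norm_eq_abs, pow_succ, mul_assoc]
    gcongr
    · linarith
    · refine (ContinuousLinearMap.opNorm_comp_le _ _).trans ?_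
      rw [mul_comm]
      gcongr
      exact hAn t
  have hF'i : Integrable (F' w) :=
    (integrable_inv_one_add_sq.const_mul C).mono' hF'c.aestronglyMeasurable
      (Eventually.of_forall fun t => hbound t w (Metric.mem_ball_self hε))
  refine ⟨hF'i, ?_⟩
  refine hasFDerivAt_integral_of_dominated_of_fderiv_le (F' := F')
    (F := fun q (t : ℝ) => (t : ℂ) ^ k * f (A t q))
    (Metric.ball_mem_nhds w hε) (Eventually.of_forall fun q =>
      ((Complex.continuous_ofReal.pow k).mul (f.continuous.comp (hAq q))).aestronglyMeasurable) hint
    hF'c.aestronglyMeasurable (Eventually.of_forall hbound) (integrable_inv_one_add_sq.const_mul C)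
    (Eventually.of_forall fun t q _ => ?_)
  have h1 : HasFDerivAt (fun q : W => f (A t q)) ((fderiv ℝ f (A t q)).comp (A t)) q :=
    (f.hasFDerivAt (A t q)).comp q (A t).hasFDerivAt
  exact h1.const_smul ((t : ℂ) ^ k)

/-- Differentiating `f (x + tξ)` in `ξ` produces a factor `t`, which is why all moments, not only
the zeroth, are considered. -/
lemma hasFDerivAt_rayMoment (k : ℕ) (f : 𝓢(E, ℂ)) {p : E × E} (hp : p ∈ nonzeroDir E) :
    ∃ L : E × E →L[ℝ] ℂ, HasFDerivAt (rayMoment k f) L p ∧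
      ∀ a b : E, L (a, b) = rayMoment k (∂_{a} f) p + rayMoment (k + 1) (∂_{b} f) p := by
  obtain ⟨ε, hε, C, hC⟩ := exists_moment_bound (SchwartzMap.fderivCLM ℝ E ℂ f) (k + 1) hp
  have hAn : ∀ t : ℝ, ‖ContinuousLinearMap.fst ℝ E E + t • ContinuousLinearMap.snd ℝ E E‖
      ≤ 1 + |t| := by
    intro t
    refine ContinuousLinearMap.opNorm_le_bound _ (by positivity) fun q => ?_
    have h1 := norm_fst_le q
    have h2 := norm_snd_le q
    change ‖q.1 + t • q.2‖ ≤ _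
    refine (norm_add_le _ _).trans ?_
    rw [norm_smul, Real.norm_eq_abs]
    have : |t| * ‖q.2‖ ≤ |t| * ‖q‖ := by gcongr
    linarith
  obtain ⟨hi, key⟩ := hasFDerivAt_integral_comp f k (w := p)
    (A := fun t => ContinuousLinearMap.fst ℝ E E + t • ContinuousLinearMap.snd ℝ E E)
    (by fun_prop) hAn hε hC (integrable_rayMoment k f hp)
  refine ⟨_, key, fun a b => ?_⟩
  rw [ContinuousLinearMap.integral_apply hi, rayMoment, rayMoment,
    ← integral_add (integrable_rayMoment k _ hp) (integrable_rayMoment (k + 1) _ hp)]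
  congr 1
  ext t
  simp only [smul_apply, ContinuousLinearMap.comp_apply, SchwartzMap.lineDerivOp_apply_eq_fderiv,
    add_apply, ContinuousLinearMap.coe_fst', ContinuousLinearMap.coe_snd',
    map_add, map_smul, smul_eq_mul, Complex.real_smul]
  ring

lemma differentiableAt_rayMoment (k : ℕ) (f : 𝓢(E, ℂ)) {p : E × E} (hp : p ∈ nonzeroDir E) :
    DifferentiableAt ℝ (rayMoment k f) p :=
  (hasFDerivAt_rayMoment k f hp).choose_spec.1.differentiableAt

lemma dirDeriv_rayMoment (k : ℕ) (f : 𝓢(E, ℂ)) {p : E × E} (hp : p ∈ nonzeroDir E) (a b : E) :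
    dirDeriv (a, b) (rayMoment k f) p = rayMoment k (∂_{a} f) p + rayMoment (k + 1) (∂_{b} f) p := by
  obtain ⟨L, h1, h2⟩ := hasFDerivAt_rayMoment k f hp
  rw [dirDeriv, h1.fderiv, h2]

lemma rayMoment_zero_fun (k : ℕ) (p : E × E) : rayMoment k (0 : 𝓢(E, ℂ)) p = 0 := by
  simp [rayMoment]

lemma rayMoment_add {k : ℕ} (f g : 𝓢(E, ℂ)) {p : E × E} (hp : p ∈ nonzeroDir E) :
    rayMoment k (f + g) p = rayMoment k f p + rayMoment k g p := by
  rw [rayMoment, rayMoment, rayMoment,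
    ← integral_add (integrable_rayMoment k f hp) (integrable_rayMoment k g hp)]
  simp [mul_add]

lemma rayMoment_smul {k : ℕ} (c : ℂ) (f : 𝓢(E, ℂ)) (p : E × E) :
    rayMoment k (c • f) p = c * rayMoment k f p := by
  rw [rayMoment, rayMoment, ← integral_const_mul]
  congr 1; ext t; simp; ring

lemma rayMoment_sum {k : ℕ} {ι : Type} (s : Finset ι) (f : ι → 𝓢(E, ℂ)) {p : E × E}
    (hp : p ∈ nonzeroDir E) :
    rayMoment k (∑ i ∈ s, f i) p = ∑ i ∈ s, rayMoment k (f i) p := by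
  classical
  induction s using Finset.induction_on with
  | empty => simp [rayMoment_zero_fun]
  | insert i s hi ih => rw [Finset.sum_insert hi, Finset.sum_insert hi, rayMoment_add _ _ hp, ih]

end Moments

/-! ### The Fourier slice theorem -/

section Slice

variable {E : Type} [NormedAddCommGroup E] [InnerProductSpace ℝ E] [FiniteDimensional ℝ E]
  [MeasurableSpace E] [BorelSpace E]

lemma fourier_eq_mul (F : E → ℂ) (y : E) : 𝓕 F y = ∫ x, (𝐞 (-⟪x, y⟫) : ℂ) * F x := by
  rw [Real.fourier_eq]
  simp [Circle.smul_def]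

lemma norm_char_mul (t : ℝ) (z : ℂ) : ‖(𝐞 t : ℂ) * z‖ = ‖z‖ := by
  rw [norm_mul, Circle.norm_coe, one_mul]

lemma integrable_char_mul {F : E → ℂ} (hF : Integrable F) (y : E) :
    Integrable (fun x => (𝐞 (-⟪x, y⟫) : ℂ) * F x) := by
  have h1 := (Real.fourierIntegral_convergent_iff (μ := volume) (f := F) y).2 hF
  exact h1.congr (Eventually.of_forall fun x => by simp [Circle.smul_def])

lemma char_add_smul {y ξ : E} (hy : ⟪y, ξ⟫ = 0) (x : E) (t : ℝ) :
    (𝐞 (-⟪x + t • ξ, y⟫) : ℂ) = 𝐞 (-⟪x, y⟫) := by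
  rw [inner_add_left, real_inner_smul_left, real_inner_comm y ξ, hy]; simp

lemma RayLike.add_smul {m : ℕ} {Ψ : E × E → ℂ} (h : RayLike m Ψ) {ξ : E} (hξ : ξ ≠ 0) (x : E)
    (t : ℝ) : Ψ (x + t • ξ, ξ) = Ψ (x, ξ) := by
  have := h.equivariant t one_ne_zero (x, ξ) hξ
  simpa using this

/-- The window modulated by the character of frequency `τ`. -/
def modWindow (τ t : ℝ) : ℂ := 𝐞 (-(τ * t)) * window t

lemma integrable_modWindow (τ : ℝ) : Integrable (modWindow τ) := by
  have h := (Real.fourierIntegral_convergent_iff (μ := volume) (V := ℝ)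
    (f := fun t => (window t : ℂ)) τ).2 integrable_window.ofReal
  refine h.congr (Eventually.of_forall fun t => ?_)
  simp [modWindow, Circle.smul_def]

lemma integral_ofReal_window : ∫ t, (window t : ℂ) = 1 := by
  have : ∫ t, ((window t : ℝ) : ℂ) = ((∫ t, window t : ℝ) : ℂ) := integral_ofReal
  rw [this, integral_window, Complex.ofReal_one]

lemma integral_window_line {ξ ν : E} (x : E) (hc : ⟪ξ, ν⟫ ≠ 0) :
    ∫ t : ℝ, (window ⟪x - t • ξ, ν⟫ : ℂ) = ((|⟪ξ, ν⟫|⁻¹ : ℝ) : ℂ) := by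
  set c := ⟪ξ, ν⟫ with hcdef
  have e : ∀ t : ℝ, ⟪x - t • ξ, ν⟫ = (t - ⟪x, ν⟫ / c) * (-c) := fun t => by
    rw [inner_sub_left, real_inner_smul_left, ← hcdef]; field_simp; ring
  simp only [e]
  rw [integral_sub_right_eq_self (μ := volume) (fun t : ℝ => (window (t * (-c)) : ℂ)) (⟪x, ν⟫ / c),
    Measure.integral_comp_mul_right (fun t => (window t : ℂ)), abs_inv, abs_neg,
    integral_ofReal_window]
  simp

/-- Integrals of a function invariant along `ξ` against different windows are proportional. -/
lemma integral_cutoff_change {m : ℕ} {Ψ : E × E → ℂ} (h : RayLike m Ψ) {ξ ν ν' y : E}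
    (hν : ⟪ξ, ν⟫ = 1) (hν' : ⟪ξ, ν'⟫ ≠ 0) (hy : ⟪y, ξ⟫ = 0) {k : ℝ → ℂ} (hk : Integrable k) :
    ((|⟪ξ, ν'⟫|⁻¹ : ℝ) : ℂ) * (∫ t, k t) * 𝓕 (cutoff Ψ ξ ν) y
      = ∫ x, (𝐞 (-⟪x, y⟫) : ℂ) * (k ⟪x, ν'⟫ * Ψ (x, ξ)) := by
  have hξ := ne_zero_of_inner_eq_one hν
  have hint : Integrable (cutoff Ψ ξ ν) := (h.stripDecay.toSchwartz hν).integrable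
  have e1 : ∀ x, (𝐞 (-⟪x, y⟫) : ℂ) * cutoff Ψ ξ ν x
      = (𝐞 (-⟪x, y⟫) : ℂ) * Ψ (x, ξ) * window ⟪x, ν⟫ := fun x => by
    rw [cutoff, Complex.real_smul]; ring
  have := (integral_window_swap (U := fun x => (𝐞 (-⟪x, y⟫) : ℂ) * Ψ (x, ξ))
    (a := fun x => (window ⟪x, ν⟫ : ℂ)) (ξ := ξ) (ν := ν')
    (fun x t => by rw [char_add_smul hy, h.add_smul hξ])
    ((integrable_char_mul hint y).congr (Eventually.of_forall e1)) hk hν').2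
  rw [fourier_eq_mul]
  simp only [e1]
  rw [this]
  congr 1; ext x
  rw [integral_window_line x (by rw [hν]; exact one_ne_zero), hν]
  simp; ring

/-- The Fourier transform of a cutoff is determined by its restriction to `ξᗮ`. -/
lemma fourier_cutoff_add {m : ℕ} {Ψ : E × E → ℂ} (h : RayLike m Ψ) {ξ y : E} (hξ : ‖ξ‖ = 1)
    (hy : ⟪y, ξ⟫ = 0) (τ : ℝ) :
    𝓕 (cutoff Ψ ξ ξ) (y + τ • ξ) = (∫ t, modWindow τ t) * 𝓕 (cutoff Ψ ξ ξ) y := by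
  have h1 := inner_self_of_unit hξ
  have := integral_cutoff_change h h1 (by rw [h1]; exact one_ne_zero) hy (integrable_modWindow τ)
  rw [h1, abs_one, inv_one, Complex.ofReal_one, one_mul] at this
  rw [this, fourier_eq_mul]
  congr 1; ext x
  rw [inner_add_right, real_inner_smul_right, neg_add, AddChar.map_add_eq_mul, cutoff, modWindow,
    Circle.coe_mul, Complex.real_smul]
  ring

lemma rayMoment_zero_eq (f : 𝓢(E, ℂ)) (x ξ : E) :
    rayMoment 0 f (x, ξ) = ∫ t : ℝ, f (x - t • ξ) := by
  rw [rayMoment, ← integral_neg_eq_self (fun t : ℝ => f (x - t • ξ))]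
  simp

/-- `integral_window_swap` with `U` the character of frequency `y`, constant along `ξ`, and `a = f`.
The frequency `τ` along `ξ` only meets the window. -/
lemma window_mul_rayMoment (f : 𝓢(E, ℂ)) {ξ y : E} (hξ : ‖ξ‖ = 1) (hy : ⟪y, ξ⟫ = 0) (τ : ℝ) :
    Integrable (cutoff (rayMoment 0 f) ξ ξ) ∧
    𝓕 (cutoff (rayMoment 0 f) ξ ξ) (y + τ • ξ) = (∫ t, modWindow τ t) * 𝓕 f y := by
  have h1 := inner_self_of_unit hξ
  have h1' : ⟪ξ, ξ⟫ ≠ 0 := by rw [h1]; exact one_ne_zero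
  constructor
  · have := (integral_window_swap (U := fun _ => (1 : ℂ)) (a := f) (ξ := ξ) (ν := ξ)
      (fun x t => rfl) (by simpa using f.integrable) integrable_window.ofReal h1').1
    refine this.congr (Eventually.of_forall fun x => ?_)
    simp only [cutoff, Complex.real_smul, rayMoment_zero_eq, one_mul]
    rfl
  · have := (integral_window_swap (U := fun x => (𝐞 (-⟪x, y⟫) : ℂ)) (a := f) (ξ := ξ) (ν := ξ)
      (fun x t => char_add_smul hy x t) (integrable_char_mul f.integrable y)
      (integrable_modWindow τ) h1').2
    rw [h1, abs_one, inv_one, Complex.ofReal_one, one_mul] at this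
    rw [SchwartzMap.fourier_coe, fourier_eq_mul f, this, fourier_eq_mul]
    congr 1; ext x
    rw [inner_add_right, real_inner_smul_right, neg_add, AddChar.map_add_eq_mul, cutoff, modWindow,
      Circle.coe_mul, Complex.real_smul, rayMoment_zero_eq]
    ring

/-- The slice theorem. -/
lemma fourier_cutoff_of_eq {Ψ : E × E → ℂ} (f : 𝓢(E, ℂ)) {ξ y : E} (hξ : ‖ξ‖ = 1)
    (hf : ∀ x, Ψ (x, ξ) = rayMoment 0 f (x, ξ)) (hy : ⟪y, ξ⟫ = 0) :
    𝓕 (cutoff Ψ ξ ξ) y = 𝓕 f y := by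
  have := (window_mul_rayMoment f hξ hy 0).2
  have e : cutoff (rayMoment 0 f) ξ ξ = cutoff Ψ ξ ξ := by
    ext x; rw [cutoff, cutoff, hf]
  have hw : ∫ t, modWindow 0 t = 1 := by
    simp only [modWindow, zero_mul, neg_zero, AddChar.map_zero_eq_one, Circle.coe_one, one_mul]
    exact integral_ofReal_window
  rwa [zero_smul, add_zero, hw, one_mul, e] at this

/-- A ray-like function is the ray transform of `f` if their Fourier transforms agree. -/
lemma eq_rayMoment_of_fourier_eq {m : ℕ} {Ψ : E × E → ℂ} (h : RayLike m Ψ) (f : 𝓢(E, ℂ)) {ξ : E}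
    (hξ : ‖ξ‖ = 1) (hf : ∀ y, ⟪y, ξ⟫ = 0 → 𝓕 (cutoff Ψ ξ ξ) y = 𝓕 f y) (x : E) :
    Ψ (x, ξ) = rayMoment 0 f (x, ξ) := by
  have hξ0 : ξ ≠ 0 := by rintro rfl; simp at hξ
  have h1 := inner_self_of_unit hξ
  -- Off the hyperplane both transforms are their values on `ξᗮ` times the same factor `∫ modWindow
  -- τ`, so agreement on `ξᗮ` suffices.
  have hFT : 𝓕 (cutoff (rayMoment 0 f) ξ ξ) = 𝓕 (cutoff Ψ ξ ξ) := by
    ext z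
    have hz : z = (z - ⟪z, ξ⟫ • ξ) + ⟪z, ξ⟫ • ξ := by abel
    have hy : ⟪z - ⟪z, ξ⟫ • ξ, ξ⟫ = 0 := by
      rw [inner_sub_left, real_inner_smul_left, h1]; ring
    rw [hz, (window_mul_rayMoment f hξ hy _).2, fourier_cutoff_add h hξ hy, hf _ hy]
  set g := h.stripDecay.toSchwartz h1 with hg
  have hgi : Integrable (𝓕 (cutoff Ψ ξ ξ)) := (𝓕 g).integrable
  have hcont : Continuous (cutoff (rayMoment 0 f) ξ ξ) := by
    have hc : Continuous (fun x => rayMoment 0 f (x, ξ)) :=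
      continuous_iff_continuousAt.2 fun x =>
        ContinuousAt.comp (f := fun x : E => (x, ξ)) (g := rayMoment 0 f)
          (differentiableAt_rayMoment 0 f (p := (x, ξ)) hξ0).continuousAt (by fun_prop)
    exact (contDiff_window_inner ξ).continuous.smul hc
  have hi := (window_mul_rayMoment f hξ (y := 0) (by simp) 0).1
  have e1 := hcont.fourierInv_fourier_eq hi (by rw [hFT]; exact hgi)
  have e2 := (h.stripDecay.contDiff_cutoff hξ0 ξ).continuous.fourierInv_fourier_eq g.integrable hgi
  rw [hFT, e2] at e1
  -- On `ξᗮ` the window has the nonzero value `window 0` and can be cancelled. Other points are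
  -- reached by sliding along `ξ`.
  have key : ∀ x, ⟪x, ξ⟫ = 0 → Ψ (x, ξ) = rayMoment 0 f (x, ξ) := by
    intro x hx
    have := congrFun e1 x
    rw [cutoff, cutoff, hx] at this
    exact smul_right_injective ℂ window_zero_ne this
  have hx : ⟪x + (-⟪x, ξ⟫) • ξ, ξ⟫ = 0 := by
    rw [inner_add_left, real_inner_smul_left, h1]; ring
  have := key _ hx
  rw [h.add_smul hξ0] at this
  rw [this, rayMoment, rayMoment, ← integral_add_right_eq_self (μ := volume)
    (fun t : ℝ => (t : ℂ) ^ 0 * f ((x + -⟪x, ξ⟫ • ξ, ξ).1 + t • (x + -⟪x, ξ⟫ • ξ, ξ).2)) ⟪x, ξ⟫]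
  congr 1; ext t
  simp only [pow_zero, one_mul]
  congr 1
  rw [add_smul, neg_smul]; abel

end Slice

/-! ### Rank zero: John's theorem for functions -/

section Base

variable {E : Type} [NormedAddCommGroup E] [InnerProductSpace ℝ E] [FiniteDimensional ℝ E]
  [MeasurableSpace E] [BorelSpace E]

/-- The window stays normal to the fixed `ξ` while the direction moves. As `⟪ξ + s • η, ξ⟫ = 1`
throughout, the cutoff bounds are locally uniform in `s` and dominate the integral. -/
lemma hasDerivAt_fourier_cutoff {Γ : E × E → ℂ} (h : StripDecay Γ) {ξ η : E} (hξ : ‖ξ‖ = 1)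
    (hη : ⟪η, ξ⟫ = 0) (y : E) (s : ℝ) :
    HasDerivAt (fun s : ℝ => 𝓕 (cutoff Γ (ξ + s • η) ξ) y)
      (𝓕 (cutoff (dirDeriv (0, η) Γ) (ξ + s • η) ξ) y) s := by
  obtain ⟨p, hp⟩ := exists_integrable_inv_pow E
  obtain ⟨C, hC⟩ := (h.dirDeriv (0, η)).cutoff_bound (1 + (|s| + 1) * ‖η‖) p 0
  have hone : ∀ s : ℝ, ⟪ξ + s • η, ξ⟫ = 1 := fun s => by
    rw [inner_add_left, real_inner_smul_left, hη, inner_self_of_unit hξ]; ring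
  have hint : ∀ s : ℝ, Integrable (cutoff Γ (ξ + s • η) ξ) := fun s =>
    (h.toSchwartz (hone s)).integrable
  have hint' : Integrable (cutoff (dirDeriv (0, η) Γ) (ξ + s • η) ξ) :=
    ((h.dirDeriv (0, η)).toSchwartz (hone s)).integrable
  simp only [fourier_eq_mul]
  refine (hasDerivAt_integral_of_dominated_loc_of_deriv_le (bound := fun x => C * ((1 + ‖x‖) ^ p)⁻¹)
    (F := fun (s : ℝ) x => (𝐞 (-⟪x, y⟫) : ℂ) * cutoff Γ (ξ + s • η) ξ x)
    (F' := fun (s : ℝ) x => (𝐞 (-⟪x, y⟫) : ℂ) * cutoff (dirDeriv (0, η) Γ) (ξ + s • η) ξ x)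
    (Metric.ball_mem_nhds s one_pos)
    (Eventually.of_forall fun s => (integrable_char_mul (hint s) y).aestronglyMeasurable)
    (integrable_char_mul (hint s) y) (integrable_char_mul hint' y).aestronglyMeasurable
    (Eventually.of_forall fun x r hr => ?_) (hp.const_mul C)
    (Eventually.of_forall fun x r _ => ?_)).2
  · rw [norm_char_mul, ← div_eq_mul_inv, le_div_iff₀ (by positivity), mul_comm]
    have hr1 : |r| ≤ |s| + 1 := by
      rw [Metric.mem_ball, Real.dist_eq] at hr
      have := abs_sub_abs_le_abs_sub r s
      linarith
    have := hC (ξ + r • η) ξ ?_ ?_ (hone r) x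
    · rwa [norm_iteratedFDeriv_zero] at this
    · refine (norm_add_le _ _).trans ?_
      rw [hξ, norm_smul, Real.norm_eq_abs]
      gcongr
    · rw [hξ]
      have : 0 ≤ (|s| + 1) * ‖η‖ := by positivity
      linarith
  · have hd : HasFDerivAt Γ (fderiv ℝ Γ (x, ξ + r • η)) (x, ξ + r • η) :=
      (differentiableAt_of_nonzeroDir h.smooth (p := (x, ξ + r • η))
        (ne_zero_of_inner_eq_one (hone r))).hasFDerivAt
    have hc : HasDerivAt (fun r : ℝ => ((x, ξ + r • η) : E × E)) (0, η) r := by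
      have h1 : HasDerivAt (fun r : ℝ => ξ + r • η) η r := by
        simpa using ((hasDerivAt_id r).smul_const η).const_add ξ
      exact (hasDerivAt_const r x).prodMk h1
    have := ((hd.comp_hasDerivAt r hc).const_smul (window ⟪x, ξ⟫)).const_mul (𝐞 (-⟪x, y⟫) : ℂ)
    exact this

/-- Let `D` be the derivative in `s`. John's equation for the pair `y, η` gives `∂_{x,y} ∂_{ξ,η} Ψ =
∂_{x,η} ∂_{ξ,y} Ψ`. After the Fourier transform the left side is `2πi ‖y‖² D` and the right side
carries the factor `⟪y, η⟫ = 0`, so `D = 0`. -/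
lemma fourier_cutoff_line {m : ℕ} {Ψ : E × E → ℂ} (h : RayLike m Ψ)
    (hJ : ∀ a b, ∀ p ∈ nonzeroDir E, john a b Ψ p = 0) {ξ η y : E} (hξ : ‖ξ‖ = 1)
    (hη : ⟪η, ξ⟫ = 0) (hy : y ≠ 0) (hyξ : ⟪y, ξ⟫ = 0) (hyη : ⟪y, η⟫ = 0) (s : ℝ) :
    𝓕 (cutoff Ψ (ξ + s • η) ξ) y = 𝓕 (cutoff Ψ ξ ξ) y := by
  have hder := hasDerivAt_fourier_cutoff h.stripDecay hξ hη y
  have hzero : ∀ s : ℝ, 𝓕 (cutoff (dirDeriv (0, η) Ψ) (ξ + s • η) ξ) y = 0 := by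
    intro s
    have hone : ⟪ξ + s • η, ξ⟫ = 1 := by
      rw [inner_add_left, real_inner_smul_left, hη, inner_self_of_unit hξ]; ring
    have e1 := (h.stripDecay.dirDeriv (0, η)).fourier_cutoff_dirDeriv hone hyξ y
    have e2 := (h.stripDecay.dirDeriv (0, y)).fourier_cutoff_dirDeriv hone hη y
    rw [hyη] at e2
    have e3 : cutoff (dirDeriv (y, 0) (dirDeriv (0, η) Ψ)) (ξ + s • η) ξ
        = cutoff (dirDeriv (η, 0) (dirDeriv (0, y) Ψ)) (ξ + s • η) ξ := by
      ext x
      have := hJ y η (x, ξ + s • η) (ne_zero_of_inner_eq_one hone)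
      rw [john, sub_eq_zero] at this
      rw [cutoff, cutoff, this]
    rw [e3, e2, real_inner_self_eq_norm_sq] at e1
    have hn : (2 * π * Complex.I * ((‖y‖ ^ 2 : ℝ) : ℂ)) ≠ 0 := by
      have : ‖y‖ ≠ 0 := norm_ne_zero_iff.2 hy
      have h2 : ((‖y‖ ^ 2 : ℝ) : ℂ) ≠ 0 := by exact_mod_cast pow_ne_zero 2 this
      exact mul_ne_zero Complex.two_pi_I_ne_zero h2
    have e4 : 2 * π * Complex.I * ((‖y‖ ^ 2 : ℝ) : ℂ) *
        𝓕 (cutoff (dirDeriv (0, η) Ψ) (ξ + s • η) ξ) y = 0 := by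
      rw [← e1]; simp
    exact (mul_eq_zero.1 e4).resolve_left hn
  have := is_const_of_deriv_eq_zero (fun s => (hder s).differentiableAt)
    (fun s => by rw [(hder s).deriv, hzero]) s 0
  simpa using this

lemma window_neg (t : ℝ) : window (-t) = window t := ContDiffBump.normed_neg _ t

lemma fourier_cutoff_neg {Ψ : E × E → ℂ} (h : RayLike 0 Ψ) {ξ : E} (hξ : ‖ξ‖ = 1) (y : E) :
    𝓕 (cutoff Ψ (-ξ) (-ξ)) y = 𝓕 (cutoff Ψ ξ ξ) y := by
  have hξ0 : ξ ≠ 0 := by rintro rfl; simp at hξ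
  have e : cutoff Ψ (-ξ) (-ξ) = cutoff Ψ ξ ξ := by
    ext x
    have := h.equivariant 0 (r := -1) (by norm_num) (x, ξ) hξ0
    simp at this
    rw [cutoff, cutoff, inner_neg_right, window_neg, this]
  rw [e]

/-- With `c = ⟪ζ, ξ⟫`, the vector `c⁻¹ • ζ` lies on the affine line through `ξ` treated in
`fourier_cutoff_line`. Rescaling it to `ζ` and changing the window normal from `ξ` to `ζ` produce
factors that cancel. -/
lemma fourier_cutoff_eq_of_pos {Ψ : E × E → ℂ} (h : RayLike 0 Ψ)
    (hJ : ∀ a b, ∀ p ∈ nonzeroDir E, john a b Ψ p = 0) {ξ ζ y : E} (hξ : ‖ξ‖ = 1) (hζ : ‖ζ‖ = 1)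
    (hpos : 0 < ⟪ζ, ξ⟫) (hy : y ≠ 0) (hyξ : ⟪y, ξ⟫ = 0) (hyζ : ⟪y, ζ⟫ = 0) :
    𝓕 (cutoff Ψ ζ ζ) y = 𝓕 (cutoff Ψ ξ ξ) y := by
  have hζ0 : ζ ≠ 0 := by rintro rfl; simp at hζ
  set c := ⟪ζ, ξ⟫ with hc
  have h1 := fourier_cutoff_line h hJ (η := c⁻¹ • ζ - ξ) hξ (by
    rw [inner_sub_left, real_inner_smul_left, ← hc, inner_self_of_unit hξ, inv_mul_cancel₀ hpos.ne',
      sub_self]) hy hyξ (by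
    rw [inner_sub_right, real_inner_smul_right, hyζ, hyξ]; ring) 1
  rw [one_smul, add_sub_cancel] at h1
  rw [← h1]
  have h2 := integral_cutoff_change h (inner_self_of_unit hζ) (by rw [← hc]; exact hpos.ne') hyζ
    (integrable_window.ofReal (𝕜 := ℂ)) (ν' := ξ)
  have hw : ∫ t, (RCLike.ofReal (window t) : ℂ) = 1 := integral_ofReal_window
  rw [hw, ← hc, abs_of_pos hpos, mul_one] at h2
  have hcc : (c : ℂ) ≠ 0 := by exact_mod_cast hpos.ne'
  have h3 : 𝓕 (cutoff Ψ ζ ζ) y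
      = c * ∫ x, (𝐞 (-⟪x, y⟫) : ℂ) * ((RCLike.ofReal (window ⟪x, ξ⟫) : ℂ) * Ψ (x, ζ)) := by
    rw [← h2]; push_cast; field_simp
  rw [h3, fourier_eq_mul, ← integral_const_mul]
  congr 1
  ext x
  have h4 := h.equivariant 0 (r := c⁻¹) (by positivity) (x, ζ) hζ0
  simp only [shearScale_apply, zero_smul, add_zero, pow_zero, one_mul, abs_inv, inv_inv,
    abs_of_pos hpos] at h4
  rw [cutoff, h4, Complex.real_smul]
  change (c : ℂ) * ((𝐞 (-⟪x, y⟫) : ℂ) * ((window ⟪x, ξ⟫ : ℂ) * Ψ (x, ζ))) = _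
  ring

lemma fourier_cutoff_eq_of_ne {Ψ : E × E → ℂ} (h : RayLike 0 Ψ)
    (hJ : ∀ a b, ∀ p ∈ nonzeroDir E, john a b Ψ p = 0) {ξ ζ y : E} (hξ : ‖ξ‖ = 1) (hζ : ‖ζ‖ = 1)
    (hy : y ≠ 0) (hyξ : ⟪y, ξ⟫ = 0) (hyζ : ⟪y, ζ⟫ = 0) :
    𝓕 (cutoff Ψ ζ ζ) y = 𝓕 (cutoff Ψ ξ ξ) y := by
  rcases lt_trichotomy 0 ⟪ζ, ξ⟫ with h1 | h1 | h1
  · exact fourier_cutoff_eq_of_pos h hJ hξ hζ h1 hy hyξ hyζ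
  -- Orthogonal directions are joined through their normalized sum, which has positive inner product
  -- with both.
  · have hn : ‖ζ + ξ‖ ^ 2 = 2 := by
      rw [norm_add_sq_real, hξ, hζ, ← h1]; norm_num
    have hpos : 0 < ‖ζ + ξ‖ := by
      rcases (norm_nonneg (ζ + ξ)).eq_or_lt with h0 | h0
      · rw [← h0] at hn; norm_num at hn
      · exact h0
    set μ := ‖ζ + ξ‖⁻¹ • (ζ + ξ) with hμ
    have hμ1 : ‖μ‖ = 1 := by
      rw [hμ, norm_smul, norm_inv, norm_norm, inv_mul_cancel₀ hpos.ne']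
    have hyμ : ⟪y, μ⟫ = 0 := by
      rw [hμ, real_inner_smul_right, inner_add_right, hyξ, hyζ]; ring
    have e1 : 0 < ⟪ζ, μ⟫ := by
      rw [hμ, real_inner_smul_right, inner_add_right, inner_self_of_unit hζ, ← h1]; positivity
    have e2 : 0 < ⟪μ, ξ⟫ := by
      rw [hμ, real_inner_smul_left, inner_add_left, inner_self_of_unit hξ, ← h1]; positivity
    rw [fourier_cutoff_eq_of_pos h hJ hμ1 hζ e1 hy hyμ hyζ,
      fourier_cutoff_eq_of_pos h hJ hξ hμ1 e2 hy hyξ hyμ]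
  · rw [← fourier_cutoff_neg h hζ]
    exact fourier_cutoff_eq_of_pos h hJ hξ (by rwa [norm_neg])
      (by rw [inner_neg_left]; linarith) hy hyξ (by rw [inner_neg_right, hyζ, neg_zero])

lemma fourier_cutoff_eq (hE : 3 ≤ Module.finrank ℝ E) {Ψ : E × E → ℂ} (h : RayLike 0 Ψ)
    (hJ : ∀ a b, ∀ p ∈ nonzeroDir E, john a b Ψ p = 0) {ξ ζ y : E} (hξ : ‖ξ‖ = 1) (hζ : ‖ζ‖ = 1)
    (hyξ : ⟪y, ξ⟫ = 0) (hyζ : ⟪y, ζ⟫ = 0) :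
    𝓕 (cutoff Ψ ζ ζ) y = 𝓕 (cutoff Ψ ξ ξ) y := by
  by_cases hy : y = 0
  -- The frequency `0` is the limit of `s • v`, with `v` orthogonal to both directions.
  · obtain ⟨v, hv, hvξ, hvζ⟩ := exists_unit_orthogonal hE ξ ζ
    have hv0 : v ≠ 0 := by rintro rfl; simp at hv
    have hcont : ∀ ξ : E, ‖ξ‖ = 1 → Continuous fun s : ℝ => 𝓕 (cutoff Ψ ξ ξ) (s • v) := by
      intro ξ hξ
      have := (𝓕 (h.stripDecay.toSchwartz (inner_self_of_unit hξ))).continuous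
      rw [SchwartzMap.fourier_coe, StripDecay.coe_toSchwartz] at this
      exact this.comp (by fun_prop)
    have heq : Set.EqOn (fun s : ℝ => 𝓕 (cutoff Ψ ζ ζ) (s • v)) (fun s => 𝓕 (cutoff Ψ ξ ξ) (s • v))
        {0}ᶜ := fun s hs => fourier_cutoff_eq_of_ne h hJ hξ hζ (smul_ne_zero hs hv0)
          (by rw [real_inner_smul_left, real_inner_comm, hvξ, mul_zero])
          (by rw [real_inner_smul_left, real_inner_comm, hvζ, mul_zero])
    have := congrFun (Continuous.ext_on (dense_compl_singleton (0 : ℝ)) (hcont ζ hζ) (hcont ξ hξ) heq) 0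
    simpa [hy] using this
  · exact fourier_cutoff_eq_of_ne h hJ hξ hζ hy hyξ hyζ

/-- John's equations characterize the ray transforms of Schwartz functions. -/
theorem exists_rayMoment_of_john (hE : 3 ≤ Module.finrank ℝ E) {Ψ : E × E → ℂ} (h : RayLike 0 Ψ)
    (hJ : ∀ a b, ∀ p ∈ nonzeroDir E, john a b Ψ p = 0) :
    ∃ f : 𝓢(E, ℂ), ∀ x ξ : E, ‖ξ‖ = 1 → Ψ (x, ξ) = rayMoment 0 f (x, ξ) := by
  -- `F y` is read off from an arbitrary normal `dir y` of `y`. By `fourier_cutoff_eq` the choice is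
  -- immaterial.
  choose dir hdir hdir' _ using fun y : E => exists_unit_orthogonal hE y y
  obtain ⟨S, hS⟩ := exists_schwartz_of_hyperplanes hE
    (F := fun y => 𝓕 (cutoff Ψ (dir y) (dir y)) y) h.stripDecay.uniformlySchwartz
    (fun ξ y hξ hy => by
      rw [h.stripDecay.family_eq hξ, SchwartzMap.fourier_coe, StripDecay.coe_toSchwartz]
      exact fourier_cutoff_eq hE h hJ hξ (hdir y) hy (hdir' y))
  refine ⟨𝓕⁻ S, fun x ξ hξ => eq_rayMoment_of_fourier_eq h _ hξ (fun y hy => ?_) x⟩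
  rw [FourierTransform.fourier_fourierInv_eq, hS]
  exact fourier_cutoff_eq hE h hJ (hdir y) hξ (hdir' y) hy

end Base

/-! ### Radial means of Schwartz functions -/

section RadialMean

variable {E V : Type} [NormedAddCommGroup E] [NormedSpace ℝ E]
  [NormedAddCommGroup V] [NormedSpace ℝ V]

/-- The weighted mean `∫₀¹ sᵏ b(sy) ds` along the segment from `0` to `y`. -/
def radialMean (k : ℕ) (b : E → V) (y : E) : V := ∫ s in (0 : ℝ)..1, s ^ k • b (s • y)

lemma intervalIntegrable_radial (k : ℕ) {b : E → V} (hb : Continuous b) (y : E) :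
    IntervalIntegrable (fun s : ℝ => s ^ k • b (s • y)) volume 0 1 :=
  (by fun_prop : Continuous fun s : ℝ => s ^ k • b (s • y)).intervalIntegrable _ _

lemma hasFDerivAt_radialMean (k : ℕ) (b : 𝓢(E, V)) (y : E) :
    HasFDerivAt (radialMean k b) (radialMean (k + 1) (fderiv ℝ b) y) y := by
  have hd : Continuous (fderiv ℝ b) := (SchwartzMap.fderivCLM ℝ E V b).continuous
  obtain ⟨C, hC⟩ := exists_schwartz_bound (SchwartzMap.fderivCLM ℝ E V b) 0
  refine intervalIntegral.hasFDerivAt_integral_of_dominated_of_fderiv_le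
    (F' := fun y s => s ^ (k + 1) • fderiv ℝ b (s • y)) (bound := fun _ => C)
    (s := Set.univ) univ_mem ?_ (intervalIntegrable_radial k b.continuous y) ?_ ?_
    intervalIntegrable_const ?_
  · exact Eventually.of_forall fun z =>
      (intervalIntegrable_radial k b.continuous z).aestronglyMeasurable_restrict_uIoc
  · exact (intervalIntegrable_radial (k + 1) hd y).aestronglyMeasurable_restrict_uIoc
  · refine Eventually.of_forall fun s hs z _ => ?_
    rw [Set.uIoc_of_le zero_le_one] at hs
    have h1 := hC (s • z)
    rw [pow_zero, one_mul] at h1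
    rw [norm_smul, norm_pow, Real.norm_of_nonneg hs.1.le]
    calc s ^ (k + 1) * ‖fderiv ℝ b (s • z)‖ ≤ 1 * ‖fderiv ℝ b (s • z)‖ := by
          gcongr; exact pow_le_one₀ hs.1.le hs.2
      _ ≤ C := by rw [one_mul]; exact h1
  · refine Eventually.of_forall fun s _ z _ => ?_
    have h1 : HasFDerivAt (fun z : E => s • z) (s • ContinuousLinearMap.id ℝ E) z :=
      (hasFDerivAt_id z).const_smul s
    have h2 := ((b.hasFDerivAt (s • z)).comp z h1).const_smul (s ^ k)
    rw [ContinuousLinearMap.comp_smul, ContinuousLinearMap.comp_id, smul_smul, ← pow_succ] at h2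
    exact h2

/-- The derivative of a radial mean is the radial mean, with exponent one higher, of the derivative.
The induction therefore runs over all target spaces at once. -/
lemma contDiff_radialMean (N : ℕ) :
    ∀ {V : Type} [NormedAddCommGroup V] [NormedSpace ℝ V] (k : ℕ) (b : 𝓢(E, V)),
      ContDiff ℝ N (radialMean k b) := by
  induction N with
  | zero =>
    intro V _ _ k b
    exact contDiff_zero.2 (continuous_iff_continuousAt.2 fun y =>
      (hasFDerivAt_radialMean k b y).continuousAt)
  | succ N ih =>
    intro V _ _ k b
    push_cast
    rw [contDiff_succ_iff_fderiv]
    refine ⟨fun y => (hasFDerivAt_radialMean k b y).differentiableAt, by simp, ?_⟩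
    have : fderiv ℝ (radialMean k b) = radialMean (k + 1) (SchwartzMap.fderivCLM ℝ E V b) :=
      funext fun y => (hasFDerivAt_radialMean k b y).fderiv
    rw [this]
    exact ih (k + 1) _

lemma exists_bound_radialMean (N : ℕ) :
    ∀ {V : Type} [NormedAddCommGroup V] [NormedSpace ℝ V] (k : ℕ) (b : 𝓢(E, V)),
      ∃ C : ℝ, ∀ y, ‖iteratedFDeriv ℝ N (radialMean k b) y‖ ≤ C := by
  induction N with
  | zero =>
    intro V _ _ k b
    obtain ⟨C, hC⟩ := exists_schwartz_bound b 0
    refine ⟨C, fun y => ?_⟩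
    rw [norm_iteratedFDeriv_zero]
    have := intervalIntegral.norm_integral_le_of_norm_le_const (a := 0) (b := 1) (C := C)
      (f := fun s : ℝ => s ^ k • b (s • y)) (fun s hs => by
        rw [Set.uIoc_of_le zero_le_one] at hs
        have h1 := hC (s • y)
        rw [pow_zero, one_mul] at h1
        rw [norm_smul, norm_pow, Real.norm_of_nonneg hs.1.le]
        calc s ^ k * ‖b (s • y)‖ ≤ 1 * ‖b (s • y)‖ := by
              gcongr; exact pow_le_one₀ hs.1.le hs.2
          _ ≤ C := by rw [one_mul]; exact h1)
    simpa [radialMean] using this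
  | succ N ih =>
    intro V _ _ k b
    obtain ⟨C, hC⟩ := ih (k + 1) (SchwartzMap.fderivCLM ℝ E V b)
    refine ⟨C, fun y => ?_⟩
    have : fderiv ℝ (radialMean k b) = radialMean (k + 1) (SchwartzMap.fderivCLM ℝ E V b) :=
      funext fun y => (hasFDerivAt_radialMean k b y).fderiv
    rw [← norm_iteratedFDeriv_fderiv, this]
    exact hC y

lemma hasTemperateGrowth_radialMean (k : ℕ) (b : 𝓢(E, V)) :
    (radialMean k b).HasTemperateGrowth := by
  refine ⟨contDiff_infty.2 fun N => contDiff_radialMean N k b, fun N => ?_⟩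
  obtain ⟨C, hC⟩ := exists_bound_radialMean N k b
  exact ⟨0, C, fun y => by simpa using hC y⟩

lemma radialMean_add (k : ℕ) {b c : E → V} (hb : Continuous b) (hc : Continuous c) (y : E) :
    radialMean k (b + c) y = radialMean k b y + radialMean k c y := by
  rw [radialMean, radialMean, radialMean, ← intervalIntegral.integral_add
    (intervalIntegrable_radial k hb y) (intervalIntegrable_radial k hc y)]
  simp

lemma radialMean_smul (k : ℕ) (z : ℂ) (b : E → ℂ) (y : E) :
    radialMean k (z • b) y = z * radialMean k b y := by
  rw [radialMean, radialMean, ← intervalIntegral.integral_const_mul]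
  congr 1
  ext s
  simp
  ring

end RadialMean

/-! ### Dividing by `y` on a hyperplane, uniformly in the hyperplane -/

section RadialQuotient

variable {n : ℕ}

/-- A Schwartz function with value `1` at the origin. -/
lemma exists_schwartz_apply_zero (n : ℕ) : ∃ γ : 𝓢(Euc n, ℂ), γ 0 = 1 := by
  let B : ContDiffBump (0 : Euc n) := ⟨1, 2, one_pos, one_lt_two⟩
  have h1 : HasCompactSupport fun x => (B x : ℂ) :=
    B.hasCompactSupport.comp_left (g := fun t : ℝ => (t : ℂ)) Complex.ofReal_zero
  refine ⟨h1.toSchwartzMap (Complex.ofRealCLM.contDiff.comp B.contDiff), ?_⟩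
  change ((B 0 : ℝ) : ℂ) = 1
  rw [B.one_of_mem_closedBall (Metric.mem_closedBall_self B.rIn_pos.le), Complex.ofReal_one]

/-- A fixed Schwartz function with value `1` at the origin. -/
def germ (n : ℕ) : 𝓢(Euc n, ℂ) := (exists_schwartz_apply_zero n).choose

lemma germ_zero (n : ℕ) : germ n 0 = 1 := (exists_schwartz_apply_zero n).choose_spec

/-- The standard basis vector. -/
abbrev basisVec (i : Fin n) : Euc n := EuclideanSpace.single i 1

/-- The divergence of a vector field. -/
def divergence (a : Fin n → 𝓢(Euc n, ℂ)) : 𝓢(Euc n, ℂ) := ∑ i, ∂_{basisVec i} (a i)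

/-- A linear operator recovering `G` from a field which equals `G(y) y` on a hyperplane and is
tangent to it. -/
def radialQuotient (a : Fin n → 𝓢(Euc n, ℂ)) : 𝓢(Euc n, ℂ) :=
  SchwartzMap.smulLeftCLM ℂ (radialMean (n - 2) (divergence a)) (germ n)
    - ∑ i, SchwartzMap.smulLeftCLM ℂ (radialMean 0 (∂_{basisVec i} (germ n) : 𝓢(Euc n, ℂ))) (a i)

lemma radialQuotient_apply (a : Fin n → 𝓢(Euc n, ℂ)) (y : Euc n) :
    radialQuotient a y = radialMean (n - 2) (divergence a) y * germ n y
      - ∑ i, radialMean 0 (∂_{basisVec i} (germ n) : 𝓢(Euc n, ℂ)) y * a i y := by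
  rw [radialQuotient, sub_apply, sum_apply,
    SchwartzMap.smulLeftCLM_apply_apply (hasTemperateGrowth_radialMean _ _), smul_eq_mul]
  congr 2
  ext i
  rw [SchwartzMap.smulLeftCLM_apply_apply (hasTemperateGrowth_radialMean _ _), smul_eq_mul]

lemma radialQuotient_add (a b : Fin n → 𝓢(Euc n, ℂ)) :
    radialQuotient (a + b) = radialQuotient a + radialQuotient b := by
  have hd : divergence (a + b) = divergence a + divergence b := by
    simp [divergence, LineDeriv.lineDerivOp_add, Finset.sum_add_distrib]
  ext y
  rw [add_apply]
  simp only [radialQuotient_apply, hd, Pi.add_apply, add_apply, mul_add,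
    Finset.sum_add_distrib]
  rw [show ⇑(divergence a + divergence b) = ⇑(divergence a) + ⇑(divergence b) from rfl,
    radialMean_add _ (SchwartzMap.continuous _) (SchwartzMap.continuous _)]
  ring

lemma radialQuotient_smul (z : ℂ) (a : Fin n → 𝓢(Euc n, ℂ)) :
    radialQuotient (z • a) = z • radialQuotient a := by
  have hd : divergence (z • a) = z • divergence a := by
    simp [divergence, LineDeriv.lineDerivOp_smul, Finset.smul_sum]
  ext y
  rw [smul_apply]
  simp only [radialQuotient_apply, hd, Pi.smul_apply, smul_apply, smul_eq_mul]
  rw [show ⇑(z • divergence a) = z • ⇑(divergence a) from rfl, radialMean_smul, mul_sub, Finset.mul_sum]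
  congr 1
  · ring
  · exact Finset.sum_congr rfl fun i _ => by ring

lemma radialQuotient_sum {ι : Type*} (s : Finset ι) (z : ι → ℂ)
    (a : ι → Fin n → 𝓢(Euc n, ℂ)) :
    radialQuotient (∑ J ∈ s, z J • a J) = ∑ J ∈ s, z J • radialQuotient (a J) := by
  classical
  induction s using Finset.induction_on with
  | empty => simpa using radialQuotient_smul 0 (0 : Fin n → 𝓢(Euc n, ℂ))
  | insert J s hJ ih =>
    rw [Finset.sum_insert hJ, Finset.sum_insert hJ, radialQuotient_add, radialQuotient_smul, ih]

lemma sum_smul_basisVec (y : Euc n) : ∑ i, y i • basisVec i = y := by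
  ext j
  simp [Pi.single_apply]

lemma inner_basisVec (i : Fin n) (y : Euc n) : ⟪basisVec i, y⟫ = y i := by
  simp [EuclideanSpace.inner_single_left]

/-- Hadamard's formula: the derivative of `s ↦ γ (s • y)` integrated over `[0, 1]`. -/
lemma radialMean_lineDeriv_sum (γ : 𝓢(Euc n, ℂ)) (y : Euc n) :
    ∑ i, radialMean 0 (∂_{basisVec i} γ : 𝓢(Euc n, ℂ)) y * (y i : ℂ) = γ y - γ 0 := by
  have hder : ∀ s : ℝ, HasDerivAt (fun s : ℝ => γ (s • y)) (fderiv ℝ γ (s • y) y) s := fun s => by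
    have h1 : HasDerivAt (fun s : ℝ => s • y) y s := by
      simpa using (hasDerivAt_id s).smul_const y
    exact (γ.hasFDerivAt (s • y)).comp_hasDerivAt s h1
  have hcont : Continuous fun s : ℝ => fderiv ℝ γ (s • y) y := by
    have : Continuous (fderiv ℝ γ) := (SchwartzMap.fderivCLM ℝ _ _ γ).continuous
    fun_prop
  have h1 := intervalIntegral.integral_eq_sub_of_hasDerivAt (a := 0) (b := 1)
    (fun s _ => hder s) (hcont.intervalIntegrable _ _)
  rw [one_smul, zero_smul] at h1
  rw [← h1]
  simp only [radialMean, ← intervalIntegral.integral_mul_const]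
  rw [← intervalIntegral.integral_finsetSum]
  · congr 1
    ext s
    conv_rhs => rw [← sum_smul_basisVec y, map_sum]
    refine Finset.sum_congr rfl fun i _ => ?_
    rw [SchwartzMap.lineDerivOp_apply_eq_fderiv, map_smul, pow_zero, one_smul, sum_smul_basisVec,
      Complex.real_smul, mul_comm]
  · intro i _
    exact (intervalIntegrable_radial 0 (SchwartzMap.continuous _) y).mul_const _

/-- The tangential derivatives of `a` are those of `y G(y)`, and the trace of the projection onto
`ξᗮ` is `n - 1`. The normal contribution `⟪ξ, ∂_ξ a⟫` vanishes because `⟪ξ, a⟫ = 0` holds on the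
whole space, not only on `ξᗮ`. -/
lemma divergence_eq_of_radial {a : Fin n → 𝓢(Euc n, ℂ)} {G : 𝓢(Euc n, ℂ)} {ξ : Euc n}
    (hξ : ‖ξ‖ = 1) (h0 : ∀ y, ∑ i, (ξ i : ℂ) * a i y = 0)
    (h1 : ∀ y, ⟪y, ξ⟫ = 0 → ∀ i, a i y = (y i : ℂ) * G y) {y : Euc n} (hy : ⟪y, ξ⟫ = 0) :
    divergence a y = ((n : ℂ) - 1) * G y + fderiv ℝ G y y := by
  have hsq : ∑ i, ξ i ^ 2 = 1 := by
    rw [← EuclideanSpace.real_norm_sq_eq, hξ, one_pow]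
  have hrad : ∑ i, (ξ i : ℂ) * fderiv ℝ (a i) y ξ = 0 := by
    have h2 : HasFDerivAt (fun y => ∑ i, (ξ i : ℂ) * a i y)
        (∑ i, (ξ i : ℂ) • fderiv ℝ (a i) y) y :=
      HasFDerivAt.fun_sum fun i _ => ((a i).hasFDerivAt y).const_mul _
    have h3 : (fun y => ∑ i, (ξ i : ℂ) * a i y) = fun _ => 0 := funext h0
    rw [h3] at h2
    have := congrArg (fun L => L ξ) (h2.unique (hasFDerivAt_const _ _))
    simpa using this
  have htan : ∀ i, fderiv ℝ (a i) y (basisVec i - ξ i • ξ)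
      = ((1 - ξ i ^ 2 : ℝ) : ℂ) * G y + (y i : ℂ) * fderiv ℝ G y (basisVec i - ξ i • ξ) := by
    intro i
    set v := basisVec i - ξ i • ξ with hv
    have hvξ : ⟪v, ξ⟫ = 0 := by
      rw [hv, inner_sub_left, inner_basisVec, real_inner_smul_left, inner_self_of_unit hξ]; ring
    have hvi : v i = 1 - ξ i ^ 2 := by simp [hv]; ring
    have hline : HasDerivAt (fun t : ℝ => y + t • v) v 0 := by
      simpa using ((hasDerivAt_id (0 : ℝ)).smul_const v).const_add y
    have e0 : y + (0 : ℝ) • v = y := by simp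
    have hf : ∀ f : 𝓢(Euc n, ℂ), HasDerivAt (fun t : ℝ => f (y + t • v)) (fderiv ℝ f y v) 0 := by
      intro f
      have := (f.hasFDerivAt (y + (0 : ℝ) • v)).comp_hasDerivAt (0 : ℝ) hline
      rwa [e0] at this
    have hcoord : HasDerivAt (fun t : ℝ => ((y + t • v) i : ℂ)) ((v i : ℝ) : ℂ) 0 := by
      refine HasDerivAt.ofReal_comp (f := fun t : ℝ => (y + t • v) i) ?_
      simpa using ((hasDerivAt_id (0 : ℝ)).mul_const (v i)).const_add (y i)
    have h2 := hcoord.mul (hf G)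
    have h3 : (fun t : ℝ => a i (y + t • v))
        = (fun t : ℝ => ((y + t • v) i : ℂ)) * fun t : ℝ => G (y + t • v) := by
      ext t
      exact h1 _ (by rw [inner_add_left, real_inner_smul_left, hy, hvξ]; ring) i
    rw [← h3] at h2
    have := (hf (a i)).unique h2
    rw [this, e0, hvi]
  have hsplit : ∀ i, (∂_{basisVec i} (a i) : 𝓢(Euc n, ℂ)) y
      = fderiv ℝ (a i) y (basisVec i - ξ i • ξ) + (ξ i : ℂ) * fderiv ℝ (a i) y ξ := by
    intro i
    rw [SchwartzMap.lineDerivOp_apply_eq_fderiv, map_sub, map_smul, Complex.real_smul,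
      sub_add_cancel]
  rw [divergence, sum_apply]
  simp only [hsplit, htan, Finset.sum_add_distrib, hrad, add_zero]
  congr 1
  · rw [← Finset.sum_mul, ← Complex.ofReal_sum, Finset.sum_sub_distrib, hsq]
    simp
  · have : ∀ i, (y i : ℂ) * fderiv ℝ G y (basisVec i - ξ i • ξ)
        = fderiv ℝ G y (y i • basisVec i - (y i * ξ i) • ξ) := by
      intro i
      rw [← Complex.real_smul, ← map_smul, smul_sub, smul_smul]
    simp only [this]
    rw [← map_sum, Finset.sum_sub_distrib, sum_smul_basisVec, ← Finset.sum_smul]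
    have : ∑ i, y i * ξ i = 0 := by
      rw [← hy, PiLp.inner_apply]
      exact Finset.sum_congr rfl fun i _ => by simp [mul_comm]
    rw [this, zero_smul, sub_zero]

/-- The integrand `s ^ (n - 2) b(sy)` is the derivative of `s ^ (n - 1) G(sy)`. -/
lemma radialMean_of_euler {n : ℕ} (hn : 2 ≤ n) {b G : 𝓢(Euc n, ℂ)} {y : Euc n}
    (h : ∀ s : ℝ, b (s • y) = ((n : ℂ) - 1) * G (s • y) + fderiv ℝ G (s • y) (s • y)) :
    radialMean (n - 2) b y = G y := by
  obtain ⟨k, rfl⟩ := Nat.exists_eq_add_of_le' hn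
  simp only [Nat.add_sub_cancel]
  have hder : ∀ s : ℝ, HasDerivAt (fun s : ℝ => ((s ^ (k + 1) : ℝ) : ℂ) * G (s • y))
      (s ^ k • b (s • y)) s := fun s => by
    have h1 : HasDerivAt (fun s : ℝ => s • y) y s := by
      simpa using (hasDerivAt_id s).smul_const y
    have h2 := (G.hasFDerivAt (s • y)).comp_hasDerivAt s h1
    have h3 := (hasDerivAt_pow (k + 1) s).ofReal_comp.mul h2
    refine h3.congr_deriv ?_
    rw [h s, (fderiv ℝ G (s • y)).map_smul, Complex.real_smul, Complex.real_smul]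
    push_cast [Nat.add_sub_cancel, Function.comp_apply]
    ring
  have h1 := intervalIntegral.integral_eq_sub_of_hasDerivAt (a := 0) (b := 1)
    (fun s _ => hder s) (intervalIntegrable_radial k b.continuous y)
  rw [radialMean, h1]
  simp

/-- Write `γ` for the germ and `G = γ G + (1 - γ) G`. The radial mean of the divergence gives `G`,
but as a function on the whole space it is only known to have bounded derivatives, so it is used
under the factor `γ`. For the rest, Hadamard's formula `γ - 1 = ∑ γ_i y_i` gives `(1 - γ) G = -∑ γ_i
a_i`, where the `a_i` supply the decay. -/
lemma radialQuotient_eq_of_radial (hn : 2 ≤ n) {a : Fin n → 𝓢(Euc n, ℂ)} {G : 𝓢(Euc n, ℂ)}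
    {ξ : Euc n} (hξ : ‖ξ‖ = 1) (h0 : ∀ y, ∑ i, (ξ i : ℂ) * a i y = 0)
    (h1 : ∀ y, ⟪y, ξ⟫ = 0 → ∀ i, a i y = (y i : ℂ) * G y) {y : Euc n} (hy : ⟪y, ξ⟫ = 0) :
    radialQuotient a y = G y := by
  have h2 : radialMean (n - 2) (divergence a) y = G y :=
    radialMean_of_euler hn fun s => divergence_eq_of_radial hξ h0 h1
      (by rw [real_inner_smul_left, hy, mul_zero])
  have h3 := radialMean_lineDeriv_sum (germ n) y
  rw [germ_zero] at h3
  have h4 : ∑ i, radialMean 0 (∂_{basisVec i} (germ n) : 𝓢(Euc n, ℂ)) y * a i y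
      = (∑ i, radialMean 0 (∂_{basisVec i} (germ n) : 𝓢(Euc n, ℂ)) y * (y i : ℂ)) * G y := by
    rw [Finset.sum_mul]
    exact Finset.sum_congr rfl fun i _ => by rw [h1 y hy i, mul_assoc]
  rw [radialQuotient_apply, h2, h4, h3]
  ring

end RadialQuotient

/-! ### Euler identities from shear invariance and homogeneity -/

section Euler

variable {E : Type} [NormedAddCommGroup E] [InnerProductSpace ℝ E]

/-- Invariance under translation of the point along the direction. -/
def ShearInvariant (Ψ : E × E → ℂ) : Prop :=
  ∀ p ∈ nonzeroDir E, ∀ t : ℝ, Ψ (p.1 + t • p.2, p.2) = Ψ p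

lemma RayLike.shearInvariant {m : ℕ} {Ψ : E × E → ℂ} (h : RayLike m Ψ) : ShearInvariant Ψ :=
  fun p hp t => by simpa using h.equivariant t one_ne_zero p hp

lemma ShearInvariant.fderiv_eq_zero {Ψ : E × E → ℂ} (h : ShearInvariant Ψ)
    (hs : ContDiffOn ℝ ∞ Ψ (nonzeroDir E)) {p : E × E} (hp : p ∈ nonzeroDir E) :
    fderiv ℝ Ψ p (p.2, 0) = 0 := by
  have hd := (differentiableAt_of_nonzeroDir hs hp).hasFDerivAt
  have hline : HasDerivAt (fun t : ℝ => p + t • ((p.2, 0) : E × E)) (p.2, 0) 0 := by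
    simpa using ((hasDerivAt_id (0 : ℝ)).smul_const ((p.2, 0) : E × E)).const_add p
  have h1 : HasDerivAt (fun t : ℝ => Ψ (p + t • ((p.2, 0) : E × E)))
      (fderiv ℝ Ψ p (p.2, 0)) 0 := by
    have e : p + (0 : ℝ) • ((p.2, 0) : E × E) = p := by simp
    exact HasFDerivAt.comp_hasDerivAt (0 : ℝ) (by rwa [e]) hline
  have h2 : (fun t : ℝ => Ψ (p + t • ((p.2, 0) : E × E))) = fun _ => Ψ p := by
    ext t
    simpa [Prod.add_def] using h p hp t
  rw [h2] at h1
  exact h1.unique (hasDerivAt_const _ _)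

lemma hasFDerivAt_fderiv {Ψ : E × E → ℂ} (hs : ContDiffOn ℝ ∞ Ψ (nonzeroDir E)) {p : E × E}
    (hp : p ∈ nonzeroDir E) : HasFDerivAt (fderiv ℝ Ψ) (fderiv ℝ (fderiv ℝ Ψ) p) p :=
  (((ContDiffOn.at_nonzeroDir hs hp).fderiv_right (m := 1)
    (by norm_num; exact ENat.LEInfty.out)).differentiableAt (by simp)).hasFDerivAt

/-- Differentiate `⟨ξ, ∂_x⟩ Ψ = 0` in the direction `a` of `ξ`. -/
lemma ShearInvariant.fderiv_fderiv {Ψ : E × E → ℂ} (h : ShearInvariant Ψ)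
    (hs : ContDiffOn ℝ ∞ Ψ (nonzeroDir E)) {p : E × E} (hp : p ∈ nonzeroDir E) (a : E) :
    dirDeriv (p.2, 0) (dirDeriv (0, a) Ψ) p = -dirDeriv (a, 0) Ψ p := by
  have h1 := (hasFDerivAt_fderiv hs hp).clm_apply
    ((hasFDerivAt_snd (𝕜 := ℝ) (E := E) (F := E) (p := p)).prodMk (hasFDerivAt_const (0 : E) p))
  have h1' := h1.congr_of_eventuallyEq (f₁ := fun _ => (0 : ℂ)) (by
    filter_upwards [isOpen_nonzeroDir.mem_nhds hp] with q hq using (h.fderiv_eq_zero hs hq).symm)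
  have e1 := congrArg (fun L => L (0, a)) (h1'.unique (hasFDerivAt_const _ _))
  simp at e1
  rw [dirDeriv_comm hs hp, fderiv_dirDeriv hs hp, dirDeriv]
  linear_combination e1

lemma RayLike.fderiv_scale {m : ℕ} {Ψ : E × E → ℂ} (h : RayLike (m + 1) Ψ) {p : E × E}
    (hp : p ∈ nonzeroDir E) : fderiv ℝ Ψ p (0, p.2) = m * Ψ p := by
  have hd := (differentiableAt_of_nonzeroDir h.smooth hp).hasFDerivAt
  have hline : HasDerivAt (fun t : ℝ => ((p.1, t • p.2) : E × E)) (0, p.2) 1 := by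
    have := (hasDerivAt_const (1 : ℝ) p.1).prodMk ((hasDerivAt_id (1 : ℝ)).smul_const p.2)
    simpa using this
  have h1 : HasDerivAt (fun t : ℝ => Ψ (p.1, t • p.2)) (fderiv ℝ Ψ p (0, p.2)) 1 := by
    refine HasFDerivAt.comp_hasDerivAt (1 : ℝ) (f := fun t : ℝ => ((p.1, t • p.2) : E × E)) ?_ hline
    rwa [one_smul]
  have h2 : (fun t : ℝ => Ψ (p.1, t • p.2)) =ᶠ[𝓝 1] fun t => ((t ^ m : ℝ) : ℂ) * Ψ p := by
    filter_upwards [lt_mem_nhds (zero_lt_one' ℝ)] with t ht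
    have := h.equivariant 0 ht.ne' p hp
    simp only [shearScale_apply, zero_smul, add_zero, abs_of_pos ht] at this
    rw [this, pow_succ, mul_assoc, mul_inv_cancel₀ ht.ne', mul_one]
  have h3 := ((hasDerivAt_pow m (1 : ℝ)).ofReal_comp.mul_const (Ψ p)).congr_of_eventuallyEq h2
  rw [h1.unique h3]
  simp

/-- Euler's identity for the John operator in the direction of the line. -/
lemma RayLike.john_dir {m : ℕ} {Ψ : E × E → ℂ} (h : RayLike (m + 1) Ψ) (a : E) {p : E × E}
    (hp : p ∈ nonzeroDir E) :
    RayTransform.john a p.2 Ψ p = ((m : ℂ) + 1) * RayTransform.dirDeriv (a, 0) Ψ p := by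
  have hd := (differentiableAt_of_nonzeroDir h.smooth hp).hasFDerivAt
  -- Differentiating `⟨ξ, ∂_ξ⟩ Ψ = m Ψ` in `x` accounts for the summand `m`; the summand `1` comes
  -- from the commutator in `fderiv_fderiv`.
  have h2 := (hasFDerivAt_fderiv h.smooth hp).clm_apply ((hasFDerivAt_const (0 : E) p).prodMk
    (hasFDerivAt_snd (𝕜 := ℝ) (E := E) (F := E) (p := p)))
  have h2' := h2.congr_of_eventuallyEq (f₁ := fun q => (m : ℂ) * Ψ q) (by
    filter_upwards [isOpen_nonzeroDir.mem_nhds hp] with q hq using (h.fderiv_scale hq).symm)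
  have e2 := congrArg (fun L => L (a, 0)) (h2'.unique (hd.const_mul (m : ℂ)))
  simp at e2
  rw [RayTransform.john, h.shearInvariant.fderiv_fderiv h.smooth hp, fderiv_dirDeriv h.smooth hp,
    RayTransform.dirDeriv]
  have e0 : fderiv ℝ Ψ p ((0 : E), (0 : E)) = 0 := map_zero _
  linear_combination e2 - e0

/-- Removing the `ξ` component of `a` changes neither side: `Ψ` is constant along `ξ`, and `y ⊥ ξ`.
-/
lemma RayLike.fourier_cutoff_dirDeriv [FiniteDimensional ℝ E] [MeasurableSpace E] [BorelSpace E]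
    {m : ℕ} {Ψ : E × E → ℂ} (h : RayLike m Ψ) {ξ y : E} (hξ : ‖ξ‖ = 1) (hy : ⟪y, ξ⟫ = 0) (a : E) :
    𝓕 (cutoff (dirDeriv (a, 0) Ψ) ξ ξ) y = 2 * π * Complex.I * ⟪y, a⟫ * 𝓕 (cutoff Ψ ξ ξ) y := by
  have h1 := inner_self_of_unit hξ
  have hξ0 := ne_zero_of_inner_eq_one h1
  set v := a - ⟪a, ξ⟫ • ξ with hv
  have hvξ : ⟪v, ξ⟫ = 0 := by rw [hv, inner_sub_left, real_inner_smul_left, h1]; ring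
  have hyv : ⟪y, v⟫ = ⟪y, a⟫ := by rw [hv, inner_sub_right, real_inner_smul_right, hy]; ring
  have e : cutoff (dirDeriv (a, 0) Ψ) ξ ξ = cutoff (dirDeriv (v, 0) Ψ) ξ ξ := by
    ext x
    rw [cutoff, cutoff]
    congr 1
    have : ((a, 0) : E × E) = (v, 0) + ⟪a, ξ⟫ • (ξ, 0) := by simp [hv]
    rw [this, dirDeriv_add_vec, dirDeriv_smul_vec]
    have h2 := h.shearInvariant.fderiv_eq_zero h.smooth (p := (x, ξ)) hξ0
    rw [dirDeriv, dirDeriv, h2, mul_zero, add_zero]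
  rw [e, h.stripDecay.fourier_cutoff_dirDeriv h1 hvξ, hyv]

end Euler

/-! ### Iterated John equations and the induction on the rank -/

section Coordinates

variable {n : ℕ}

lemma john_eq_sum_right {Ψ : Euc n × Euc n → ℂ} (h : ContDiffOn ℝ ∞ Ψ (nonzeroDir (Euc n)))
    {p : Euc n × Euc n} (hp : p ∈ nonzeroDir (Euc n)) (a b : Euc n) :
    john a b Ψ p = ∑ j, (b j : ℂ) * john a (basisVec j) Ψ p := by
  have e1 : ((b, 0) : Euc n × Euc n) = ∑ j, b j • (basisVec j, 0) := by
    conv_lhs => rw [← sum_smul_basisVec b]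
    rw [Prod.ext_iff]; simp [Prod.fst_sum, Prod.snd_sum]
  have e2 : ((0, b) : Euc n × Euc n) = ∑ j, b j • (0, basisVec j) := by
    conv_lhs => rw [← sum_smul_basisVec b]
    rw [Prod.ext_iff]; simp [Prod.fst_sum, Prod.snd_sum]
  simp only [john, fderiv_dirDeriv h hp]
  rw [e1, e2]
  simp only [map_sum, map_smul, sum_apply, smul_apply, Complex.real_smul, mul_sub,
    Finset.sum_sub_distrib]

lemma john_neg_swap {E : Type} [NormedAddCommGroup E] [InnerProductSpace ℝ E] (a b : E)
    (Ψ : E × E → ℂ) (p : E × E) : john a b Ψ p = -john b a Ψ p := by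
  rw [john, john, neg_sub]

/-- The iterated John equations of order `m + 1`. -/
def Killed {n : ℕ} : ℕ → (Euc n × Euc n → ℂ) → Prop
  | 0, Ψ => ∀ i j, ∀ p ∈ nonzeroDir (Euc n), john (basisVec i) (basisVec j) Ψ p = 0
  | m + 1, Ψ => ∀ i j, Killed m (john (basisVec i) (basisVec j) Ψ)

lemma Killed.congr {m : ℕ} : ∀ {Ψ Φ : Euc n × Euc n → ℂ},
    Set.EqOn Ψ Φ (nonzeroDir (Euc n)) → Killed m Ψ → Killed m Φ := by
  induction m with
  | zero => exact fun h hΨ i j p hp => by rw [← john_congr h _ _ hp]; exact hΨ i j p hp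
  | succ m ih => exact fun h hΨ i j => ih (john_congr h _ _) (hΨ i j)

lemma john_eq_zero_of_killed {Ψ : Euc n × Euc n → ℂ} (h : ContDiffOn ℝ ∞ Ψ (nonzeroDir (Euc n)))
    (hΨ : Killed 0 Ψ) (a b : Euc n) : ∀ p ∈ nonzeroDir (Euc n), john a b Ψ p = 0 := by
  intro p hp
  rw [john_eq_sum_right h hp]
  refine Finset.sum_eq_zero fun j _ => ?_
  rw [john_neg_swap, john_eq_sum_right h hp, Finset.sum_eq_zero fun i _ => ?_, neg_zero, mul_zero]
  rw [hΨ j i p hp, mul_zero]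

/-- The monomial `ξ_{J 1} ⋯ ξ_{J m}`. -/
def monomial {m : ℕ} (J : Fin m → Fin n) (ξ : Euc n) : ℂ := ∏ a, (ξ (J a) : ℂ)

lemma monomial_cons {m : ℕ} (j : Fin n) (J : Fin m → Fin n) (ξ : Euc n) :
    monomial (Fin.cons j J : Fin (m + 1) → Fin n) ξ = (ξ j : ℂ) * monomial J ξ := by
  simp [monomial, Fin.prod_univ_succ]

lemma sum_cons {m : ℕ} {M : Type*} [AddCommMonoid M] (F : (Fin (m + 1) → Fin n) → M) :
    ∑ K, F K = ∑ j, ∑ J : Fin m → Fin n, F (Fin.cons j J) := by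
  rw [← Fintype.sum_prod_type']
  exact (Fintype.sum_equiv (Fin.consEquiv fun _ => Fin n) _ _ fun _ => rfl).symm

/-- The contraction of a tensor field with `m` copies of the vector `ξ`. -/
def contract {m : ℕ} (f : (Fin m → Fin n) → 𝓢(Euc n, ℂ)) (ξ : Euc n) : 𝓢(Euc n, ℂ) :=
  ∑ J, monomial J ξ • f J

/-- Represents a function as a tensor ray transform on unit directions. -/
def IsTransform {m : ℕ} (Ψ : Euc n × Euc n → ℂ) (f : (Fin m → Fin n) → 𝓢(Euc n, ℂ)) : Prop :=
  ∀ x ξ : Euc n, ‖ξ‖ = 1 → Ψ (x, ξ) = rayMoment 0 (contract f ξ) (x, ξ)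

lemma rayMoment_sub {E : Type} [NormedAddCommGroup E] [InnerProductSpace ℝ E] {k : ℕ}
    (f g : 𝓢(E, ℂ)) {p : E × E} (hp : p ∈ nonzeroDir E) :
    rayMoment k (f - g) p = rayMoment k f p - rayMoment k g p := by
  have : f - g = f + (-1 : ℂ) • g := by simp [sub_eq_add_neg]
  rw [this, rayMoment_add _ _ hp, rayMoment_smul]
  ring

/-- Fields chosen separately for each pair have antisymmetric transforms but need not be
antisymmetric themselves. Antisymmetry of the fields is what makes `⟪ξ, a⟫` vanish off `ξᗮ` too. -/
lemma exists_antisymm_transform {m : ℕ} {Ψ : Euc n × Euc n → ℂ}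
    (h : ∀ i j, ∃ g : (Fin m → Fin n) → 𝓢(Euc n, ℂ),
      IsTransform (john (basisVec i) (basisVec j) Ψ) g) :
    ∃ f : Fin n → Fin n → (Fin m → Fin n) → 𝓢(Euc n, ℂ), (∀ i j J, f i j J = -f j i J) ∧
      ∀ i j, IsTransform (john (basisVec i) (basisVec j) Ψ) (f i j) := by
  choose g hg using h
  refine ⟨fun i j J => (2⁻¹ : ℂ) • (g i j J - g j i J), fun i j J => ?_, fun i j x ξ hξ => ?_⟩
  · rw [← smul_neg, neg_sub]
  · have hp : ((x, ξ) : Euc n × Euc n) ∈ nonzeroDir (Euc n) := by rintro rfl; simp at hξ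
    have e : contract (fun J => (2⁻¹ : ℂ) • (g i j J - g j i J)) ξ
        = (2⁻¹ : ℂ) • (contract (g i j) ξ - contract (g j i) ξ) := by
      simp only [contract, ← Finset.sum_sub_distrib, Finset.smul_sum]
      exact Finset.sum_congr rfl fun J _ => by rw [smul_comm, smul_sub (monomial J ξ)]
    rw [e, rayMoment_smul, rayMoment_sub _ _ hp, ← hg i j x ξ hξ, ← hg j i x ξ hξ,
      john_neg_swap (basisVec j)]
    ring

lemma sum_mul_mul_eq_zero_of_antisymm (ξ : Euc n) {c : Fin n → Fin n → ℂ}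
    (hc : ∀ i j, c i j = -c j i) : ∑ i, (ξ i : ℂ) * ∑ j, (ξ j : ℂ) * c i j = 0 := by
  have h : ∑ i, ∑ j, (ξ i : ℂ) * ((ξ j : ℂ) * c i j)
      = -∑ i, ∑ j, (ξ i : ℂ) * ((ξ j : ℂ) * c i j) := by
    conv_lhs => rw [Finset.sum_comm]
    simp only [← Finset.sum_neg_distrib]
    exact Finset.sum_congr rfl fun i _ => Finset.sum_congr rfl fun j _ => by rw [hc j i]; ring
  simp only [Finset.mul_sum]
  exact self_eq_neg.1 h

/-- The iterated John equations imply solvability of the ray transform. -/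
theorem exists_transform_of_killed (hn : 3 ≤ n) (m : ℕ) : ∀ {Ψ : Euc n × Euc n → ℂ},
    RayLike m Ψ → Killed m Ψ → ∃ f : (Fin m → Fin n) → 𝓢(Euc n, ℂ), IsTransform Ψ f := by
  induction m with
  | zero =>
    intro Ψ h hK
    obtain ⟨f, hf⟩ := exists_rayMoment_of_john (by simpa using hn) h
      (john_eq_zero_of_killed h.smooth hK)
    refine ⟨fun _ => f, fun x ξ hξ => ?_⟩
    rw [hf x ξ hξ]
    simp [contract, monomial]
  | succ m ih =>
    intro Ψ h hK
    obtain ⟨f, hanti, hf⟩ := exists_antisymm_transform fun i j => ih (h.john _ _) (hK i j)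
    -- `2πi` comes from the Fourier transform of `∂_{x_i}`, and `m + 1` from Euler's identity.
    set c : ℂ := 2 * π * Complex.I * ((m : ℂ) + 1) with hc
    have hc0 : c ≠ 0 := mul_ne_zero Complex.two_pi_I_ne_zero (by exact_mod_cast m.succ_ne_zero)
    -- The index contracted by Euler's identity becomes the first index of the new tensor. `A` is
    -- free of `ξ`, so the tensor field built from it is too.
    set A : (Fin (m + 1) → Fin n) → Fin n → 𝓢(Euc n, ℂ) := fun K i => 𝓕 (f i (K 0) (Fin.tail K))
      with hA
    refine ⟨fun K => 𝓕⁻ (c⁻¹ • radialQuotient (A K)), fun x ξ hξ =>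
      eq_rayMoment_of_fourier_eq h _ hξ (fun y hy => ?_) x⟩
    have hξ0 : ξ ≠ 0 := by rintro rfl; simp at hξ
    have h1 := inner_self_of_unit hξ
    set a : Fin n → 𝓢(Euc n, ℂ) := ∑ K, monomial K ξ • A K with ha
    set G : 𝓢(Euc n, ℂ) := c • 𝓕 (h.stripDecay.toSchwartz h1) with hG
    have hGy : ∀ y, G y = c * 𝓕 (cutoff Ψ ξ ξ) y := fun y => by
      rw [hG, smul_apply, SchwartzMap.fourier_coe, StripDecay.coe_toSchwartz, smul_eq_mul]
    have haf : ∀ i, a i = 𝓕 (∑ j, (ξ j : ℂ) • contract (f i j) ξ) := by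
      intro i
      rw [ha, Finset.sum_apply, sum_cons, FourierTransform.fourier_sum]
      refine Finset.sum_congr rfl fun j _ => ?_
      rw [FourierTransform.fourier_smul, contract, FourierTransform.fourier_sum, Finset.smul_sum]
      refine Finset.sum_congr rfl fun J _ => ?_
      rw [FourierTransform.fourier_smul, smul_smul, Pi.smul_apply, monomial_cons, hA]
      simp
    have ha0 : ∀ y, ∑ i, (ξ i : ℂ) * a i y = 0 := by
      intro y
      have := sum_mul_mul_eq_zero_of_antisymm ξ (c := fun i j => 𝓕 (contract (f i j) ξ) y)
        (fun i j => by
          have : contract (f i j) ξ = -contract (f j i) ξ := by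
            simp only [contract, ← Finset.sum_neg_distrib]
            exact Finset.sum_congr rfl fun J _ => by rw [hanti i j J, smul_neg]
          rw [this, FourierTransform.fourier_neg, neg_apply])
      rw [← this]
      refine Finset.sum_congr rfl fun i _ => ?_
      rw [haf, FourierTransform.fourier_sum, sum_apply]
      simp only [FourierTransform.fourier_smul, smul_apply, smul_eq_mul]
    have ha1 : ∀ y, ⟪y, ξ⟫ = 0 → ∀ i, a i y = (y i : ℂ) * G y := by
      intro y hy i
      have hslice : ∀ x, ((m : ℂ) + 1) * dirDeriv (basisVec i, 0) Ψ (x, ξ)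
          = rayMoment 0 (∑ j, (ξ j : ℂ) • contract (f i j) ξ) (x, ξ) := by
        intro x
        have hp : ((x, ξ) : Euc n × Euc n) ∈ nonzeroDir (Euc n) := hξ0
        rw [← h.john_dir (basisVec i) hp, john_eq_sum_right h.smooth hp, rayMoment_sum _ _ hp]
        exact Finset.sum_congr rfl fun j _ => by rw [rayMoment_smul, hf i j x ξ hξ]
      have e1 := fourier_cutoff_of_eq
        (Ψ := fun p => ((m : ℂ) + 1) * dirDeriv (basisVec i, 0) Ψ p) _ hξ hslice hy
      rw [haf i, ← e1, hGy]
      have e2 : cutoff (fun p => ((m : ℂ) + 1) * dirDeriv (basisVec i, 0) Ψ p) ξ ξ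
          = ((m : ℂ) + 1) • cutoff (dirDeriv (basisVec i, 0) Ψ) ξ ξ := by
        ext x; simp only [cutoff, Pi.smul_apply, smul_eq_mul, Complex.real_smul]; ring
      have e3 : 𝓕 (((m : ℂ) + 1) • cutoff (dirDeriv (basisVec i, 0) Ψ) ξ ξ) y
          = ((m : ℂ) + 1) * 𝓕 (cutoff (dirDeriv (basisVec i, 0) Ψ) ξ ξ) y := by
        rw [fourier_eq_mul, fourier_eq_mul, ← integral_const_mul]
        congr 1; ext x; simp only [Pi.smul_apply, smul_eq_mul]; ring
      rw [e2, e3, h.fourier_cutoff_dirDeriv hξ hy, real_inner_comm, inner_basisVec, hc]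
      ring
    -- Linearity of `radialQuotient` lets it pass through the contraction with `ξ`.
    have hfin : 𝓕 (contract (fun K => 𝓕⁻ (c⁻¹ • radialQuotient (A K))) ξ)
        = c⁻¹ • radialQuotient a := by
      rw [contract, FourierTransform.fourier_sum, ha, radialQuotient_sum, Finset.smul_sum]
      refine Finset.sum_congr rfl fun K _ => ?_
      rw [FourierTransform.fourier_smul, FourierTransform.fourier_fourierInv_eq, smul_comm]
    rw [hfin, smul_apply,
      radialQuotient_eq_of_radial (by omega) hξ ha0 ha1 hy, hGy, smul_eq_mul, ← mul_assoc,
      inv_mul_cancel₀ hc0, one_mul]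

end Coordinates

/-! ### Ray transforms satisfy the iterated John equations -/

section Necessity

variable {n : ℕ}

lemma lineDeriv_comm {E : Type} [NormedAddCommGroup E] [NormedSpace ℝ E] (f : 𝓢(E, ℂ)) (a b : E) :
    (∂_{a} (∂_{b} f : 𝓢(E, ℂ)) : 𝓢(E, ℂ)) = ∂_{b} (∂_{a} f : 𝓢(E, ℂ)) := by
  have key : ∀ (a b x : E), (∂_{a} (∂_{b} f : 𝓢(E, ℂ)) : 𝓢(E, ℂ)) x
      = fderiv ℝ (fderiv ℝ f) x a b := by
    intro a b x
    have hd : DifferentiableAt ℝ (fderiv ℝ f) x :=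
      (SchwartzMap.fderivCLM ℝ E ℂ f).differentiableAt
    have e : ((∂_{b} f : 𝓢(E, ℂ)) : E → ℂ) = fun y => fderiv ℝ f y b :=
      funext fun y => SchwartzMap.lineDerivOp_apply_eq_fderiv b f y
    rw [SchwartzMap.lineDerivOp_apply_eq_fderiv, e, fderiv_clm_apply hd (differentiableAt_const b)]
    simp
  ext x
  rw [key, key]
  exact ((f.smooth ⊤).contDiffAt.isSymmSndFDerivAt (by simp; exact ENat.LEInfty.out)).eq _ _

lemma lineDeriv_zero_vec {E : Type} [NormedAddCommGroup E] [NormedSpace ℝ E] (f : 𝓢(E, ℂ)) :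
    (∂_{(0 : E)} f : 𝓢(E, ℂ)) = 0 := by
  ext x
  simp

/-- Polynomials of degree at most `m`, described by their derivatives. -/
def PolyDeg {n : ℕ} : ℕ → (Euc n → ℂ) → Prop
  | 0, M => ∃ c, M = fun _ => c
  | m + 1, M => Differentiable ℝ M ∧ ∀ j, PolyDeg m fun ξ => fderiv ℝ M ξ (basisVec j)

lemma PolyDeg.differentiable {m : ℕ} {M : Euc n → ℂ} (h : PolyDeg m M) : Differentiable ℝ M := by
  cases m with
  | zero => obtain ⟨c, rfl⟩ := h; exact differentiable_const c
  | succ m => exact h.1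

lemma PolyDeg.deriv {m : ℕ} {M : Euc n → ℂ} (h : PolyDeg m M) (j : Fin n) :
    Differentiable ℝ fun ξ => fderiv ℝ M ξ (basisVec j) := by
  cases m with
  | zero => obtain ⟨c, rfl⟩ := h; simp
  | succ m => exact (h.2 j).differentiable

lemma PolyDeg.add {m : ℕ} : ∀ {M M' : Euc n → ℂ}, PolyDeg m M → PolyDeg m M' →
    PolyDeg m fun ξ => M ξ + M' ξ := by
  induction m with
  | zero => rintro _ _ ⟨c, rfl⟩ ⟨c', rfl⟩; exact ⟨c + c', rfl⟩
  | succ m ih =>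
    refine fun h h' => ⟨h.1.fun_add h'.1, fun j => ?_⟩
    have := ih (h.2 j) (h'.2 j)
    convert this using 2 with ξ
    rw [fderiv_fun_add (h.1 ξ) (h'.1 ξ), add_apply]

lemma PolyDeg.const_mul {m : ℕ} (c : ℂ) : ∀ {M : Euc n → ℂ}, PolyDeg m M →
    PolyDeg m fun ξ => c * M ξ := by
  induction m with
  | zero => rintro _ ⟨c', rfl⟩; exact ⟨c * c', rfl⟩
  | succ m ih =>
    refine fun h => ⟨h.1.const_mul c, fun j => ?_⟩
    have := ih (h.2 j)
    convert this using 2 with ξ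
    rw [fderiv_const_mul (h.1 ξ)]
    simp

lemma hasFDerivAt_coord (i : Fin n) (ξ : Euc n) :
    HasFDerivAt (fun ξ : Euc n => (ξ i : ℂ))
      (Complex.ofRealCLM.comp (EuclideanSpace.proj i : Euc n →L[ℝ] ℝ)) ξ :=
  (Complex.ofRealCLM.comp (EuclideanSpace.proj i : Euc n →L[ℝ] ℝ)).hasFDerivAt

lemma fderiv_coord_mul (i j : Fin n) {M : Euc n → ℂ} (h : Differentiable ℝ M) (ξ : Euc n) :
    fderiv ℝ (fun ξ => (ξ i : ℂ) * M ξ) ξ (basisVec j)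
      = (if i = j then 1 else 0) * M ξ + (ξ i : ℂ) * fderiv ℝ M ξ (basisVec j) := by
  rw [((hasFDerivAt_coord i ξ).fun_mul (h ξ).hasFDerivAt).fderiv]
  by_cases hij : i = j
  · subst hij; simp; ring
  · simp [hij]

lemma PolyDeg.coord_mul {m : ℕ} (i : Fin n) : ∀ {M : Euc n → ℂ}, PolyDeg m M →
    PolyDeg (m + 1) fun ξ => (ξ i : ℂ) * M ξ := by
  induction m with
  | zero =>
    rintro _ ⟨c, rfl⟩
    refine ⟨fun ξ => ((hasFDerivAt_coord i ξ).differentiableAt.mul_const c), fun j =>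
      ⟨(if i = j then 1 else 0) * c, funext fun ξ => ?_⟩⟩
    rw [fderiv_coord_mul i j (differentiable_const c)]
    simp
  | succ m ih =>
    refine fun h => ⟨fun ξ => (hasFDerivAt_coord i ξ).differentiableAt.fun_mul (h.1 ξ), fun j => ?_⟩
    have := (h.const_mul (if i = j then 1 else 0)).add (ih (h.2 j))
    convert this using 2 with ξ
    exact fderiv_coord_mul i j h.1 ξ

lemma polyDeg_monomial {m : ℕ} (J : Fin m → Fin n) : PolyDeg m (monomial J) := by
  induction m with
  | zero => exact ⟨1, funext fun ξ => by simp [monomial]⟩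
  | succ m ih =>
    have := (ih (Fin.tail J)).coord_mul (J 0)
    convert this using 2 with ξ
    rw [← monomial_cons, Fin.cons_self_tail]

/-- Ray transforms with coefficients depending on the direction. -/
def transformSum {ι : Type} [Fintype ι] (M : ι → Euc n → ℂ) (f : ι → 𝓢(Euc n, ℂ))
    (p : Euc n × Euc n) : ℂ := ∑ l, M l p.2 * rayMoment 0 (f l) p

lemma hasFDerivAt_coeff_mul_rayMoment {M : Euc n → ℂ} (hM : Differentiable ℝ M) (k : ℕ)
    (f : 𝓢(Euc n, ℂ)) {p : Euc n × Euc n} (hp : p ∈ nonzeroDir (Euc n)) :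
    DifferentiableAt ℝ (fun p : Euc n × Euc n => M p.2 * rayMoment k f p) p ∧
    ∀ a b, dirDeriv (a, b) (fun p => M p.2 * rayMoment k f p) p
      = M p.2 * (rayMoment k (∂_{a} f) p + rayMoment (k + 1) (∂_{b} f) p)
        + fderiv ℝ M p.2 b * rayMoment k f p := by
  have h1 : HasFDerivAt (fun p : Euc n × Euc n => M p.2)
      ((fderiv ℝ M p.2).comp (ContinuousLinearMap.snd ℝ (Euc n) (Euc n))) p :=
    (hM p.2).hasFDerivAt.comp p hasFDerivAt_snd
  have h2 := differentiableAt_rayMoment k f hp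
  refine ⟨h1.differentiableAt.fun_mul h2, fun a b => ?_⟩
  rw [dirDeriv_mul h1.differentiableAt h2, dirDeriv_rayMoment k f hp]
  congr 2
  rw [dirDeriv, h1.fderiv]
  rfl

lemma dirDeriv_sum {E ι : Type} [NormedAddCommGroup E] [InnerProductSpace ℝ E] [Fintype ι]
    {F : ι → E × E → ℂ} {p : E × E} (h : ∀ l, DifferentiableAt ℝ (F l) p) (v : E × E) :
    dirDeriv v (fun q => ∑ l, F l q) p = ∑ l, dirDeriv v (F l) p := by
  rw [dirDeriv, fderiv_fun_sum fun l _ => h l, sum_apply]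
  rfl

lemma dirDeriv_dirDeriv_transformSum {ι : Type} [Fintype ι] {m : ℕ} {M : ι → Euc n → ℂ}
    (hM : ∀ l, PolyDeg m (M l)) (f : ι → 𝓢(Euc n, ℂ)) (i j : Fin n) {p : Euc n × Euc n}
    (hp : p ∈ nonzeroDir (Euc n)) :
    dirDeriv (basisVec i, 0) (dirDeriv (0, basisVec j) (transformSum M f)) p
      = ∑ l, (M l p.2 * rayMoment 1 (∂_{basisVec i} (∂_{basisVec j} (f l) : 𝓢(Euc n, ℂ))) p
        + fderiv ℝ (M l) p.2 (basisVec j) * rayMoment 0 (∂_{basisVec i} (f l)) p) := by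
  have h1 : Set.EqOn (dirDeriv (0, basisVec j) (transformSum M f))
      (fun p => ∑ l, (M l p.2 * rayMoment 1 (∂_{basisVec j} (f l)) p
        + fderiv ℝ (M l) p.2 (basisVec j) * rayMoment 0 (f l) p)) (nonzeroDir (Euc n)) := by
    intro p hp
    have hl := fun l => hasFDerivAt_coeff_mul_rayMoment (hM l).differentiable 0 (f l) hp
    change dirDeriv _ (fun p => ∑ l, M l p.2 * rayMoment 0 (f l) p) p = _
    rw [dirDeriv_sum fun l => (hl l).1]
    refine Finset.sum_congr rfl fun l _ => ?_
    rw [(hl l).2, lineDeriv_zero_vec, rayMoment_zero_fun, zero_add]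
  rw [dirDeriv_congr h1 _ hp]
  have ha := fun l =>
    hasFDerivAt_coeff_mul_rayMoment (hM l).differentiable 1 (∂_{basisVec j} (f l) : 𝓢(Euc n, ℂ)) hp
  have hb := fun l => hasFDerivAt_coeff_mul_rayMoment ((hM l).deriv j) 0 (f l) hp
  rw [dirDeriv_sum fun l => (ha l).1.fun_add (hb l).1]
  refine Finset.sum_congr rfl fun l _ => ?_
  rw [dirDeriv_add (ha l).1 (hb l).1, (ha l).2, (hb l).2]
  simp [rayMoment_zero_fun]

/-- The terms in which both derivatives fall on the integral are first moments of `∂_i ∂_j f`,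
symmetric in `i, j`, and cancel. What remains has the same shape with differentiated coefficients,
over two copies of the index set. -/
lemma john_transformSum {ι : Type} [Fintype ι] {m : ℕ} {M : ι → Euc n → ℂ}
    (hM : ∀ l, PolyDeg m (M l)) (f : ι → 𝓢(Euc n, ℂ)) (i j : Fin n) {p : Euc n × Euc n}
    (hp : p ∈ nonzeroDir (Euc n)) :
    john (basisVec i) (basisVec j) (transformSum M f) p
      = transformSum (ι := ι ⊕ ι)
        (Sum.elim (fun l ξ => fderiv ℝ (M l) ξ (basisVec j))
          (fun l ξ => -1 * fderiv ℝ (M l) ξ (basisVec i)))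
        (Sum.elim (fun l => ∂_{basisVec i} (f l)) (fun l => ∂_{basisVec j} (f l))) p := by
  rw [john, dirDeriv_dirDeriv_transformSum hM f i j hp, dirDeriv_dirDeriv_transformSum hM f j i hp,
    transformSum, Fintype.sum_sum_type, ← Finset.sum_sub_distrib, ← Finset.sum_add_distrib]
  refine Finset.sum_congr rfl fun l _ => ?_
  rw [lineDeriv_comm (f l) (basisVec j)]
  simp only [Sum.elim_inl, Sum.elim_inr]
  ring

lemma killed_transformSum (m : ℕ) : ∀ {ι : Type} [Fintype ι] {M : ι → Euc n → ℂ}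
    (_ : ∀ l, PolyDeg m (M l)) (f : ι → 𝓢(Euc n, ℂ)), Killed m (transformSum M f) := by
  induction m with
  | zero =>
    intro ι _ M hM f i j p hp
    rw [john_transformSum hM f i j hp, transformSum]
    refine Finset.sum_eq_zero fun l _ => ?_
    rcases l with l | l <;> obtain ⟨c, hc⟩ := hM l <;> simp [hc]
  | succ m ih =>
    intro ι _ M hM f i j
    refine Killed.congr (fun p hp => (john_transformSum hM f i j hp).symm) (ih ?_ _)
    rintro (l | l)
    · exact (hM l).2 j
    · exact ((hM l).2 i).const_mul (-1)

end Necessity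

/-! ### Homogeneous extensions from the sphere bundle -/

section Extension

variable {n : ℕ}

lemma TSphere_mem (p : TSphere n) : (p.pos, p.dir) ∈ nonzeroDir (Euc n) := by
  have h : ‖p.dir‖ = 1 := p.2.1
  intro h0
  have h0 : p.dir = 0 := h0
  rw [h0, norm_zero] at h
  exact zero_ne_one h

lemma extend_of_mem (φ : TSphere n → ℂ) {p : Euc n × Euc n} (hp : p ∈ nonzeroDir (Euc n)) :
    TSphere.extend φ p = φ (TSphere.proj p hp) := by
  have hp' : p.2 ≠ 0 := hp
  rw [TSphere.extend, dif_pos hp']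

lemma TSphere_ext {p q : TSphere n} (h1 : p.pos = q.pos) (h2 : p.dir = q.dir) : p = q :=
  Subtype.ext (Prod.ext h1 h2)

/-- The shear and scaling parameters that bring `(x, ξ)` to `T𝕊ⁿ⁻¹`. -/
lemma shearScale_proj {p : Euc n × Euc n} (hp : p ∈ nonzeroDir (Euc n)) :
    shearScale (-(⟪p.1, p.2⟫ / ‖p.2‖ ^ 2)) (inv_ne_zero (norm_ne_zero_iff.2 hp)) p
      = ((TSphere.proj p hp).pos, (TSphere.proj p hp).dir) := by
  rw [shearScale_apply, neg_smul, ← sub_eq_add_neg]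
  rfl

lemma proj_shearScale {p : Euc n × Euc n} (hp : p ∈ nonzeroDir (Euc n)) (t : ℝ) {r : ℝ}
    (hr : 0 < r) :
    TSphere.proj (shearScale t hr.ne' p) (shearScale_mem t hr.ne' hp) = TSphere.proj p hp := by
  have h0 : ‖p.2‖ ≠ 0 := norm_ne_zero_iff.2 hp
  refine TSphere_ext ?_ ?_
  · change p.1 + t • p.2 - (⟪p.1 + t • p.2, r • p.2⟫ / ‖r • p.2‖ ^ 2) • (r • p.2)
      = p.1 - (⟪p.1, p.2⟫ / ‖p.2‖ ^ 2) • p.2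
    rw [inner_smul_right, inner_add_left, real_inner_smul_left, real_inner_self_eq_norm_sq,
      norm_smul, Real.norm_of_nonneg hr.le, smul_smul, add_sub_assoc, ← sub_smul, sub_eq_add_neg,
      sub_eq_add_neg, ← neg_smul]
    congr 2
    field_simp
    ring
  · change ‖r • p.2‖⁻¹ • (r • p.2) = ‖p.2‖⁻¹ • p.2
    rw [norm_smul, Real.norm_of_nonneg hr.le, smul_smul]
    congr 1
    field_simp

lemma proj_TSphere (p : TSphere n) : TSphere.proj (p.pos, p.dir) (TSphere_mem p) = p := by
  have h1 : ‖p.dir‖ = 1 := p.2.1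
  have h2 : ⟪p.pos, p.dir⟫ = 0 := p.2.2
  refine TSphere_ext ?_ ?_
  · change p.pos - (⟪p.pos, p.dir⟫ / ‖p.dir‖ ^ 2) • p.dir = p.pos
    rw [h2]; simp
  · change ‖p.dir‖⁻¹ • p.dir = p.dir
    rw [h1]; simp

lemma extend_TSphere (φ : TSphere n → ℂ) (p : TSphere n) :
    TSphere.extend φ (p.pos, p.dir) = φ p := by
  rw [extend_of_mem φ (TSphere_mem p), proj_TSphere]

lemma extend_shearScale (φ : TSphere n → ℂ) {p : Euc n × Euc n} (hp : p ∈ nonzeroDir (Euc n))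
    (t : ℝ) {r : ℝ} (hr : 0 < r) :
    TSphere.extend φ (shearScale t hr.ne' p) = TSphere.extend φ p := by
  rw [extend_of_mem φ (shearScale_mem t hr.ne' hp), proj_shearScale hp t hr, extend_of_mem φ hp]

lemma extend_shearInvariant (φ : TSphere n → ℂ) : ShearInvariant (TSphere.extend φ) :=
  fun p hp t => by simpa using extend_shearScale φ hp t (r := 1) one_pos

lemma contDiffOn_norm_zpow (d : ℤ) :
    ContDiffOn ℝ ∞ (fun p : Euc n × Euc n => ‖p.2‖ ^ d) (nonzeroDir (Euc n)) := by
  intro p hp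
  refine ContDiffAt.contDiffWithinAt ?_
  have h1 : ContDiffAt ℝ ∞ (fun p : Euc n × Euc n => ‖p.2‖ ^ (d : ℝ)) p :=
    ContDiffAt.rpow_const_of_ne (f := fun p : Euc n × Euc n => ‖p.2‖)
      (contDiffAt_snd.norm ℝ hp) (norm_ne_zero_iff.2 hp)
  simpa only [Real.rpow_intCast] using h1

/-- A function smooth on `{ξ ≠ 0}` restricts to a smooth function on `T𝕊ⁿ⁻¹`. -/
lemma isSmooth_of_eq {ψ : TSphere n → ℂ} {H : Euc n × Euc n → ℂ}
    (hH : ContDiffOn ℝ ∞ H (nonzeroDir (Euc n))) (h : ∀ p : TSphere n, ψ p = H (p.pos, p.dir)) :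
    TSphere.IsSmooth ψ := by
  have hinv : ContDiffOn ℝ ∞ (fun p : Euc n × Euc n => ‖p.2‖⁻¹) (nonzeroDir (Euc n)) := by
    simpa using contDiffOn_norm_zpow (n := n) (-1)
  have hinv2 : ContDiffOn ℝ ∞ (fun p : Euc n × Euc n => ⟪p.1, p.2⟫ / ‖p.2‖ ^ 2)
      (nonzeroDir (Euc n)) := by
    simp only [div_eq_mul_inv, ← inv_pow]
    exact (contDiff_fst.inner ℝ contDiff_snd).contDiffOn.mul (hinv.pow 2)
  have hπ : ContDiffOn ℝ ∞ (fun p : Euc n × Euc n =>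
      (p.1 - (⟪p.1, p.2⟫ / ‖p.2‖ ^ 2) • p.2, ‖p.2‖⁻¹ • p.2)) (nonzeroDir (Euc n)) :=
    (contDiff_fst.contDiffOn.sub (hinv2.smul contDiff_snd.contDiffOn)).prodMk
      (hinv.smul contDiff_snd.contDiffOn)
  refine (hH.comp hπ fun p hp => TSphere_mem (TSphere.proj p hp)).congr fun p hp => ?_
  rw [extend_of_mem ψ hp, h]
  rfl

/-- Functions with the same behaviour under shears and positive scalings agree as soon as they
agree on `T𝕊ⁿ⁻¹`. -/
lemma eqOn_of_homogeneous {Ψ Φ : Euc n × Euc n → ℂ} {c : ℝ → ℂ} (hc : ∀ r, 0 < r → c r ≠ 0)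
    (hΨ : ∀ p ∈ nonzeroDir (Euc n), ∀ (t : ℝ) {r : ℝ} (hr : 0 < r),
      Ψ (shearScale t hr.ne' p) = c r * Ψ p)
    (hΦ : ∀ p ∈ nonzeroDir (Euc n), ∀ (t : ℝ) {r : ℝ} (hr : 0 < r),
      Φ (shearScale t hr.ne' p) = c r * Φ p)
    (h : ∀ p : TSphere n, Ψ (p.pos, p.dir) = Φ (p.pos, p.dir)) :
    Set.EqOn Ψ Φ (nonzeroDir (Euc n)) := by
  intro p hp
  have hr : 0 < ‖p.2‖⁻¹ := inv_pos.2 (norm_pos_iff.2 hp)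
  have h1 := hΨ p hp (-(⟪p.1, p.2⟫ / ‖p.2‖ ^ 2)) hr
  have h2 := hΦ p hp (-(⟪p.1, p.2⟫ / ‖p.2‖ ^ 2)) hr
  rw [shearScale_proj hp, h] at h1
  rw [shearScale_proj hp] at h2
  exact mul_left_cancel₀ (hc _ hr) (h1.symm.trans h2)

/-- The extension of `φ` that is homogeneous of degree `d` in the direction. -/
def homExtend (d : ℤ) (φ : TSphere n → ℂ) (p : Euc n × Euc n) : ℂ :=
  ((‖p.2‖ ^ d : ℝ) : ℂ) * TSphere.extend φ p

lemma homExtend_TSphere (d : ℤ) (φ : TSphere n → ℂ) (p : TSphere n) :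
    homExtend d φ (p.pos, p.dir) = φ p := by
  have h1 : ‖p.dir‖ = 1 := p.2.1
  rw [homExtend, extend_TSphere, h1]
  simp

lemma homExtend_shearScale (d : ℤ) (φ : TSphere n → ℂ) : ∀ p ∈ nonzeroDir (Euc n),
    ∀ (t : ℝ) {r : ℝ} (hr : 0 < r),
      homExtend d φ (shearScale t hr.ne' p) = ((r ^ d : ℝ) : ℂ) * homExtend d φ p := by
  intro p hp t r hr
  rw [homExtend, extend_shearScale φ hp t hr, homExtend, shearScale_apply]
  dsimp only
  rw [norm_smul, Real.norm_of_nonneg hr.le, mul_zpow]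
  push_cast
  ring

lemma contDiffOn_homExtend (d : ℤ) {φ : TSphere n → ℂ} (hφ : TSphere.IsSmooth φ) :
    ContDiffOn ℝ ∞ (homExtend d φ) (nonzeroDir (Euc n)) :=
  (Complex.ofRealCLM.contDiff.comp_contDiffOn (contDiffOn_norm_zpow d)).mul hφ

lemma john_homExtend_shearScale (d : ℤ) {φ : TSphere n → ℂ} (hφ : TSphere.IsSmooth φ)
    (a b : Euc n) : ∀ p ∈ nonzeroDir (Euc n), ∀ (t : ℝ) {r : ℝ} (hr : 0 < r),
      john a b (homExtend d φ) (shearScale t hr.ne' p)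
        = ((r ^ (d - 1) : ℝ) : ℂ) * john a b (homExtend d φ) p := by
  intro p hp t r hr
  have h1 := john_eq_mul_shearScale (contDiffOn_homExtend d hφ) a b t hr.ne' (c := (r ^ d)⁻¹)
    (fun q hq => by
      rw [homExtend_shearScale d φ q hq t hr, ← mul_assoc, ← Complex.ofReal_mul,
        inv_mul_cancel₀ (zpow_pos hr d).ne', Complex.ofReal_one, one_mul]) hp
  rw [h1, ← mul_assoc, ← Complex.ofReal_mul]
  have : r ^ (d - 1) * ((r ^ d)⁻¹ * r) = 1 := by
    rw [zpow_sub_one₀ hr.ne']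
    have := (zpow_pos hr d).ne'
    field_simp
  rw [this, Complex.ofReal_one, one_mul]

end Extension

/-! ### The intrinsic operators in terms of the extension -/

section Operators

variable {n : ℕ}

lemma fderiv_extend_scale {φ : TSphere n → ℂ} (hφ : TSphere.IsSmooth φ) {p : Euc n × Euc n}
    (hp : p ∈ nonzeroDir (Euc n)) : fderiv ℝ (TSphere.extend φ) p (0, p.2) = 0 := by
  have hd := (differentiableAt_of_nonzeroDir hφ hp).hasFDerivAt
  have hline : HasDerivAt (fun t : ℝ => ((p.1, t • p.2) : Euc n × Euc n)) (0, p.2) 1 := by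
    have := (hasDerivAt_const (1 : ℝ) p.1).prodMk ((hasDerivAt_id (1 : ℝ)).smul_const p.2)
    simpa using this
  have h1 : HasDerivAt (fun t : ℝ => TSphere.extend φ (p.1, t • p.2))
      (fderiv ℝ (TSphere.extend φ) p (0, p.2)) 1 := by
    refine HasFDerivAt.comp_hasDerivAt (l := TSphere.extend φ) (1 : ℝ)
      (f := fun t : ℝ => ((p.1, t • p.2) : Euc n × Euc n)) ?_ hline
    rwa [one_smul ℝ p.2]
  have h2 : (fun t : ℝ => TSphere.extend φ (p.1, t • p.2)) =ᶠ[𝓝 1] fun _ => TSphere.extend φ p := by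
    filter_upwards [lt_mem_nhds (zero_lt_one' ℝ)] with t ht
    simpa using extend_shearScale φ hp 0 (r := t) ht
  exact (h1.congr_of_eventuallyEq h2.symm).unique (hasDerivAt_const _ _)

lemma X_eq {φ : TSphere n → ℂ} (hφ : TSphere.IsSmooth φ) (i : Fin n) (p : TSphere n) :
    TSphere.X i φ p = dirDeriv (basisVec i, 0) (TSphere.extend φ) (p.pos, p.dir) := by
  have h1 := (extend_shearInvariant φ).fderiv_eq_zero hφ (TSphere_mem p)
  have h2 : TSphere.vecX i (p.pos, p.dir)
      = ((basisVec i, 0) : Euc n × Euc n) - p.dir i • (p.dir, 0) := by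
    simp [TSphere.vecX]
  rw [TSphere.X, h2, map_sub, map_smul, h1, smul_zero, sub_zero]
  rfl

lemma Xi_eq {φ : TSphere n → ℂ} (hφ : TSphere.IsSmooth φ) (j : Fin n) (p : TSphere n) :
    TSphere.Xi j φ p = dirDeriv (0, basisVec j) (TSphere.extend φ) (p.pos, p.dir) := by
  have h1 := (extend_shearInvariant φ).fderiv_eq_zero hφ (TSphere_mem p)
  have h0 := fderiv_extend_scale hφ (TSphere_mem p)
  have h2 : TSphere.vecXi j (p.pos, p.dir)
      = ((0, basisVec j) : Euc n × Euc n) - p.pos j • (p.dir, 0) - p.dir j • (0, p.dir) := by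
    simp [TSphere.vecXi]
  rw [TSphere.Xi, h2, map_sub, map_sub, map_smul, map_smul, h1, h0, smul_zero, smul_zero, sub_zero,
    sub_zero]
  rfl

lemma isSmooth_Xi {φ : TSphere n → ℂ} (hφ : TSphere.IsSmooth φ) (j : Fin n) :
    TSphere.IsSmooth (TSphere.Xi j φ) :=
  isSmooth_of_eq (contDiffOn_dirDeriv hφ _) fun p => Xi_eq hφ j p

/-- The extension of `Ξ_j φ` agrees with `∂_{ξ_j}` of the extension of `φ` only on `T𝕊ⁿ⁻¹`, so the
two are compared along the tangent direction `e_i - ξ_i ξ`. The correction arises since `⟨ξ, ∂_x⟩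
∂_{ξ_j}` acts as `-∂_{x_j}` on shear-invariant functions. -/
lemma X_Xi_eq {φ : TSphere n → ℂ} (hφ : TSphere.IsSmooth φ) (i j : Fin n) (p : TSphere n) :
    TSphere.X i (TSphere.Xi j φ) p
      = dirDeriv (basisVec i, 0) (dirDeriv (0, basisVec j) (TSphere.extend φ)) (p.pos, p.dir)
        + (p.dir i : ℂ) * TSphere.X j φ p := by
  have hp := TSphere_mem p
  have h1 : ‖p.dir‖ = 1 := p.2.1
  have h2 : ⟪p.pos, p.dir⟫ = 0 := p.2.2
  set v := basisVec i - p.dir i • p.dir with hv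
  have hvp : ⟪v, p.dir⟫ = 0 := by
    rw [hv, inner_sub_left, inner_basisVec, real_inner_smul_left, inner_self_of_unit h1]; ring
  have hline : HasDerivAt (fun t : ℝ => ((p.pos, p.dir) : Euc n × Euc n) + t • (v, 0)) (v, 0) 0 := by
    simpa using ((hasDerivAt_id (0 : ℝ)).smul_const ((v, 0) : Euc n × Euc n)).const_add
      ((p.pos, p.dir) : Euc n × Euc n)
  have e : ((p.pos, p.dir) : Euc n × Euc n) + (0 : ℝ) • (v, 0) = (p.pos, p.dir) := by simp
  have hcomp : ∀ F : Euc n × Euc n → ℂ, ContDiffOn ℝ ∞ F (nonzeroDir (Euc n)) →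
      HasDerivAt (fun t : ℝ => F (((p.pos, p.dir) : Euc n × Euc n) + t • (v, 0)))
        (dirDeriv (v, 0) F (p.pos, p.dir)) 0 := by
    intro F hF
    refine HasFDerivAt.comp_hasDerivAt (0 : ℝ)
      (f := fun t : ℝ => ((p.pos, p.dir) : Euc n × Euc n) + t • (v, 0)) ?_ hline
    rw [e]
    exact (differentiableAt_of_nonzeroDir hF hp).hasFDerivAt
  have hT : ∀ t : ℝ, TSphere.extend (TSphere.Xi j φ) (((p.pos, p.dir) : Euc n × Euc n) + t • (v, 0))
      = dirDeriv (0, basisVec j) (TSphere.extend φ)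
        (((p.pos, p.dir) : Euc n × Euc n) + t • (v, 0)) := by
    intro t
    let q : TSphere n := ⟨(p.pos + t • v, p.dir), h1, by
      rw [inner_add_left, real_inner_smul_left, h2, hvp]; ring⟩
    have hq : ((p.pos, p.dir) : Euc n × Euc n) + t • (v, 0) = (q.pos, q.dir) := by
      change _ = ((p.pos + t • v, p.dir) : Euc n × Euc n)
      simp
    rw [hq, extend_TSphere, Xi_eq hφ]
  have h3 := hcomp _ (isSmooth_Xi hφ j)
  rw [funext hT] at h3
  have h4 := h3.unique (hcomp _ (contDiffOn_dirDeriv hφ (0, basisVec j)))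
  have h5 : ((v, 0) : Euc n × Euc n) = (basisVec i, 0) + (-p.dir i) • (p.dir, 0) := by
    simp [hv, sub_eq_add_neg]
  have h6 := (extend_shearInvariant φ).fderiv_fderiv hφ hp (basisVec j)
  change dirDeriv (v, 0) _ _ = _
  rw [h4, h5, dirDeriv_add_vec, dirDeriv_smul_vec, h6, X_eq hφ]
  push_cast
  ring

lemma shiftedJohn_eq {φ : TSphere n → ℂ} (hφ : TSphere.IsSmooth φ) (k : ℕ) (i j : Fin n)
    (p : TSphere n) :
    TSphere.shiftedJohn k i j φ p
      = john (basisVec i) (basisVec j) (TSphere.extend φ) (p.pos, p.dir)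
        + (1 - (k : ℂ)) * ((p.dir i : ℂ) * dirDeriv (basisVec j, 0) (TSphere.extend φ) (p.pos, p.dir)
          - (p.dir j : ℂ) * dirDeriv (basisVec i, 0) (TSphere.extend φ) (p.pos, p.dir)) := by
  rw [TSphere.shiftedJohn, TSphere.intrinsicJohn, X_Xi_eq hφ, X_Xi_eq hφ, X_eq hφ, X_eq hφ, john]
  ring

lemma contDiff_coord_snd (i : Fin n) : ContDiff ℝ ∞ fun p : Euc n × Euc n => (p.2 i : ℂ) :=
  ((Complex.ofRealCLM.comp (EuclideanSpace.proj i : Euc n →L[ℝ] ℝ)).comp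
    (ContinuousLinearMap.snd ℝ (Euc n) (Euc n))).contDiff

lemma isSmooth_shiftedJohn {φ : TSphere n → ℂ} (hφ : TSphere.IsSmooth φ) (k : ℕ) (i j : Fin n) :
    TSphere.IsSmooth (TSphere.shiftedJohn k i j φ) :=
  isSmooth_of_eq ((contDiffOn_john hφ _ _).add (contDiffOn_const.mul
    (((contDiff_coord_snd i).contDiffOn.mul (contDiffOn_dirDeriv hφ _)).sub
      ((contDiff_coord_snd j).contDiffOn.mul (contDiffOn_dirDeriv hφ _)))))
    (shiftedJohn_eq hφ k i j)

lemma dirDeriv_norm_zpow (d : ℤ) {p : Euc n × Euc n} (hp : p ∈ nonzeroDir (Euc n)) (a b : Euc n) :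
    dirDeriv (a, b) (fun p : Euc n × Euc n => ((‖p.2‖ ^ d : ℝ) : ℂ)) p
      = ((d * ‖p.2‖ ^ (d - 1) * (‖p.2‖⁻¹ * ⟪p.2, b⟫) : ℝ) : ℂ) := by
  have h0 : ‖p.2‖ ≠ 0 := norm_ne_zero_iff.2 hp
  have h1 : HasFDerivAt (fun p : Euc n × Euc n => ‖p.2‖ ^ 2) _ p :=
    (hasFDerivAt_snd (𝕜 := ℝ)).norm_sq
  have h2 := h1.sqrt (pow_ne_zero 2 h0)
  simp only [Real.sqrt_sq (norm_nonneg _)] at h2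
  have h3 := ((hasDerivAt_zpow d ‖p.2‖ (Or.inl h0)).comp_hasFDerivAt p h2)
  have h4 : HasFDerivAt (fun p : Euc n × Euc n => ((‖p.2‖ ^ d : ℝ) : ℂ)) _ p :=
    Complex.ofRealCLM.hasFDerivAt.comp p h3
  rw [dirDeriv, h4.fderiv]
  simp
  exact Or.inl (by ring)

lemma john_mul {E : Type} [NormedAddCommGroup E] [InnerProductSpace ℝ E] {w F : E × E → ℂ}
    (hw : ContDiffOn ℝ ∞ w (nonzeroDir E)) (hF : ContDiffOn ℝ ∞ F (nonzeroDir E))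
    (hw0 : ∀ a : E, ∀ p ∈ nonzeroDir E, dirDeriv (a, 0) w p = 0) (a b : E) {p : E × E}
    (hp : p ∈ nonzeroDir E) :
    john a b (fun q => w q * F q) p = w p * john a b F p
      + (dirDeriv (0, b) w p * dirDeriv (a, 0) F p - dirDeriv (0, a) w p * dirDeriv (b, 0) F p) := by
  have key : ∀ a b : E, dirDeriv (a, 0) (dirDeriv (0, b) fun q => w q * F q) p
      = w p * dirDeriv (a, 0) (dirDeriv (0, b) F) p + dirDeriv (0, b) w p * dirDeriv (a, 0) F p := by
    intro a b
    have h1 : Set.EqOn (dirDeriv (0, b) fun q => w q * F q)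
        (fun q => w q * dirDeriv (0, b) F q + dirDeriv (0, b) w q * F q) (nonzeroDir E) :=
      fun q hq => dirDeriv_mul (differentiableAt_of_nonzeroDir hw hq)
        (differentiableAt_of_nonzeroDir hF hq) _
    have h2 : dirDeriv (a, 0) (dirDeriv (0, b) w) p = 0 := by
      rw [dirDeriv_comm hw hp, dirDeriv_congr (Φ := fun _ => 0) (fun q hq => hw0 a q hq) _ hp]
      simp [dirDeriv]
    have dw := differentiableAt_of_nonzeroDir hw hp
    have dF := differentiableAt_of_nonzeroDir hF hp
    have dw' := differentiableAt_of_nonzeroDir (contDiffOn_dirDeriv hw (0, b)) hp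
    have dF' := differentiableAt_of_nonzeroDir (contDiffOn_dirDeriv hF (0, b)) hp
    rw [dirDeriv_congr h1 _ hp, dirDeriv_add (dw.fun_mul dF') (dw'.fun_mul dF), dirDeriv_mul dw dF',
      dirDeriv_mul dw' dF, hw0 a p hp, h2]
    ring
  rw [john, key, key, john]
  ring

/-- The weight `‖ξ‖ ^ d` does not depend on `x`, and its derivative in `ξ_j` on the unit sphere is
`d ξ_j`. For `d = k - 1` the correction is exactly the one in `shiftedJohn_eq`. -/
lemma john_homExtend_TSphere {φ : TSphere n → ℂ} (hφ : TSphere.IsSmooth φ) (d : ℤ) (i j : Fin n)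
    (p : TSphere n) :
    john (basisVec i) (basisVec j) (homExtend d φ) (p.pos, p.dir)
      = john (basisVec i) (basisVec j) (TSphere.extend φ) (p.pos, p.dir)
        + (d : ℂ) * ((p.dir j : ℂ) * dirDeriv (basisVec i, 0) (TSphere.extend φ) (p.pos, p.dir)
          - (p.dir i : ℂ) * dirDeriv (basisVec j, 0) (TSphere.extend φ) (p.pos, p.dir)) := by
  have hp := TSphere_mem p
  have h1 : ‖p.dir‖ = 1 := p.2.1
  have hw : ContDiffOn ℝ ∞ (fun p : Euc n × Euc n => ((‖p.2‖ ^ d : ℝ) : ℂ)) (nonzeroDir (Euc n)) :=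
    Complex.ofRealCLM.contDiff.comp_contDiffOn (contDiffOn_norm_zpow d)
  have hw1 : ∀ j : Fin n, dirDeriv (0, basisVec j)
      (fun p : Euc n × Euc n => ((‖p.2‖ ^ d : ℝ) : ℂ)) (p.pos, p.dir) = d * p.dir j := by
    intro j
    rw [dirDeriv_norm_zpow d hp, real_inner_comm, inner_basisVec, h1]
    simp
  have h2 := john_mul hw hφ (fun a q hq => by rw [dirDeriv_norm_zpow d hq]; simp)
    (basisVec i) (basisVec j) hp
  rw [hw1, hw1, h1] at h2
  refine h2.trans ?_
  simp
  ring

/-- The shifted John operators are the John operator on homogeneous extensions. -/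
lemma john_homExtend {φ : TSphere n → ℂ} (hφ : TSphere.IsSmooth φ) (k : ℕ) (i j : Fin n) :
    Set.EqOn (john (basisVec i) (basisVec j) (homExtend ((k : ℤ) - 1) φ))
      (homExtend ((k : ℤ) - 2) (TSphere.shiftedJohn k i j φ)) (nonzeroDir (Euc n)) := by
  refine eqOn_of_homogeneous (c := fun r => ((r ^ ((k : ℤ) - 2) : ℝ) : ℂ)) (fun r hr => ?_)
    (fun p hp t r hr => ?_) (homExtend_shearScale _ _) fun p => ?_
  · exact_mod_cast (zpow_pos hr _).ne'
  · rw [john_homExtend_shearScale _ hφ _ _ p hp t hr, sub_sub]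
    norm_num
  · rw [john_homExtend_TSphere hφ, homExtend_TSphere, shiftedJohn_eq hφ]
    push_cast
    ring

lemma johnProduct_succ {m : ℕ} (i j : Fin (m + 2) → Fin n) (φ : TSphere n → ℂ) :
    TSphere.johnProduct i j φ = TSphere.johnProduct (fun k => i (Fin.castSucc k))
      (fun k => j (Fin.castSucc k))
      (TSphere.shiftedJohn (m + 1) (i (Fin.last (m + 1))) (j (Fin.last (m + 1))) φ) := by
  rw [TSphere.johnProduct, Fin.foldr_succ_last]
  rfl

/-- The factor with `k = m` acts first and meets degree `m - 1`. Each John operator lowers the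
degree by one, in step with the decreasing shift `k`. -/
lemma johnProduct_zero_iff (m : ℕ) : ∀ {φ : TSphere n → ℂ}, TSphere.IsSmooth φ →
    ((∀ i j : Fin (m + 1) → Fin n, TSphere.johnProduct i j φ = 0) ↔
      Killed m (homExtend ((m : ℤ) - 1) φ)) := by
  induction m with
  | zero =>
    intro φ hφ
    have h0 : ∀ i j : Fin 1 → Fin n, TSphere.johnProduct i j φ
        = TSphere.shiftedJohn 0 (i 0) (j 0) φ := fun i j => by
      simp [TSphere.johnProduct, Fin.foldr_succ]
    constructor
    · intro h i j p hp
      have := h (fun _ => i) (fun _ => j)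
      rw [h0] at this
      rw [john_homExtend hφ 0 i j hp, this, homExtend, extend_of_mem _ hp]
      simp
    · intro h i j
      rw [h0]
      ext p
      have := h (i 0) (j 0) _ (TSphere_mem p)
      rwa [john_homExtend hφ 0 (i 0) (j 0) (TSphere_mem p), homExtend_TSphere] at this
  | succ m ih =>
    intro φ hφ
    have hE : ∀ i j, Set.EqOn (john (basisVec i) (basisVec j) (homExtend (((m + 1 : ℕ) : ℤ) - 1) φ))
        (homExtend ((m : ℤ) - 1) (TSphere.shiftedJohn (m + 1) i j φ)) (nonzeroDir (Euc n)) := by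
      intro i j
      have := john_homExtend hφ (m + 1) i j
      have e : (((m + 1 : ℕ) : ℤ) - 2) = (m : ℤ) - 1 := by push_cast; ring
      rwa [e] at this
    have hK : Killed (m + 1) (homExtend (((m + 1 : ℕ) : ℤ) - 1) φ) ↔
        ∀ i j, Killed m (homExtend ((m : ℤ) - 1) (TSphere.shiftedJohn (m + 1) i j φ)) :=
      forall₂_congr fun i j => ⟨Killed.congr (hE i j), Killed.congr (hE i j).symm⟩
    rw [hK]
    constructor
    · intro h a b
      refine (ih (isSmooth_shiftedJohn hφ _ a b)).1 fun i j => ?_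
      have := h (Fin.snoc i a) (Fin.snoc j b)
      rw [johnProduct_succ] at this
      simpa using this
    · intro h i j
      rw [johnProduct_succ]
      exact (ih (isSmooth_shiftedJohn hφ _ _ _)).2 (h _ _) _ _

end Operators

/-! ### Passage between functions on the sphere bundle and their lifts -/

section Lift

variable {n : ℕ}

lemma extend_neg_dir {m : ℕ} {φ : TSphere n → ℂ} (hφ : ∀ p : TSphere n, φ p.flip = (-1) ^ m * φ p)
    {p : Euc n × Euc n} (hp : p ∈ nonzeroDir (Euc n)) :
    TSphere.extend φ (p.1, -p.2) = (-1) ^ m * TSphere.extend φ p := by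
  have hp' : ((p.1, -p.2) : Euc n × Euc n) ∈ nonzeroDir (Euc n) := neg_ne_zero.2 hp
  rw [extend_of_mem φ hp', extend_of_mem φ hp, ← hφ]
  congr 1
  refine TSphere_ext ?_ ?_
  · change p.1 - (⟪p.1, -p.2⟫ / ‖-p.2‖ ^ 2) • (-p.2) = p.1 - (⟪p.1, p.2⟫ / ‖p.2‖ ^ 2) • p.2
    rw [inner_neg_right, norm_neg, neg_div, neg_smul_neg]
  · change ‖-p.2‖⁻¹ • (-p.2) = -(‖p.2‖⁻¹ • p.2)
    rw [norm_neg, smul_neg]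

lemma zpow_natCast_sub_one {r : ℝ} (hr : 0 < r) (m : ℕ) : r ^ ((m : ℤ) - 1) = r ^ m * |r|⁻¹ := by
  rw [zpow_sub_one₀ hr.ne', zpow_natCast, abs_of_pos hr]

/-- Derivatives of `w` are invariant under translations in `x`, so it suffices to bound them on the
compact unit sphere at `x = 0`. -/
lemma exists_bound_of_dir {w : Euc n × Euc n → ℂ} (hw : ContDiffOn ℝ ∞ w (nonzeroDir (Euc n)))
    (hdir : ∀ x ξ : Euc n, w (x, ξ) = w (0, ξ)) (N : ℕ) :
    ∃ C : ℝ, ∀ x ξ : Euc n, ‖ξ‖ = 1 → ‖iteratedFDeriv ℝ N w (x, ξ)‖ ≤ C := by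
  have hcont : ContinuousOn (fun ξ : Euc n => iteratedFDeriv ℝ N w (0, ξ))
      (Metric.sphere (0 : Euc n) 1) := by
    have h1 : ContinuousOn (iteratedFDeriv ℝ N w) (nonzeroDir (Euc n)) :=
      (hw.continuousOn_iteratedFDerivWithin (mod_cast le_top)
        isOpen_nonzeroDir.uniqueDiffOn).congr
        fun p hp => (iteratedFDerivWithin_of_isOpen N isOpen_nonzeroDir hp).symm
    refine h1.comp (by fun_prop) fun ξ hξ => ?_
    rw [mem_sphere_zero_iff_norm] at hξ
    change ξ ≠ 0
    rintro rfl
    simp at hξ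
  obtain ⟨C, hC⟩ := (isCompact_sphere (0 : Euc n) 1).exists_bound_of_continuousOn hcont
  refine ⟨C, fun x ξ hξ => ?_⟩
  have h2 : (fun p : Euc n × Euc n => w (p + (x, 0))) = w := by
    ext p
    rw [show p + (x, 0) = (p.1 + x, p.2) by ext <;> simp, hdir, ← hdir p.1]
  have h3 := iteratedFDeriv_comp_add_right (𝕜 := ℝ) (f := w) N ((x, 0) : Euc n × Euc n) (0, ξ)
  rw [h2] at h3
  have h4 : ((0, ξ) : Euc n × Euc n) + (x, 0) = (x, ξ) := by simp
  rw [← h4, ← h3]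
  exact hC ξ (mem_sphere_zero_iff_norm.2 hξ)

lemma rayLike_homExtend {m : ℕ} {φ : TSphere n → ℂ} (hφ : φ ∈ TSphere.schwartzParity n m) :
    RayLike m (homExtend ((m : ℤ) - 1) φ) where
  smooth := contDiffOn_homExtend _ hφ.1.1
  equivariant t r hr p hp := by
    rcases lt_or_gt_of_ne hr with h | h
    · have h' : 0 < -r := neg_pos.2 h
      -- A negative factor is the positive factor `-r` followed by `ξ ↦ -ξ`, where the parity of `φ`
      -- supplies `(-1) ^ m`.
      set q := shearScale t h'.ne' p with hq
      have e : shearScale t hr p = (q.1, -q.2) := by simp [hq]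
      have h1 : homExtend ((m : ℤ) - 1) φ (q.1, -q.2)
          = (-1) ^ m * homExtend ((m : ℤ) - 1) φ q := by
        rw [homExtend, homExtend, extend_neg_dir hφ.2 (shearScale_mem t h'.ne' hp)]
        dsimp only
        rw [norm_neg]
        ring
      rw [e, h1, hq, homExtend_shearScale _ φ p hp t h', zpow_natCast_sub_one h', ← mul_assoc,
        abs_neg]
      congr 1
      push_cast
      rw [← mul_assoc, ← mul_pow]
      ring
    · rw [← zpow_natCast_sub_one h]
      exact homExtend_shearScale _ φ p hp t h
  decay k N := by
    have hw : ContDiffOn ℝ ∞ (fun p : Euc n × Euc n => ((‖p.2‖ ^ ((m : ℤ) - 1) : ℝ) : ℂ))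
        (nonzeroDir (Euc n)) :=
      Complex.ofRealCLM.contDiff.comp_contDiffOn (contDiffOn_norm_zpow _)
    choose H hH using fun i => exists_bound_of_dir hw (fun _ _ => rfl) i
    choose C hC using fun i => hφ.1.2 k i
    refine ⟨∑ i ∈ Finset.range (N + 1), (N.choose i : ℝ) * H i * C (N - i), fun x ξ hξ hx => ?_⟩
    have hp : ((x, ξ) : Euc n × Euc n) ∈ nonzeroDir (Euc n) := by rintro rfl; simp at hξ
    have h1 := norm_iteratedFDerivWithin_mul_le (n := N) hw hφ.1.1
      isOpen_nonzeroDir.uniqueDiffOn hp (mod_cast le_top)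
    simp only [iteratedFDerivWithin_of_isOpen _ isOpen_nonzeroDir hp] at h1
    refine (mul_le_mul_of_nonneg_left h1 (by positivity)).trans ?_
    rw [Finset.mul_sum]
    refine Finset.sum_le_sum fun i _ => ?_
    have h2 := hC (N - i) ⟨(x, ξ), hξ, hx⟩
    have h2 : (1 + ‖x‖) ^ k * ‖iteratedFDeriv ℝ (N - i) (TSphere.extend φ) (x, ξ)‖ ≤ C (N - i) := h2
    have h3 := hH i x ξ hξ
    have h4 : 0 ≤ H i := (norm_nonneg _).trans h3
    calc _ = (N.choose i : ℝ) * ‖iteratedFDeriv ℝ i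
          (fun p : Euc n × Euc n => ((‖p.2‖ ^ ((m : ℤ) - 1) : ℝ) : ℂ)) (x, ξ)‖
          * ((1 + ‖x‖) ^ k * ‖iteratedFDeriv ℝ (N - i) (TSphere.extend φ) (x, ξ)‖) := by ring
      _ ≤ _ := by gcongr

lemma rayMoment_shearScale {E : Type} [NormedAddCommGroup E] [InnerProductSpace ℝ E] (f : 𝓢(E, ℂ))
    (p : E × E) (t : ℝ) {r : ℝ} (hr : 0 < r) :
    rayMoment 0 f (shearScale t hr.ne' p) = ((r⁻¹ : ℝ) : ℂ) * rayMoment 0 f p := by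
  have h1 := Measure.integral_comp_mul_right (fun s : ℝ => f (p.1 + (t + s) • p.2)) r
  have h2 := integral_add_left_eq_self (μ := volume) (fun s : ℝ => f (p.1 + s • p.2)) t
  rw [h2, abs_of_pos (inv_pos.2 hr), Complex.real_smul] at h1
  simp only [rayMoment, pow_zero, one_mul, shearScale_apply]
  rw [← h1]
  congr 1
  ext s
  rw [add_smul, smul_smul, add_assoc]

lemma monomial_smul {m : ℕ} (J : Fin m → Fin n) (r : ℝ) (ξ : Euc n) :
    monomial J (r • ξ) = (r : ℂ) ^ m * monomial J ξ := by
  simp [monomial, Finset.prod_mul_distrib]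

lemma transformSum_shearScale {m : ℕ} (f : (Fin m → Fin n) → 𝓢(Euc n, ℂ)) (p : Euc n × Euc n)
    (t : ℝ) {r : ℝ} (hr : 0 < r) :
    transformSum monomial f (shearScale t hr.ne' p)
      = ((r ^ ((m : ℤ) - 1) : ℝ) : ℂ) * transformSum monomial f p := by
  rw [transformSum, transformSum, Finset.mul_sum]
  refine Finset.sum_congr rfl fun J _ => ?_
  rw [rayMoment_shearScale (f J) p t hr, shearScale_apply, monomial_smul, zpow_natCast_sub_one hr,
    abs_of_pos hr]
  push_cast
  ring

lemma rayMoment_contract {m : ℕ} (f : (Fin m → Fin n) → 𝓢(Euc n, ℂ)) {p : Euc n × Euc n}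
    (hp : p ∈ nonzeroDir (Euc n)) : rayMoment 0 (contract f p.2) p = transformSum monomial f p := by
  rw [contract, rayMoment_sum _ _ hp, transformSum]
  exact Finset.sum_congr rfl fun J _ => rayMoment_smul _ _ _

lemma rayTransform_eq {m : ℕ} (f : SchwartzTensorField n m) (p : TSphere n) :
    rayTransform f p = rayMoment 0 (contract f.comp p.dir) (p.pos, p.dir) := by
  rw [rayTransform, rayMoment]
  congr 1
  ext t
  rw [pow_zero, one_mul, contract, sum_apply]
  exact Finset.sum_congr rfl fun J _ => mul_comm _ _

/-- The symmetrization of a tensor field. -/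
def symmetrize {m : ℕ} (f : (Fin m → Fin n) → 𝓢(Euc n, ℂ)) : SchwartzTensorField n m where
  comp i := ((m.factorial : ℂ))⁻¹ • ∑ σ : Equiv.Perm (Fin m), f (i ∘ σ)
  symm τ i := by
    congr 1
    exact Fintype.sum_equiv (Equiv.mulLeft τ) _ _ fun σ => rfl

/-- Monomials in `ξ` are symmetric in their indices, so the ray transform does not see the
symmetrization. The induction may thus work with arbitrary tensors. -/
lemma contract_symmetrize {m : ℕ} (f : (Fin m → Fin n) → 𝓢(Euc n, ℂ)) (ξ : Euc n) :
    contract (symmetrize f).comp ξ = contract f ξ := by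
  have h1 : ∀ σ : Equiv.Perm (Fin m), ∑ i : Fin m → Fin n, monomial i ξ • f (i ∘ σ)
      = contract f ξ := fun σ =>
    Fintype.sum_equiv (σ.arrowCongr (Equiv.refl (Fin n))).symm _ _ fun i => by
      have : monomial (i ∘ σ) ξ = monomial i ξ := Equiv.prod_comp σ fun a => (ξ (i a) : ℂ)
      change _ = monomial (i ∘ σ) ξ • f (i ∘ σ)
      rw [this]
  have h2 : contract (symmetrize f).comp ξ
      = (m.factorial : ℂ)⁻¹ • ∑ σ : Equiv.Perm (Fin m), contract f ξ := by
    rw [← Finset.sum_congr rfl fun σ _ => h1 σ, Finset.sum_comm, Finset.smul_sum, contract]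
    refine Finset.sum_congr rfl fun i _ => ?_
    rw [← Finset.smul_sum, smul_comm]
    rfl
  rw [h2, Finset.sum_const, Finset.card_univ, Fintype.card_perm, Fintype.card_fin,
    ← Nat.cast_smul_eq_nsmul ℂ, smul_smul, inv_mul_cancel₀ (Nat.cast_ne_zero.2 m.factorial_ne_zero),
    one_smul]

/-- The range of the ray transform is characterized by the products of shifted John operators. -/
theorem mem_range_rayTransform_iff (m : ℕ) (hn : 3 ≤ n) (φ : TSphere n → ℂ)
    (hφ : φ ∈ TSphere.schwartzParity n m) :
    φ ∈ Set.range (rayTransform : SchwartzTensorField n m → TSphere n → ℂ) ↔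
      ∀ i j : Fin (m + 1) → Fin n, TSphere.johnProduct i j φ = 0 := by
  rw [johnProduct_zero_iff m hφ.1.1]
  constructor
  · rintro ⟨f, hf⟩
    refine Killed.congr (Set.EqOn.symm ?_)
      (killed_transformSum m (fun J => polyDeg_monomial J) f.comp)
    refine eqOn_of_homogeneous (c := fun r => ((r ^ ((m : ℤ) - 1) : ℝ) : ℂ))
      (fun r hr => mod_cast (zpow_pos hr _).ne') (homExtend_shearScale _ _)
      (fun p _ t _ hr => transformSum_shearScale f.comp p t hr) fun p => ?_
    rw [homExtend_TSphere, ← rayMoment_contract f.comp (TSphere_mem p), ← hf, rayTransform_eq]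
  · intro hK
    obtain ⟨f, hf⟩ := exists_transform_of_killed hn m (rayLike_homExtend hφ) hK
    refine ⟨symmetrize f, funext fun p => ?_⟩
    rw [rayTransform_eq, contract_symmetrize, ← hf p.pos p.dir p.2.1, homExtend_TSphere]

end Lift

end

end RayTransform

theorem theorem3p1 (n m : ℕ) (hn : 3 ≤ n) (φ : TSphere n → ℂ)
    (hφ : φ ∈ TSphere.schwartzParity n m) :
    φ ∈ Set.range (rayTransform : SchwartzTensorField n m → TSphere n → ℂ) ↔
      ∀ i j : Fin (m + 1) → Fin n, TSphere.johnProduct i j φ = 0 :=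
  RayTransform.mem_range_rayTransform_iff m hn φ hφ
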